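/- **Setting.** Let $\mathcal X$ be a measurable space with countably generated $\sigma$-algebra, let $Q$ be a Markov transition kernel on $\mathcal X$ with stationary distribution $Q_0$, and let $Q_0\otimes Q$ be the law of $(X_t,X_{t+1})$ under $Q$ when $X_t\sim Q_0$. Let $\alpha\in\mathbb R$, $\beta\in(0,1)$, $r>1$ and $u:\mathcal X^2\to\mathbb R$. For $s\ge 1$ let $\phi_s(x)=e^{x^s}-1$. For a probability measure $\mu$ let $\|f\|_{L^{\phi_s}(\mu)}=\inf\{c>0:\mathbb E^\mu[\phi_s(|f|/c)]\le 1\}$, let $L^{\phi_s}(\mu)$ be the space of (classes of) measurable $f$ for which this is finite, and let $E^{\phi_s}(\mu)$ be the set of $f\in L^{\phi_s}(\mu)$ with $\mathbb E^\mu[\phi_s(|f|/c)]<\infty$ for all $c>0$. Write $L^{\phi_s},E^{\phi_s}$ when $\mu=Q_0$ and $L_2^{\phi_s},E_2^{\phi_s}$ when $\mu=Q_0\otimes Q$; the norm is written $\|\cdot\|_{\phi_s}$ in both cases. Let $\hat Q$ be another Markov transition kernel on $\mathcal X$ such that $Q(\cdot|x)\ll\hat Q(\cdot|x)\ll Q(\cdot|x)$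 for every $x$. Put $$\mathbb Tf(x)=\beta\log\mathbb E^{Q}\big[e^{f(X_{t+1})+\alpha u(X_t,X_{t+1})}\,\big|\,X_t=x\big],\qquad \hat{\mathbb T}f(x)=\beta\log\mathbb E^{\hat Q}\big[e^{f(X_{t+1})+\alpha u(X_t,X_{t+1})}\,\big|\,X_t=x\big],$$ $$\hat\ell(x_0,x_1)=\log\frac{d\hat Q(\cdot|x_0)}{dQ(\cdot|x_0)}(x_1),\qquad \hat\eta(x_0,x_1)=\hat\ell(x_0,x_1)-\mathbb E^Q[\hat\ell(X_t,X_{t+1})\,|\,X_t=x_0].$$ **Assumptions.** Assume $u\in E_2^{\phi_r}$ (Assumption U), let $M<\infty$ satisfy $M\ge\mathbb E^{Q_0\otimes Q}[\exp(|\frac{\alpha}{1-\beta}u(X_t,X_{t+1})|^r)]$, and let $\|\hat\eta\|_{\phi_1}\le 1$. Assume moreover (Assumption AM2) that (a) or (b) holds: (a) $\hat\ell\in E_2^{\phi_r}$, $\|\hat\ell\|_{\phi_r}\le M$ and $\mathbb E^{Q_0\otimes Q}[\exp(|\frac1{1-\beta}(\hat\ell(X_t,X_{t+1})+\alpha u(X_t,X_{t+1}))|^r)]\le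 M$; (b) $\hat\ell\in L_2^{\phi_1}$, there is a stationary distribution $\hat Q_0$ of $\hat Q$ with $Q_0\ll\hat Q_0\ll Q_0$, and for some $p>1$ the Radon–Nikodym derivatives $\hat\Delta=d\hat Q_0/dQ_0$ and $\hat\Delta_2=d(\hat Q_0\otimes\hat Q)/d(Q_0\otimes Q)$ satisfy $\mathbb E^{Q_0}[\hat\Delta^p]\le M$, $\mathbb E^{Q_0}[\hat\Delta^{1-p}]\le M$ and $\mathbb E^{Q_0\otimes Q}[\hat\Delta_2^p]\le M$. **Claim.** $\mathbb T$ has a fixed point $v\in E^{\phi_r}$ that is its unique fixed point in $E^{\phi_s}$ for each $1<s\le r$; likewise $\hat{\mathbb T}$ has a fixed point $\hat v\in E^{\phi_r}$ that is its unique fixed point in $E^{\phi_s}$ for each $1<s\le r$. These fixed points satisfy $$\|\hat v-v\|_{\phi_1}\le C\|\hat\eta\|_{\phi_1},\qquad C^{-1}\|\hat{\mathbb T}v-v\|_{\phi_1}\le\|\hat v-v\|_{\phi_1}\le C\|\hat{\mathbb T}v-v\|_{\phi_1},$$ where $C>0$ is a constant that depends only on $\alpha,\beta,\|u\|_{\phi_r},r,M$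 in case (a), and only on $\alpha,\beta,\|u\|_{\phi_r},r,M,p$ and $\mathbb E^{Q_0\otimes Q}[\exp(q^2|\frac{\alpha}{1-\beta}u(X_t,X_{t+1})|^r)]$, with $p^{-1}+q^{-1}=1$, in case (b). In case (a) the same inequalities, with the same kind of constant $C$ (not depending on $s$), hold with $\|\cdot\|_{\phi_s}$ in place of $\|\cdot\|_{\phi_1}$ throughout, for every $1\le s\le r$. -/

import Mathlib

open MeasureTheory ProbabilityTheory
open scoped ENNReal

noncomputable section

namespace RobustValue

/-- The expectation `E^μ[φ_r(|f| / c)]` with `φ_r(x) = exp(x ^ r) - 1`, as an extended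
nonnegative number (so that it is meaningful whether or not it is finite). -/
def orliczModular {Ω : Type*} [MeasurableSpace Ω] (r : ℝ) (f : Ω → ℝ) (μ : Measure Ω) (c : ℝ) :
    ℝ≥0∞ :=
  ∫⁻ ω, ENNReal.ofReal (Real.exp ((|f ω| / c) ^ r) - 1) ∂μ

/-- The Luxemburg norm `‖f‖_{L^{φ_r}(μ)} = inf {c > 0 : E^μ[φ_r(|f| / c)] ≤ 1}`, with value `∞`
when there is no such `c`. -/
def orliczNorm {Ω : Type*} [MeasurableSpace Ω] (r : ℝ) (f : Ω → ℝ) (μ : Measure Ω) : ℝ≥0∞ :=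
  ⨅ (c : ℝ) (_ : 0 < c ∧ orliczModular r f μ c ≤ 1), ENNReal.ofReal c

/-- Membership in the Orlicz space `L^{φ_r}(μ)`. -/
def MemOrlicz {Ω : Type*} [MeasurableSpace Ω] (r : ℝ) (f : Ω → ℝ) (μ : Measure Ω) : Prop :=
  AEMeasurable f μ ∧ orliczNorm r f μ < ∞

/-- Membership in the Orlicz heart `E^{φ_r}(μ)`. -/
def MemOrliczHeart {Ω : Type*} [MeasurableSpace Ω] (r : ℝ) (f : Ω → ℝ) (μ : Measure Ω) : Prop :=
  MemOrlicz r f μ ∧ ∀ c : ℝ, 0 < c → orliczModular r f μ c < ∞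

/-- `E^μ[exp(a |f| ^ r)]`. -/
def expMoment {Ω : Type*} [MeasurableSpace Ω] (a r : ℝ) (f : Ω → ℝ) (μ : Measure Ω) : ℝ≥0∞ :=
  ∫⁻ ω, ENNReal.ofReal (Real.exp (a * |f ω| ^ r)) ∂μ

variable {𝒳 : Type*} [MeasurableSpace 𝒳]

/-- The value recursion operator of the model `Q`:
`T f (x) = β log E^Q[exp(f(X_{t+1}) + α u(X_t, X_{t+1})) | X_t = x]`. -/
def valueOp (α β : ℝ) (u : 𝒳 × 𝒳 → ℝ) (Q : Kernel 𝒳 𝒳) (f : 𝒳 → ℝ) (x : 𝒳) : ℝ :=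
  β * Real.log (∫ y, Real.exp (f y + α * u (x, y)) ∂(Q x))

/-- `v` is the fixed point of the operator of the model `Q`: it lies in `E^{φ_r}(Q₀)` and is the
unique fixed point in `E^{φ_s}(Q₀)` for each `1 < s ≤ r`. Elements of these spaces are identified
when they agree `Q₀`-almost everywhere. -/
def IsValueFunction (α β r : ℝ) (u : 𝒳 × 𝒳 → ℝ) (Q : Kernel 𝒳 𝒳) (Q₀ : Measure 𝒳)
    (v : 𝒳 → ℝ) : Prop :=
  MemOrliczHeart r v Q₀ ∧ valueOp α β u Q v =ᵐ[Q₀] v ∧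
    ∀ s : ℝ, 1 < s → s ≤ r → ∀ w : 𝒳 → ℝ,
      MemOrliczHeart s w Q₀ → valueOp α β u Q w =ᵐ[Q₀] w → w =ᵐ[Q₀] v

/-- Everywhere mutual absolute continuity of two transition kernels. -/
def EverywhereMutuallyAC (Q Qhat : Kernel 𝒳 𝒳) : Prop :=
  ∀ x, Q x ≪ Qhat x ∧ Qhat x ≪ Q x

variable [MeasurableSpace.CountablyGenerated 𝒳]

/-- The log-likelihood ratio `ℓ̂(x₀, x₁) = log (dQ̂(·|x₀) / dQ(·|x₀))(x₁)`, through the jointly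
measurable version of the Radon–Nikodym derivative. -/
def logLik (Q Qhat : Kernel 𝒳 𝒳) (z : 𝒳 × 𝒳) : ℝ :=
  Real.log (Kernel.rnDeriv Qhat Q z.1 z.2).toReal

/-- The score `η̂(x₀, x₁) = ℓ̂(x₀, x₁) - E^Q[ℓ̂(X_t, X_{t+1}) | X_t = x₀]`. -/
def score (Q Qhat : Kernel 𝒳 𝒳) (z : 𝒳 × 𝒳) : ℝ :=
  logLik Q Qhat z - ∫ y, logLik Q Qhat (z.1, y) ∂(Q z.1)

/-- The first alternative of the regularity condition on `Q̂`: thin-tailed log-likelihood ratio. -/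
def ThinTailed (α β r M : ℝ) (u : 𝒳 × 𝒳 → ℝ) (Q Qhat : Kernel 𝒳 𝒳) (Q₀ : Measure 𝒳) : Prop :=
  EverywhereMutuallyAC Q Qhat ∧
  MemOrliczHeart r (logLik Q Qhat) (Q₀ ⊗ₘ Q) ∧
  orliczNorm r (logLik Q Qhat) (Q₀ ⊗ₘ Q) ≤ ENNReal.ofReal M ∧
  expMoment 1 r (fun z => 1 / (1 - β) * (logLik Q Qhat z + α * u z)) (Q₀ ⊗ₘ Q)
    ≤ ENNReal.ofReal M

/-- The second alternative of the regularity condition on `Q̂`, with exponent `p`: `X` is stationary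
under `Q̂`, with a stationary distribution `Q̂₀` equivalent to `Q₀` and moment bounds on the
Radon–Nikodym derivatives of `Q̂₀` and `Q̂₀ ⊗ Q̂` with respect to `Q₀` and `Q₀ ⊗ Q`. -/
def StationaryAlternative (p M : ℝ) (Q Qhat : Kernel 𝒳 𝒳) (Q₀ : Measure 𝒳) : Prop :=
  EverywhereMutuallyAC Q Qhat ∧
  MemOrlicz 1 (logLik Q Qhat) (Q₀ ⊗ₘ Q) ∧
  ∃ Qhat₀ : Measure 𝒳, IsProbabilityMeasure Qhat₀ ∧ Qhat.Invariant Qhat₀ ∧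
    Q₀ ≪ Qhat₀ ∧ Qhat₀ ≪ Q₀ ∧
    ∫⁻ x, (Qhat₀.rnDeriv Q₀ x) ^ p ∂Q₀ ≤ ENNReal.ofReal M ∧
    ∫⁻ x, (Qhat₀.rnDeriv Q₀ x) ^ (1 - p) ∂Q₀ ≤ ENNReal.ofReal M ∧
    ∫⁻ z, ((Qhat₀ ⊗ₘ Qhat).rnDeriv (Q₀ ⊗ₘ Q) z) ^ p ∂(Q₀ ⊗ₘ Q) ≤ ENNReal.ofReal M

/-- The three inequalities, in the `φ_s` norm and with constant `C`:
`‖v̂ - v‖ ≤ C ‖η̂‖`, `C⁻¹ ‖T̂ v - v‖ ≤ ‖v̂ - v‖` and `‖v̂ - v‖ ≤ C ‖T̂ v - v‖`. -/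
def PerturbationBounds (α β s C : ℝ) (u : 𝒳 × 𝒳 → ℝ) (Q Qhat : Kernel 𝒳 𝒳) (Q₀ : Measure 𝒳)
    (v vhat : 𝒳 → ℝ) : Prop :=
  orliczNorm s (fun x => vhat x - v x) Q₀
      ≤ ENNReal.ofReal C * orliczNorm s (score Q Qhat) (Q₀ ⊗ₘ Q) ∧
  (ENNReal.ofReal C)⁻¹ * orliczNorm s (fun x => valueOp α β u Qhat v x - v x) Q₀
      ≤ orliczNorm s (fun x => vhat x - v x) Q₀ ∧
  orliczNorm s (fun x => vhat x - v x) Q₀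
      ≤ ENNReal.ofReal C * orliczNorm s (fun x => valueOp α β u Qhat v x - v x) Q₀

end RobustValue

end

namespace RobustValue

open Filter Topology

/-! The operator fails to contract visibly in the Luxemburg norm itself. It contracts in an
equivalent gauge, the least `c` with `E exp((|f|/c)^s) ≤ exp K` (`ExpBound`), once the level `K` is
large enough.

By Gibbs' inequality, a difference of two log exponential moments is at most the mean of the
difference of exponents under an exponential tilt of the conditional law. The density of a tilt has
a second moment controlled by exponential moments of the exponent, so Cauchy–Schwarz and Jensen give
`exp((|Tf - Tg|/(βc))^s) ≤ A² B` pointwise, with `A` a conditional exponential moment of `|f| + |g|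
+ |w|` and `B` the conditional mean of `exp((|f - g|/c)^s)`. If the moment of order `4/(1-β)` behind
`A` is at most `exp K`, Hölder's inequality restores the level `exp K` at the price of a factor `2 -
β` in the scale (`expBound_of_kernel_le`). The factor `β` of the operator turns this into the rate
`β(2-β) = 1 - (1-β)² < 1` (`ExpBound.riskOp_sub`).

The level `K` must serve all iterates at once. For `r > 1` the map `y ↦ exp(l (log y)^r)` has
tangent-line minorants at all large `y`, so `exp(l (log E e^g)^r) ≤ J + E exp(l g^r)`. Splitting
`|f| + |w|` with weights `β` and `1-β` gives an affine recursion whose fixed bound is `momentBound`.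
Moments of order `r > 1` dominate all linear exponential moments, so value iteration from `0` is
Cauchy with a common `K`, and two fixed points with all linear exponential moments agree.

For the perturbation bounds, `Q̂` is viewed through a reference model `(P, P₀)` with `dQ̂/dP = e^ψ`:
its operator is that of `P` with `ψ` added to the utility increment. In case (a) the reference is
`Q` with `ψ = ℓ̂`; in case (b) it is `Q̂` with its own stationary law and `ψ = 0`, and Hölder's
inequality moves scales between the two models at a factor `q`. The score controls `ℓ̂`, because the
relative entropy `-E^Q ℓ̂` is at most `E^Q̂ |η̂|`. In turn `ℓ̂` controls `T̂v - v` by Gibbs'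
inequality applied in both directions, and the contraction turns a bound on `T̂v - v` into one on
`v̂ - v` and back (`expBound_perturbation`). Passing from level `K` to the level `log 2` of the
Luxemburg norm costs only the factor `max 1 (K / log 2)`. Since `K` is fixed from the constants
alone, so is `C`. -/

/-- The exponential as an extended nonnegative number. -/
noncomputable def eexp (x : ℝ) : ℝ≥0∞ := ENNReal.ofReal (Real.exp x)

lemma eexp_add (x y : ℝ) : eexp (x + y) = eexp x * eexp y := by
  simp [eexp, Real.exp_add, ENNReal.ofReal_mul (Real.exp_pos x).le]

@[gcongr]
lemma eexp_le_eexp {x y : ℝ} (h : x ≤ y) : eexp x ≤ eexp y :=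
  ENNReal.ofReal_le_ofReal (Real.exp_le_exp.2 h)

lemma eexp_pos (x : ℝ) : 0 < eexp x := ENNReal.ofReal_pos.2 (Real.exp_pos x)

lemma eexp_ne_top (x : ℝ) : eexp x ≠ ∞ := ENNReal.ofReal_ne_top

lemma eexp_zero : eexp 0 = 1 := by simp [eexp]

lemma one_le_eexp {x : ℝ} (h : 0 ≤ x) : 1 ≤ eexp x := eexp_zero ▸ eexp_le_eexp h

lemma eexp_rpow (x y : ℝ) : eexp x ^ y = eexp (x * y) := by
  rw [eexp, eexp, ENNReal.ofReal_rpow_of_pos (Real.exp_pos x), Real.exp_mul]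

@[fun_prop]
lemma measurable_eexp : Measurable eexp :=
  (ENNReal.measurable_ofReal.comp Real.measurable_exp)

lemma continuous_eexp : Continuous eexp := ENNReal.continuous_ofReal.comp Real.continuous_exp

lemma eexp_add_le (x y : ℝ) : eexp (x + y) ≤ eexp (2 * x) + eexp (2 * y) := by
  rcases le_total x y with h | h
  · exact (eexp_le_eexp (by linarith)).trans le_add_self
  · exact (eexp_le_eexp (by linarith)).trans le_self_add

lemma toReal_eexp (x : ℝ) : (eexp x).toReal = Real.exp x :=
  ENNReal.toReal_ofReal (Real.exp_pos x).le

/-- A linear exponential is dominated by an exponential of a power `r > 1`. -/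
lemma mul_le_mul_rpow_add {a l r x : ℝ} (ha : 0 ≤ a) (hl : 0 < l) (hr : 1 < r) (hx : 0 ≤ x) :
    a * x ≤ l * x ^ r + a * (a / l) ^ (1 / (r - 1)) := by
  have hr' : 0 < r - 1 := by linarith
  have hal : 0 ≤ a / l := by positivity
  rcases le_total x ((a / l) ^ (1 / (r - 1))) with h | h
  · have := mul_le_mul_of_nonneg_left h ha
    have := Real.rpow_nonneg hx r
    nlinarith
  · have h1 : a / l ≤ x ^ (r - 1) := by
      have := Real.rpow_le_rpow (by positivity) h hr'.le
      rwa [← Real.rpow_mul hal, one_div, inv_mul_cancel₀ hr'.ne', Real.rpow_one] at this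
    have h2 : x ^ r = x ^ (r - 1) * x := by
      rcases hx.eq_or_lt with h0 | h0
      · subst h0
        rw [Real.zero_rpow (by linarith)]
        simp
      · rw [Real.rpow_sub_one h0.ne', div_mul_cancel₀ _ h0.ne']
    have h3 : a ≤ l * x ^ (r - 1) := by
      rwa [div_le_iff₀' hl] at h1
    have h4 : 0 ≤ a * (a / l) ^ (1 / (r - 1)) := by positivity
    rw [h2, ← mul_assoc]
    nlinarith

/-! ### Jensen, exponential tilts and Gibbs' inequality on one probability space. -/

section Pointwise

variable {Ω : Type*} [MeasurableSpace Ω] {μ : Measure Ω}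

lemma integrable_exp_of_lintegral {f : Ω → ℝ} (hf : AEMeasurable f μ)
    (h : ∫⁻ ω, eexp (f ω) ∂μ < ∞) : Integrable (fun ω => Real.exp (f ω)) μ := by
  refine ⟨(Real.measurable_exp.comp_aemeasurable hf).aestronglyMeasurable, ?_⟩
  rw [hasFiniteIntegral_iff_ofReal (ae_of_all _ fun ω => (Real.exp_pos _).le)]
  exact h

lemma lintegral_eexp_eq {f : Ω → ℝ} (h : Integrable (fun ω => Real.exp (f ω)) μ) :
    ∫⁻ ω, eexp (f ω) ∂μ = ENNReal.ofReal (∫ ω, Real.exp (f ω) ∂μ) :=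
  (ofReal_integral_eq_lintegral_ofReal h (ae_of_all _ fun _ => (Real.exp_pos _).le)).symm

lemma integrable_of_lintegral_eexp_abs {f : Ω → ℝ} (hf : AEMeasurable f μ)
    (h : ∫⁻ ω, eexp |f ω| ∂μ < ∞) : Integrable f μ := by
  refine (integrable_exp_of_lintegral hf.abs h).mono' hf.aestronglyMeasurable
    (ae_of_all _ fun ω => ?_)
  have := Real.add_one_le_exp |f ω|
  rw [Real.norm_eq_abs]
  linarith

lemma lintegral_eexp_abs_lt_top_of_two_mul {f : Ω → ℝ}
    (h : ∫⁻ ω, eexp (2 * |f ω|) ∂μ < ∞) : ∫⁻ ω, eexp |f ω| ∂μ < ∞ :=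
  (lintegral_mono fun ω => eexp_le_eexp (by linarith [abs_nonneg (f ω)])).trans_lt h

lemma integrable_exp_of_abs {f : Ω → ℝ} (hf : AEMeasurable f μ)
    (h : ∫⁻ ω, eexp |f ω| ∂μ < ∞) : Integrable (fun ω => Real.exp (f ω)) μ :=
  integrable_exp_of_lintegral hf
    ((lintegral_mono fun ω => eexp_le_eexp (le_abs_self (f ω))).trans_lt h)

variable [IsProbabilityMeasure μ]

lemma exp_integral_le {f : Ω → ℝ} (hf : Integrable f μ)
    (h : Integrable (fun ω => Real.exp (f ω)) μ) :
    Real.exp (∫ ω, f ω ∂μ) ≤ ∫ ω, Real.exp (f ω) ∂μ :=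
  convexOn_exp.map_integral_le Real.continuous_exp.continuousOn isClosed_univ
    (ae_of_all _ fun _ => Set.mem_univ _) hf h

lemma eexp_integral_le {f : Ω → ℝ} (hf : Integrable f μ) :
    eexp (∫ ω, f ω ∂μ) ≤ ∫⁻ ω, eexp (f ω) ∂μ := by
  by_cases h : ∫⁻ ω, eexp (f ω) ∂μ < ∞
  · have h' := integrable_exp_of_lintegral hf.aemeasurable h
    rw [lintegral_eexp_eq h']
    exact ENNReal.ofReal_le_ofReal (exp_integral_le hf h')
  · rw [not_lt_top_iff.1 h]
    exact le_top

lemma lintegral_rpow_le {f : Ω → ℝ≥0∞} (hf : AEMeasurable f μ) {p : ℝ} (hp : 1 ≤ p) :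
    (∫⁻ ω, f ω ∂μ) ^ p ≤ ∫⁻ ω, f ω ^ p ∂μ := by
  have hp0 : 0 < p := by linarith
  have h := ENNReal.lintegral_mul_norm_pow_le (μ := μ) (f := fun ω => f ω ^ p) (g := fun _ => 1)
    (hf.pow_const p) aemeasurable_const (p := 1 / p) (q := 1 - 1 / p) (by positivity)
    (by rw [sub_nonneg, div_le_one hp0]; exact hp) (by ring)
  simp only [← ENNReal.rpow_mul, mul_one_div_cancel hp0.ne', ENNReal.rpow_one, ENNReal.one_rpow,
    mul_one, lintegral_const, measure_univ] at h
  calc (∫⁻ ω, f ω ∂μ) ^ p ≤ ((∫⁻ ω, f ω ^ p ∂μ) ^ (1 / p)) ^ p := by gcongr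
    _ = _ := by rw [← ENNReal.rpow_mul, one_div_mul_cancel hp0.ne', ENNReal.rpow_one]

lemma lintegral_rpow_le' {f : Ω → ℝ≥0∞} (hf : AEMeasurable f μ) {p : ℝ} (hp0 : 0 ≤ p)
    (hp : p ≤ 1) : ∫⁻ ω, f ω ^ p ∂μ ≤ (∫⁻ ω, f ω ∂μ) ^ p := by
  have h := ENNReal.lintegral_mul_norm_pow_le (μ := μ) (f := f) (g := fun _ => 1)
    hf aemeasurable_const (p := p) (q := 1 - p) hp0 (by linarith) (by ring)
  simpa using h

/-- Jensen for `f` and for `-f`. It bounds normalising constants from below: `1 / E e^ψ ≤ E e^{-ψ}`.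
-/
lemma one_le_integral_mul_integral_neg {f : Ω → ℝ}
    (h1 : Integrable (fun ω => Real.exp (f ω)) μ) (h2 : Integrable (fun ω => Real.exp (-f ω)) μ)
    (hf : Integrable f μ) :
    1 ≤ (∫ ω, Real.exp (f ω) ∂μ) * ∫ ω, Real.exp (-f ω) ∂μ := by
  have a := exp_integral_le hf h1
  have b := exp_integral_le hf.neg h2
  simp only [Pi.neg_apply, integral_neg] at b
  calc (1 : ℝ) = Real.exp (∫ ω, f ω ∂μ) * Real.exp (-∫ ω, f ω ∂μ) := by
        rw [← Real.exp_add, add_neg_cancel, Real.exp_zero]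
    _ ≤ _ := mul_le_mul a b (Real.exp_pos _).le ((Real.exp_pos _).le.trans a)

/-- The square of the density of an exponential tilt. -/
lemma lintegral_tilt_density_sq_le {ψ : Ω → ℝ} (hψ : AEMeasurable ψ μ)
    (h : ∫⁻ ω, eexp (2 * |ψ ω|) ∂μ < ∞) :
    ∫⁻ ω, ENNReal.ofReal (Real.exp (ψ ω) / ∫ x, Real.exp (ψ x) ∂μ) ^ (2 : ℝ) ∂μ
      ≤ (∫⁻ ω, eexp (2 * |ψ ω|) ∂μ) ^ 2 := by
  have h1 := lintegral_eexp_abs_lt_top_of_two_mul h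
  have i0 := integrable_of_lintegral_eexp_abs hψ h1
  have i1 := integrable_exp_of_abs hψ h1
  have i2 : Integrable (fun ω => Real.exp (-ψ ω)) μ :=
    integrable_exp_of_abs (f := fun ω => -ψ ω) hψ.neg (by simpa using h1)
  have hZ : 0 < ∫ x, Real.exp (ψ x) ∂μ := integral_exp_pos i1
  have key := one_le_integral_mul_integral_neg i1 i2 i0
  set Z := ∫ x, Real.exp (ψ x) ∂μ
  have hinv : Z⁻¹ ≤ ∫ ω, Real.exp (-ψ ω) ∂μ := by
    rw [inv_le_iff_one_le_mul₀' hZ]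
    exact key
  have e1 : ENNReal.ofReal Z⁻¹ ≤ ∫⁻ ω, eexp (-ψ ω) ∂μ := by
    rw [lintegral_eexp_eq i2]
    exact ENNReal.ofReal_le_ofReal hinv
  have e2 : ENNReal.ofReal Z⁻¹ ^ (2 : ℝ) ≤ ∫⁻ ω, eexp (2 * |ψ ω|) ∂μ := by
    calc _ ≤ (∫⁻ ω, eexp (-ψ ω) ∂μ) ^ (2 : ℝ) := by gcongr
      _ ≤ ∫⁻ ω, eexp (-ψ ω) ^ (2 : ℝ) ∂μ :=
        lintegral_rpow_le (measurable_eexp.comp_aemeasurable hψ.neg) (by norm_num)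
      _ ≤ _ := lintegral_mono fun ω => by
        rw [eexp_rpow]
        exact eexp_le_eexp (by linarith [neg_le_abs (ψ ω)])
  calc _ = ∫⁻ ω, eexp (2 * ψ ω) * ENNReal.ofReal Z⁻¹ ^ (2 : ℝ) ∂μ := by
        refine lintegral_congr fun ω => ?_
        rw [div_eq_mul_inv, ENNReal.ofReal_mul (Real.exp_pos _).le,
          ENNReal.mul_rpow_of_nonneg _ _ (by norm_num), mul_comm (2 : ℝ), ← eexp_rpow]
        rfl
    _ = (∫⁻ ω, eexp (2 * ψ ω) ∂μ) * ENNReal.ofReal Z⁻¹ ^ (2 : ℝ) :=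
        lintegral_mul_const'' _ (measurable_eexp.comp_aemeasurable (hψ.const_mul 2))
    _ ≤ (∫⁻ ω, eexp (2 * |ψ ω|) ∂μ) * ∫⁻ ω, eexp (2 * |ψ ω|) ∂μ := by
        refine mul_le_mul' (lintegral_mono fun ω => eexp_le_eexp ?_) e2
        linarith [le_abs_self (ψ ω)]
    _ = _ := (sq _).symm

/-- Expectations under an exponential tilt `μ.tilted ψ` are controlled, on the exponential scale, by
exponential moments under `μ`. -/
lemma integrable_tilted_and_eexp_le {ψ h : Ω → ℝ} {s : ℝ} (hs : 1 ≤ s) (hψm : AEMeasurable ψ μ)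
    (hψ : ∫⁻ ω, eexp (2 * |ψ ω|) ∂μ < ∞) (hm : Measurable h) (h0 : ∀ ω, 0 ≤ h ω)
    (hh : ∫⁻ ω, eexp (h ω ^ s) ∂μ < ∞) :
    Integrable h (μ.tilted ψ) ∧
    eexp ((∫ ω, h ω ∂(μ.tilted ψ)) ^ s)
      ≤ (∫⁻ ω, eexp (2 * |ψ ω|) ∂μ) ^ 2 * ∫⁻ ω, eexp (h ω ^ s) ∂μ := by
  have h1 := lintegral_eexp_abs_lt_top_of_two_mul hψ
  have i1 := integrable_exp_of_abs hψm h1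
  have hP : IsProbabilityMeasure (μ.tilted ψ) := isProbabilityMeasure_tilted i1
  have hsm : Measurable fun ω => h ω ^ s := hm.pow_const s
  -- The exponent is halved so that Cauchy–Schwarz against the density of the tilt returns
  -- `exp(h^s)` in the second factor.
  have key : (∫⁻ ω, eexp (h ω ^ s / 2) ∂(μ.tilted ψ)) ^ (2 : ℝ)
      ≤ (∫⁻ ω, eexp (2 * |ψ ω|) ∂μ) ^ 2 * ∫⁻ ω, eexp (h ω ^ s) ∂μ := by
    rw [lintegral_tilted]
    have cs := ENNReal.lintegral_mul_le_Lp_mul_Lq μ Real.HolderConjugate.two_two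
      (f := fun ω => ENNReal.ofReal (Real.exp (ψ ω) / ∫ x, Real.exp (ψ x) ∂μ))
      (g := fun ω => eexp (h ω ^ s / 2))
      (((Real.measurable_exp.comp_aemeasurable hψm).div_const _).ennreal_ofReal)
      (measurable_eexp.comp (hsm.div_const 2)).aemeasurable
    simp only [Pi.mul_apply] at cs
    calc _ ≤ _ := ENNReal.rpow_le_rpow cs (by norm_num)
      _ = (∫⁻ ω, ENNReal.ofReal (Real.exp (ψ ω) / ∫ x, Real.exp (ψ x) ∂μ) ^ (2 : ℝ) ∂μ)
          * ∫⁻ ω, eexp (h ω ^ s / 2) ^ (2 : ℝ) ∂μ := by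
        rw [ENNReal.mul_rpow_of_nonneg _ _ (by norm_num), ← ENNReal.rpow_mul, ← ENNReal.rpow_mul]
        norm_num
      _ ≤ _ := by
        refine mul_le_mul' (lintegral_tilt_density_sq_le hψm hψ) (le_of_eq ?_)
        refine lintegral_congr fun ω => ?_
        rw [eexp_rpow]
        congr 1
        ring
  have fin : ∫⁻ ω, eexp (h ω ^ s / 2) ∂(μ.tilted ψ) < ∞ := by
    have := key.trans_lt (ENNReal.mul_lt_top (ENNReal.pow_lt_top hψ) hh)
    exact (ENNReal.rpow_lt_top_iff_of_pos (by norm_num)).1 this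
  have ihs2 : Integrable (fun ω => h ω ^ s / 2) (μ.tilted ψ) := by
    refine integrable_of_lintegral_eexp_abs (hsm.div_const 2).aemeasurable ?_
    refine lt_of_le_of_lt (lintegral_mono fun ω => ?_) fin
    rw [abs_of_nonneg (div_nonneg (Real.rpow_nonneg (h0 ω) s) (by norm_num))]
  have ihs : Integrable (fun ω => h ω ^ s) (μ.tilted ψ) := by
    simpa [div_mul_cancel₀] using ihs2.mul_const 2
  have ih : Integrable h (μ.tilted ψ) := by
    refine (ihs.add (integrable_const (1 : ℝ))).mono' hm.aestronglyMeasurable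
      (ae_of_all _ fun ω => ?_)
    rw [Real.norm_eq_abs, abs_of_nonneg (h0 ω)]
    rcases le_total (h ω) 1 with h' | h'
    · have := Real.rpow_nonneg (h0 ω) s
      simp only [Pi.add_apply]
      linarith
    · have := Real.rpow_le_rpow_of_exponent_le h' hs
      rw [Real.rpow_one] at this
      simp only [Pi.add_apply]
      linarith
  refine ⟨ih, ?_⟩
  have j : (∫ ω, h ω ∂(μ.tilted ψ)) ^ s ≤ ∫ ω, h ω ^ s ∂(μ.tilted ψ) :=
    (convexOn_rpow hs).map_integral_le
      ((Real.continuous_rpow_const (by linarith)).continuousOn) isClosed_Ici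
      (ae_of_all _ fun ω => h0 ω) ih ihs
  calc eexp ((∫ ω, h ω ∂(μ.tilted ψ)) ^ s)
      ≤ eexp ((∫ ω, h ω ^ s / 2 ∂(μ.tilted ψ)) * 2) := by
        refine eexp_le_eexp ?_
        rw [integral_div, div_mul_cancel₀ _ (by norm_num)]
        exact j
    _ = eexp (∫ ω, h ω ^ s / 2 ∂(μ.tilted ψ)) ^ (2 : ℝ) := (eexp_rpow _ _).symm
    _ ≤ (∫⁻ ω, eexp (h ω ^ s / 2) ∂(μ.tilted ψ)) ^ (2 : ℝ) := by
        gcongr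
        exact eexp_integral_le ihs2
    _ ≤ _ := key

/-- Gibbs' inequality for the logarithm of exponential moments. -/
lemma log_integral_exp_sub_le {ψ χ : Ω → ℝ} (hψ : Integrable (fun ω => Real.exp (ψ ω)) μ)
    (hχ : Integrable (fun ω => Real.exp (χ ω)) μ)
    (hd : Integrable (fun ω => ψ ω - χ ω) (μ.tilted ψ)) :
    Real.log (∫ ω, Real.exp (ψ ω) ∂μ) - Real.log (∫ ω, Real.exp (χ ω) ∂μ)
      ≤ ∫ ω, (ψ ω - χ ω) ∂(μ.tilted ψ) := by
  have hP : IsProbabilityMeasure (μ.tilted ψ) := isProbabilityMeasure_tilted hψ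
  have hZ : 0 < ∫ x, Real.exp (ψ x) ∂μ := integral_exp_pos hψ
  have hZ' : 0 < ∫ x, Real.exp (χ x) ∂μ := integral_exp_pos hχ
  have hd' : Integrable (fun ω => (χ - ψ) ω) (μ.tilted ψ) := by
    refine hd.neg.congr (ae_of_all _ fun ω => ?_)
    simp
  have hi : Integrable (fun ω => Real.exp ((χ - ψ) ω)) (μ.tilted ψ) := by
    rw [integrable_tilted_iff hψ]
    refine hχ.congr (ae_of_all _ fun ω => ?_)
    simp [← Real.exp_add]
  -- Jensen under the tilt by `ψ`, where the mean of `exp(χ - ψ)` is the ratio of the two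
  -- normalising constants.
  have h := exp_integral_le hd' hi
  rw [integral_exp_tilted, add_sub_cancel, ← Real.log_le_log_iff (Real.exp_pos _) (by positivity),
    Real.log_exp, Real.log_div hZ'.ne' hZ.ne'] at h
  have e : ∫ ω, (ψ ω - χ ω) ∂(μ.tilted ψ) = -∫ ω, (χ - ψ) ω ∂(μ.tilted ψ) := by
    rw [← integral_neg]
    simp
  rw [e]
  linarith

end Pointwise

/-! ### Conditional estimates for log exponential moments. -/

section PointwiseBounds

variable {Ω : Type*} [MeasurableSpace Ω] {μ : Measure Ω}

lemma integrable_exp_of_rpow {g : Ω → ℝ} {l r : ℝ} (hr : 1 < r) (hl : 0 < l) (hg : Measurable g)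
    (h0 : ∀ ω, 0 ≤ g ω) (h : ∫⁻ ω, eexp (l * g ω ^ r) ∂μ < ∞) :
    Integrable (fun ω => Real.exp (g ω)) μ := by
  refine integrable_exp_of_lintegral hg.aemeasurable ?_
  have : ∀ ω, eexp (g ω) ≤ eexp (1 * (1 / l) ^ (1 / (r - 1))) * eexp (l * g ω ^ r) := by
    intro ω
    rw [← eexp_add]
    refine eexp_le_eexp ?_
    have := mul_le_mul_rpow_add zero_le_one hl hr (h0 ω)
    linarith
  refine (lintegral_mono this).trans_lt ?_
  rw [lintegral_const_mul' _ _ (eexp_ne_top _)]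
  exact ENNReal.mul_lt_top (eexp_ne_top _).lt_top h

variable [IsProbabilityMeasure μ]

lemma one_le_lintegral_eexp {f : Ω → ℝ} (h0 : ∀ ω, 0 ≤ f ω) : 1 ≤ ∫⁻ ω, eexp (f ω) ∂μ := by
  calc (1 : ℝ≥0∞) = ∫⁻ _, 1 ∂μ := by simp
    _ ≤ _ := lintegral_mono fun ω => one_le_eexp (h0 ω)

/-- Tilting by the exponent with the larger log moment makes Gibbs' inequality bound the absolute
difference by a tilted mean of `|f - g|`; the tilt estimate then returns to `μ`. The moment factor
is at least `1`, so nothing is claimed when the last integral is infinite. -/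
lemma eexp_log_integral_sub_le_of_le {f g w : Ω → ℝ} {s c : ℝ} (hs : 1 ≤ s) (hc : 0 < c)
    (hf : Measurable f) (hg : Measurable g) (hw : Measurable w)
    (hle : Real.log (∫ ω, Real.exp (g ω + w ω) ∂μ) ≤ Real.log (∫ ω, Real.exp (f ω + w ω) ∂μ))
    (h : ∫⁻ ω, eexp (2 * (|f ω| + |g ω| + |w ω|)) ∂μ < ∞) :
    eexp ((|Real.log (∫ ω, Real.exp (f ω + w ω) ∂μ)
        - Real.log (∫ ω, Real.exp (g ω + w ω) ∂μ)| / c) ^ s)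
      ≤ (∫⁻ ω, eexp (2 * (|f ω| + |g ω| + |w ω|)) ∂μ) ^ 2
        * ∫⁻ ω, eexp ((|f ω - g ω| / c) ^ s) ∂μ := by
  by_cases hfin : ∫⁻ ω, eexp ((|f ω - g ω| / c) ^ s) ∂μ < ∞
  swap
  · rw [not_lt_top_iff.1 hfin, ENNReal.mul_top]
    · exact le_top
    · exact pow_ne_zero 2 (lt_of_lt_of_le one_pos (one_le_lintegral_eexp fun ω => by positivity)).ne'
  have h2f : ∫⁻ ω, eexp (2 * |f ω + w ω|) ∂μ ≤ ∫⁻ ω, eexp (2 * (|f ω| + |g ω| + |w ω|)) ∂μ := by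
    refine lintegral_mono fun ω => eexp_le_eexp ?_
    linarith [abs_add_le (f ω) (w ω), abs_nonneg (g ω)]
  have h2g : ∫⁻ ω, eexp (2 * |g ω + w ω|) ∂μ ≤ ∫⁻ ω, eexp (2 * (|f ω| + |g ω| + |w ω|)) ∂μ := by
    refine lintegral_mono fun ω => eexp_le_eexp ?_
    linarith [abs_add_le (g ω) (w ω), abs_nonneg (f ω)]
  have iF := integrable_exp_of_abs (f := fun ω => f ω + w ω) (hf.add hw).aemeasurable
    (lintegral_eexp_abs_lt_top_of_two_mul (h2f.trans_lt h))
  have iG := integrable_exp_of_abs (f := fun ω => g ω + w ω) (hg.add hw).aemeasurable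
    (lintegral_eexp_abs_lt_top_of_two_mul (h2g.trans_lt h))
  obtain ⟨ih, hb⟩ := integrable_tilted_and_eexp_le (ψ := fun ω => f ω + w ω)
    (h := fun ω => |f ω - g ω| / c) hs (hf.add hw).aemeasurable (h2f.trans_lt h)
    ((hf.sub hg).abs.div_const c) (fun ω => by positivity) hfin
  have ih' : Integrable (fun ω => |f ω - g ω|) (μ.tilted fun ω => f ω + w ω) := by
    simpa [div_mul_cancel₀ _ hc.ne'] using ih.mul_const c
  have ih'' : Integrable (fun ω => f ω - g ω) (μ.tilted fun ω => f ω + w ω) :=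
    (integrable_norm_iff (hf.sub hg).aestronglyMeasurable).1 ih'
  have ge := log_integral_exp_sub_le iF iG (by simpa using ih'')
  have hle' : |Real.log (∫ ω, Real.exp (f ω + w ω) ∂μ) - Real.log (∫ ω, Real.exp (g ω + w ω) ∂μ)| / c
      ≤ ∫ ω, |f ω - g ω| / c ∂(μ.tilted fun ω => f ω + w ω) := by
    rw [abs_of_nonneg (by linarith), integral_div]
    gcongr
    refine ge.trans ?_
    simp only [add_sub_add_right_eq_sub]
    exact integral_mono ih'' ih' fun ω => le_abs_self _
  calc _ ≤ eexp ((∫ ω, |f ω - g ω| / c ∂(μ.tilted fun ω => f ω + w ω)) ^ s) := by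
        refine eexp_le_eexp (Real.rpow_le_rpow (by positivity) hle' (by linarith))
    _ ≤ _ := hb
    _ ≤ _ := by gcongr

lemma eexp_log_integral_sub_le {f g w : Ω → ℝ} {s c : ℝ} (hs : 1 ≤ s) (hc : 0 < c)
    (hf : Measurable f) (hg : Measurable g) (hw : Measurable w)
    (h : ∫⁻ ω, eexp (2 * (|f ω| + |g ω| + |w ω|)) ∂μ < ∞) :
    eexp ((|Real.log (∫ ω, Real.exp (f ω + w ω) ∂μ)
        - Real.log (∫ ω, Real.exp (g ω + w ω) ∂μ)| / c) ^ s)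
      ≤ (∫⁻ ω, eexp (2 * (|f ω| + |g ω| + |w ω|)) ∂μ) ^ 2
        * ∫⁻ ω, eexp ((|f ω - g ω| / c) ^ s) ∂μ := by
  rcases le_total (Real.log (∫ ω, Real.exp (g ω + w ω) ∂μ))
    (Real.log (∫ ω, Real.exp (f ω + w ω) ∂μ)) with hle | hle
  · exact eexp_log_integral_sub_le_of_le hs hc hf hg hw hle h
  · have h' : ∫⁻ ω, eexp (2 * (|g ω| + |f ω| + |w ω|)) ∂μ < ∞ := by
      simpa [add_comm |g _|] using h
    have := eexp_log_integral_sub_le_of_le hs hc hg hf hw hle h'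
    simpa [abs_sub_comm, add_comm] using this

/-- The additive constant in the Jensen-type inequality for `exp (l (log ·) ^ r)`. -/
noncomputable def jensenConst (l r : ℝ) : ℝ≥0∞ := eexp (l * ((1 / (l * r)) ^ (1 / (r - 1))) ^ r)

/-- The tangent at `y = e^x` of `y ↦ exp(l (log y)^r)` lies below the function on `y ≥ 1`. It comes
from two Bernoulli inequalities, one for `(t/x)^r` and one for `(e^{t-x})^k`; the second needs the
slope parameter `k = l r x^{r-1}` to be at least `1`. -/
lemma exp_mul_rpow_tangent {l r x t : ℝ} (hr : 1 < r) (hl : 0 < l) (hx : 0 < x)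
    (hk : 1 ≤ l * r * x ^ (r - 1)) (ht : 0 ≤ t) :
    Real.exp (l * x ^ r) * (1 + l * r * x ^ (r - 1) * (Real.exp (t - x) - 1))
      ≤ Real.exp (l * t ^ r) := by
  set k := l * r * x ^ (r - 1) with hkdef
  have b1 := one_add_mul_self_le_rpow_one_add (s := t / x - 1)
    (by linarith [div_nonneg ht hx.le]) hr.le
  rw [add_sub_cancel, Real.div_rpow ht hx.le, le_div_iff₀ (Real.rpow_pos_of_pos hx r)] at b1
  have e : x ^ r = x ^ (r - 1) * x := by rw [Real.rpow_sub_one hx.ne', div_mul_cancel₀ _ hx.ne']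
  have b1' : l * x ^ r + k * (t - x) ≤ l * t ^ r := by
    have : (1 + r * (t / x - 1)) * x ^ r = x ^ r + r * x ^ (r - 1) * (t - x) := by
      rw [e]
      field_simp
    rw [this] at b1
    rw [hkdef]
    nlinarith
  have b2 := one_add_mul_self_le_rpow_one_add (s := Real.exp (t - x) - 1)
    (by linarith [Real.exp_pos (t - x)]) hk
  rw [add_sub_cancel, ← Real.exp_mul] at b2
  calc _ ≤ Real.exp (l * x ^ r) * Real.exp ((t - x) * k) := by gcongr
    _ = Real.exp (l * x ^ r + k * (t - x)) := by rw [← Real.exp_add, mul_comm k]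
    _ ≤ _ := Real.exp_le_exp.2 b1'

/-- Let `x = log E e^g`. Below the threshold where `l r x^{r-1} = 1` the constant suffices. Above
it, the tangent inequality is integrated, and its linear term vanishes because `E e^{g-x} = 1`. -/
lemma eexp_log_integral_rpow_le {g : Ω → ℝ} {l r : ℝ} (hr : 1 < r) (hl : 0 < l) (hg : Measurable g)
    (h0 : ∀ ω, 0 ≤ g ω) :
    eexp (l * Real.log (∫ ω, Real.exp (g ω) ∂μ) ^ r)
      ≤ jensenConst l r + ∫⁻ ω, eexp (l * g ω ^ r) ∂μ := by
  by_cases hfin : ∫⁻ ω, eexp (l * g ω ^ r) ∂μ < ∞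
  swap
  · rw [not_lt_top_iff.1 hfin]
    simp
  have hr' : 0 < r - 1 := by linarith
  have i1 := integrable_exp_of_rpow hr hl hg h0 hfin
  have i2 := integrable_exp_of_lintegral ((hg.pow_const r).const_mul l).aemeasurable hfin
  have hZ1 : 1 ≤ ∫ ω, Real.exp (g ω) ∂μ := by
    calc (1 : ℝ) = ∫ _, 1 ∂μ := by simp
      _ ≤ _ := integral_mono (integrable_const _) i1 fun ω => Real.one_le_exp (h0 ω)
  have hx : 0 ≤ Real.log (∫ ω, Real.exp (g ω) ∂μ) := Real.log_nonneg hZ1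
  have hexp : Real.exp (Real.log (∫ ω, Real.exp (g ω) ∂μ)) = ∫ ω, Real.exp (g ω) ∂μ :=
    Real.exp_log (by linarith)
  set x := Real.log (∫ ω, Real.exp (g ω) ∂μ)
  have hb0 : 0 ≤ 1 / (l * r) := by positivity
  rcases le_total x ((1 / (l * r)) ^ (1 / (r - 1))) with hxb | hxb
  · refine le_trans ?_ le_self_add
    refine eexp_le_eexp ?_
    gcongr
  refine le_trans ?_ le_add_self
  have hx0 : 0 < x := lt_of_lt_of_le (by positivity) hxb
  have hk : 1 ≤ l * r * x ^ (r - 1) := by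
    have h := Real.rpow_le_rpow (by positivity) hxb hr'.le
    rw [← Real.rpow_mul hb0, one_div_mul_cancel hr'.ne', Real.rpow_one,
      div_le_iff₀' (by positivity)] at h
    exact h
  rw [lintegral_eexp_eq i2]
  refine ENNReal.ofReal_le_ofReal ?_
  have iL : Integrable (fun ω => Real.exp (g ω - x)) μ := by
    simpa [Real.exp_sub] using i1.div_const (Real.exp x)
  have iLv : ∫ ω, Real.exp (g ω - x) ∂μ = 1 := by
    simp_rw [Real.exp_sub, integral_div, hexp]
    exact div_self (by linarith)
  have iD : Integrable (fun ω => Real.exp (g ω - x) - 1) μ := iL.sub (integrable_const _)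
  calc Real.exp (l * x ^ r)
      = ∫ ω, Real.exp (l * x ^ r) * (1 + l * r * x ^ (r - 1) * (Real.exp (g ω - x) - 1)) ∂μ := by
        rw [integral_const_mul, integral_add (integrable_const _) (iD.const_mul _),
          integral_const_mul,
          integral_sub iL (integrable_const _), iLv]
        simp
    _ ≤ _ := integral_mono
        (((integrable_const _).add (iD.const_mul _)).const_mul _) i2
        fun ω => exp_mul_rpow_tangent hr hl hx0 hk (h0 ω)

lemma one_le_jensenConst {l r : ℝ} (hr : 1 < r) (hl : 0 < l) : 1 ≤ jensenConst l r :=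
  one_le_eexp (by positivity)

lemma eexp_mul_rpow_convex {l r β x y : ℝ} (hr : 1 < r) (hl : 0 < l) (hβ₀ : 0 < β) (hβ₁ : β < 1)
    (hx : 0 ≤ x) (hy : 0 ≤ y) :
    eexp (l * (β * x + (1 - β) * y) ^ r)
      ≤ ENNReal.ofReal β * eexp (l * x ^ r) + ENNReal.ofReal (1 - β) * eexp (l * y ^ r) := by
  have c1 := (convexOn_rpow hr.le).2 (x := x) (y := y) hx hy hβ₀.le (sub_nonneg.2 hβ₁.le) (by ring)
  have c2 := convexOn_exp.2 (Set.mem_univ (l * x ^ r)) (Set.mem_univ (l * y ^ r)) hβ₀.le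
    (sub_nonneg.2 hβ₁.le) (by ring)
  simp only [smul_eq_mul] at c1 c2
  rw [eexp, eexp, eexp, ← ENNReal.ofReal_mul hβ₀.le, ← ENNReal.ofReal_mul (by linarith),
    ← ENNReal.ofReal_add (by positivity) (mul_nonneg (by linarith) (Real.exp_pos _).le)]
  refine ENNReal.ofReal_le_ofReal (le_trans (Real.exp_le_exp.2 ?_) c2)
  nlinarith

/-- The one-step moment bound for the logarithm of an exponential moment. -/
lemma eexp_abs_log_integral_le {f w : Ω → ℝ} {l r β : ℝ} (hr : 1 < r) (hl : 0 < l) (hβ₀ : 0 < β)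
    (hβ₁ : β < 1) (hf : Measurable f) (hw : Measurable w) :
    eexp (l * |Real.log (∫ ω, Real.exp (f ω + w ω) ∂μ)| ^ r)
      ≤ jensenConst l r + (ENNReal.ofReal β * ∫⁻ ω, eexp (l * (|f ω| / β) ^ r) ∂μ
        + ENNReal.ofReal (1 - β) * ∫⁻ ω, eexp (l * (|w ω| / (1 - β)) ^ r) ∂μ) := by
  have hβ' : 0 < 1 - β := by linarith
  -- This is `|f| + |w|`, written as the convex combination that yields the weights `β` and `1 - β`.
  set g : Ω → ℝ := fun ω => β * (|f ω| / β) + (1 - β) * (|w ω| / (1 - β)) with hgdef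
  have hg : Measurable g := by fun_prop
  have hg' : ∀ ω, g ω = |f ω| + |w ω| := fun ω => by
    simp only [hgdef]
    field_simp
  have h0 : ∀ ω, 0 ≤ g ω := fun ω => by rw [hg']; positivity
  have hconv : ∫⁻ ω, eexp (l * g ω ^ r) ∂μ
      ≤ ENNReal.ofReal β * ∫⁻ ω, eexp (l * (|f ω| / β) ^ r) ∂μ
        + ENNReal.ofReal (1 - β) * ∫⁻ ω, eexp (l * (|w ω| / (1 - β)) ^ r) ∂μ := by
    rw [← lintegral_const_mul' _ _ ENNReal.ofReal_ne_top,
      ← lintegral_const_mul' _ _ ENNReal.ofReal_ne_top, ← lintegral_add_left (by fun_prop)]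
    exact lintegral_mono fun ω =>
      eexp_mul_rpow_convex hr hl hβ₀ hβ₁ (by positivity) (by positivity)
  by_cases hfin : ∫⁻ ω, eexp (l * g ω ^ r) ∂μ < ∞
  swap
  · rw [not_lt_top_iff.1 hfin, top_le_iff] at hconv
    rw [hconv]
    simp
  have ig := integrable_exp_of_rpow hr hl hg h0 hfin
  have hfw : ∀ ω, |f ω + w ω| ≤ g ω := fun ω => by rw [hg']; exact abs_add_le _ _
  have i1 : Integrable (fun ω => Real.exp (f ω + w ω)) μ :=
    ig.mono' (by fun_prop) (ae_of_all _ fun ω => by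
      rw [Real.norm_eq_abs, Real.abs_exp]
      exact Real.exp_le_exp.2 ((le_abs_self _).trans (hfw ω)))
  have i2 : Integrable (fun ω => Real.exp (-g ω)) μ :=
    ig.mono' (by fun_prop) (ae_of_all _ fun ω => by
      rw [Real.norm_eq_abs, Real.abs_exp]
      exact Real.exp_le_exp.2 (by linarith [h0 ω]))
  have i3 : Integrable g μ := ig.mono' (by fun_prop) (ae_of_all _ fun ω => by
    rw [Real.norm_eq_abs, abs_of_nonneg (h0 ω)]
    linarith [Real.add_one_le_exp (g ω)])
  -- It gives `log E e^{-g} ≥ -log E e^g`, so the log moment of `f + w` is bounded by `log E e^g`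
  -- from both sides.
  have hZ := one_le_integral_mul_integral_neg ig i2 i3
  have hG : 0 < ∫ ω, Real.exp (g ω) ∂μ := integral_exp_pos ig
  have hN : 0 < ∫ ω, Real.exp (-g ω) ∂μ := integral_exp_pos i2
  have hF : 0 < ∫ ω, Real.exp (f ω + w ω) ∂μ := integral_exp_pos i1
  have up : Real.log (∫ ω, Real.exp (f ω + w ω) ∂μ) ≤ Real.log (∫ ω, Real.exp (g ω) ∂μ) :=
    Real.log_le_log hF (integral_mono i1 ig fun ω =>
      Real.exp_le_exp.2 ((le_abs_self _).trans (hfw ω)))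
  have lo : Real.log (∫ ω, Real.exp (-g ω) ∂μ) ≤ Real.log (∫ ω, Real.exp (f ω + w ω) ∂μ) :=
    Real.log_le_log hN (integral_mono i2 i1 fun ω =>
      Real.exp_le_exp.2 (neg_le.1 ((neg_le_abs _).trans (hfw ω))))
  have lo' := Real.log_nonneg hZ
  rw [Real.log_mul hG.ne' hN.ne'] at lo'
  calc _ ≤ eexp (l * Real.log (∫ ω, Real.exp (g ω) ∂μ) ^ r) := by
        refine eexp_le_eexp ?_
        gcongr
        exact abs_le.2 ⟨by linarith, up⟩
    _ ≤ _ := eexp_log_integral_rpow_le hr hl hg h0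
    _ ≤ _ := by gcongr

end PointwiseBounds

/-! ### The exponential gauge at level `K`: triangle inequality, change of level, change of measure.
-/

/-- `E^μ[exp((|f| / c) ^ s)] ≤ exp K`. -/
def ExpBound {Ω : Type*} [MeasurableSpace Ω] (K s c : ℝ) (f : Ω → ℝ) (μ : Measure Ω) : Prop :=
  ∫⁻ ω, eexp ((|f ω| / c) ^ s) ∂μ ≤ eexp K

section ExpBound

variable {Ω : Type*} [MeasurableSpace Ω] {μ : Measure Ω} {K K' s c d A : ℝ} {f g : Ω → ℝ}

lemma ExpBound.mono_fun (hs : 1 ≤ s) (hc : 0 < c) (hf : ExpBound K s c f μ)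
    (h : ∀ᵐ ω ∂μ, |g ω| ≤ |f ω|) : ExpBound K s c g μ := by
  refine (lintegral_mono_ae ?_).trans hf
  filter_upwards [h] with ω hω
  gcongr

lemma ExpBound.mono_scale (hs : 1 ≤ s) (hc : 0 < c) (hcd : c ≤ d) (hf : ExpBound K s c f μ) :
    ExpBound K s d f μ := by
  refine (lintegral_mono fun ω => ?_).trans hf
  have : 0 ≤ |f ω| / d := div_nonneg (abs_nonneg _) (hc.le.trans hcd)
  gcongr

lemma ExpBound.mono_level (hK : K ≤ K') (hf : ExpBound K s c f μ) : ExpBound K' s c f μ :=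
  hf.trans (eexp_le_eexp hK)

lemma ExpBound.const_mul {a : ℝ} (ha : 0 < a) (hf : ExpBound K s c f μ) :
    ExpBound K s (a * c) (fun ω => a * f ω) μ := by
  refine le_of_eq_of_le (lintegral_congr fun ω => ?_) hf
  rw [abs_mul, abs_of_pos ha, mul_div_mul_left _ _ ha.ne']

lemma eexp_add_div_rpow_le {x y : ℝ} (hs : 1 ≤ s) (hc : 0 < c) (hd : 0 < d) (hx : 0 ≤ x)
    (hy : 0 ≤ y) :
    eexp (((x + y) / (c + d)) ^ s)
      ≤ ENNReal.ofReal (c / (c + d)) * eexp ((x / c) ^ s)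
        + ENNReal.ofReal (d / (c + d)) * eexp ((y / d) ^ s) := by
  have hcd : 0 < c + d := by positivity
  have h1 : c / (c + d) + d / (c + d) = 1 := by rw [← add_div, div_self hcd.ne']
  have e : (x + y) / (c + d) = c / (c + d) * (x / c) + d / (c + d) * (y / d) := by
    field_simp
  have hx' : 0 ≤ x / c := by positivity
  have hy' : 0 ≤ y / d := by positivity
  have hc' : 0 ≤ c / (c + d) := by positivity
  have hd' : 0 ≤ d / (c + d) := by positivity
  have c1 := (convexOn_rpow hs).2 hx' hy' hc' hd' h1
  have c2 := convexOn_exp.2 (Set.mem_univ ((x / c) ^ s)) (Set.mem_univ ((y / d) ^ s)) hc' hd' h1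
  simp only [smul_eq_mul] at c1 c2
  rw [eexp, eexp, eexp, ← ENNReal.ofReal_mul (by positivity), ← ENNReal.ofReal_mul (by positivity),
    ← ENNReal.ofReal_add (by positivity) (by positivity), e]
  exact ENNReal.ofReal_le_ofReal (le_trans (Real.exp_le_exp.2 c1) c2)

/-- Convexity of `t ↦ exp(t^s)` with weights `c/(c+d)` and `d/(c+d)`: at a fixed level the gauge
obeys the triangle inequality with constant one. -/
lemma ExpBound.add (hs : 1 ≤ s) (hc : 0 < c) (hd : 0 < d) (hfm : Measurable f)
    (hf : ExpBound K s c f μ) (hg : ExpBound K s d g μ) :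
    ExpBound K s (c + d) (fun ω => f ω + g ω) μ := by
  have hcd : 0 < c + d := by positivity
  calc _ ≤ ∫⁻ ω, ENNReal.ofReal (c / (c + d)) * eexp ((|f ω| / c) ^ s)
        + ENNReal.ofReal (d / (c + d)) * eexp ((|g ω| / d) ^ s) ∂μ := by
        refine lintegral_mono fun ω => le_trans (eexp_le_eexp ?_)
          (eexp_add_div_rpow_le hs hc hd (abs_nonneg _) (abs_nonneg _))
        gcongr
        exact abs_add_le _ _
    _ = ENNReal.ofReal (c / (c + d)) * (∫⁻ ω, eexp ((|f ω| / c) ^ s) ∂μ)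
        + ENNReal.ofReal (d / (c + d)) * ∫⁻ ω, eexp ((|g ω| / d) ^ s) ∂μ := by
        rw [lintegral_add_left (by fun_prop), lintegral_const_mul' _ _ ENNReal.ofReal_ne_top,
          lintegral_const_mul' _ _ ENNReal.ofReal_ne_top]
    _ ≤ ENNReal.ofReal (c / (c + d)) * eexp K + ENNReal.ofReal (d / (c + d)) * eexp K := by
        gcongr
        · exact hf
        · exact hg
    _ = eexp K := by
        rw [← add_mul, ← ENNReal.ofReal_add (by positivity) (by positivity), ← add_div,
          div_self hcd.ne', ENNReal.ofReal_one, one_mul]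

/-- Inflating the scale by `A ≥ 1` divides the exponent by `A^s ≥ A`; Jensen for the power `1/A`
then divides the level by `A`. This is how scale is traded for level. -/
lemma ExpBound.scale [IsProbabilityMeasure μ] (hs : 1 ≤ s) (hc : 0 < c) (hA : 1 ≤ A)
    (hK : K' ≤ K * A) (hfm : AEMeasurable f μ) (hf : ExpBound K' s c f μ) :
    ExpBound K s (A * c) f μ := by
  have hA0 : 0 < A := by linarith
  calc ∫⁻ ω, eexp ((|f ω| / (A * c)) ^ s) ∂μ
      ≤ ∫⁻ ω, eexp ((|f ω| / c) ^ s) ^ (1 / A) ∂μ := by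
        refine lintegral_mono fun ω => ?_
        rw [eexp_rpow]
        refine eexp_le_eexp ?_
        have h1 : |f ω| / (A * c) = (|f ω| / c) / A := by field_simp
        have h0 : 0 ≤ |f ω| / c := by positivity
        rw [h1, Real.div_rpow h0 hA0.le, mul_one_div]
        gcongr
        nth_rewrite 1 [← Real.rpow_one A]
        exact Real.rpow_le_rpow_of_exponent_le hA hs
    _ ≤ (∫⁻ ω, eexp ((|f ω| / c) ^ s) ∂μ) ^ (1 / A) :=
        lintegral_rpow_le' (by fun_prop) (by positivity) (by rw [div_le_one hA0]; exact hA)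
    _ ≤ eexp K' ^ (1 / A) := by gcongr; exact hf
    _ ≤ eexp K := by
        rw [eexp_rpow, mul_one_div]
        refine eexp_le_eexp ?_
        rwa [div_le_iff₀ hA0]

lemma exists_expBound [IsProbabilityMeasure μ] (hs : 1 ≤ s) (hK : 0 < K) (hfm : AEMeasurable f μ)
    (h : ∫⁻ ω, eexp (|f ω| ^ s) ∂μ < ∞) : ∃ d, 0 < d ∧ ExpBound K s d f μ := by
  set L := (∫⁻ ω, eexp (|f ω| ^ s) ∂μ).toReal
  -- The value `L` of the integral also serves as a level, since `L ≤ exp L`.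
  have hL : ExpBound L s 1 f μ := by
    have e : ∫⁻ ω, eexp ((|f ω| / 1) ^ s) ∂μ = ENNReal.ofReal L := by
      simp_rw [div_one]
      exact (ENNReal.ofReal_toReal h.ne).symm
    rw [ExpBound, e]
    exact ENNReal.ofReal_le_ofReal (by linarith [Real.add_one_le_exp L])
  refine ⟨max 1 (L / K) * 1, by positivity, hL.scale hs one_pos (le_max_left _ _) ?_ hfm⟩
  calc L = K * (L / K) := by field_simp
    _ ≤ _ := by gcongr; exact le_max_right _ _

/-- An exponential bound at scale `c` bounds the first absolute moment by a multiple of `c`. -/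
lemma ExpBound.lintegral_abs_le (hc : 0 < c) (hf : ExpBound K 1 c f μ) :
    ∫⁻ ω, ENNReal.ofReal |f ω| ∂μ ≤ ENNReal.ofReal c * eexp K := by
  calc _ ≤ ∫⁻ ω, ENNReal.ofReal c * eexp ((|f ω| / c) ^ (1 : ℝ)) ∂μ := by
        refine lintegral_mono fun ω => ?_
        rw [eexp, ← ENNReal.ofReal_mul hc.le, Real.rpow_one]
        refine ENNReal.ofReal_le_ofReal ?_
        have := Real.add_one_le_exp (|f ω| / c)
        calc |f ω| = c * (|f ω| / c) := by field_simp
          _ ≤ _ := by gcongr; linarith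
    _ = ENNReal.ofReal c * ∫⁻ ω, eexp ((|f ω| / c) ^ (1 : ℝ)) ∂μ :=
        lintegral_const_mul' _ _ ENNReal.ofReal_ne_top
    _ ≤ _ := by gcongr; exact hf

/-- Hölder's inequality for a change of measure. -/
lemma lintegral_le_of_rnDeriv_rpow {ν : Measure Ω} [IsProbabilityMeasure μ]
    [IsProbabilityMeasure ν] (hνμ : ν ≪ μ) {p q M : ℝ} (hpq : p.HolderConjugate q)
    (hM : ∫⁻ ω, (ν.rnDeriv μ ω) ^ p ∂μ ≤ ENNReal.ofReal M) {F : Ω → ℝ≥0∞} (hF : Measurable F) :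
    ∫⁻ ω, F ω ∂ν ≤ ENNReal.ofReal M ^ (1 / p) * (∫⁻ ω, F ω ^ q ∂μ) ^ (1 / q) := by
  rw [← lintegral_rnDeriv_mul hνμ hF.aemeasurable]
  refine (ENNReal.lintegral_mul_le_Lp_mul_Lq μ hpq
    (Measure.measurable_rnDeriv ν μ).aemeasurable hF.aemeasurable).trans ?_
  have := hpq.nonneg
  gcongr

/-- The factor `q` in the scale undoes the power `q` from Hölder's inequality, and `M ≤ exp K` makes
the two factors multiply back to `exp K`, so the level is unchanged. -/
lemma ExpBound.change_measure {ν : Measure Ω} [IsProbabilityMeasure μ]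
    [IsProbabilityMeasure ν] (hνμ : ν ≪ μ) {p q M : ℝ} (hpq : p.HolderConjugate q)
    (hM : ∫⁻ ω, (ν.rnDeriv μ ω) ^ p ∂μ ≤ ENNReal.ofReal M) (hMK : M ≤ Real.exp K)
    (hfm : Measurable f) (hf : ExpBound K 1 c f μ) : ExpBound K 1 (q * c) f ν := by
  have hq := hpq.symm.pos
  have hp := hpq.pos
  refine (lintegral_le_of_rnDeriv_rpow hνμ hpq hM (by fun_prop)).trans ?_
  have e : ∀ ω, eexp ((|f ω| / (q * c)) ^ (1 : ℝ)) ^ q = eexp ((|f ω| / c) ^ (1 : ℝ)) := fun ω => by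
    rw [eexp_rpow, Real.rpow_one, Real.rpow_one]
    congr 1
    field_simp
  simp_rw [e]
  calc _ ≤ eexp K ^ (1 / p) * eexp K ^ (1 / q) := by
        gcongr
        · exact ENNReal.ofReal_le_ofReal hMK
        · exact hf
    _ = eexp K := by
        rw [← ENNReal.rpow_add _ _ (eexp_pos K).ne' (eexp_ne_top K), one_div, one_div,
          hpq.inv_add_inv_eq_one, ENNReal.rpow_one]

end ExpBound

/-! ### From conditional bounds to the gauge: the Hölder step. -/

section Contraction

variable {𝒳 : Type*} [MeasurableSpace 𝒳] {Q : Kernel 𝒳 𝒳} [IsMarkovKernel Q] {Q₀ : Measure 𝒳}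
  [IsProbabilityMeasure Q₀]

/-- A conditional bound with two factors yields a bound at the scale inflated by `2 - β`. -/
lemma expBound_of_kernel_le {β K s c : ℝ} {G : 𝒳 → ℝ} {Φ : 𝒳 × 𝒳 → ℝ} {F : 𝒳 × 𝒳 → ℝ≥0∞}
    (hβ₀ : 0 < β) (hβ₁ : β < 1) (hs : 1 ≤ s) (hc : 0 < c) (hΦm : Measurable Φ)
    (hF : Measurable F)
    (hG : ∀ᵐ x ∂Q₀, eexp ((|G x| / c) ^ s)
      ≤ (∫⁻ y, eexp (2 * Φ (x, y)) ∂(Q x)) ^ 2 * ∫⁻ y, F (x, y) ∂(Q x))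
    (hFK : ∫⁻ z, F z ∂(Q₀ ⊗ₘ Q) ≤ eexp K)
    (hΦ : ∫⁻ z, eexp (4 / (1 - β) * Φ z) ∂(Q₀ ⊗ₘ Q) ≤ eexp K) :
    ExpBound K s ((2 - β) * c) G Q₀ := by
  have hδ : 0 < 1 - β := by linarith
  have hk : 0 < 2 - β := by linarith
  have hk1 : 1 ≤ 2 - β := by linarith
  set A : 𝒳 → ℝ≥0∞ := fun x => ∫⁻ y, eexp (2 * Φ (x, y)) ∂(Q x) with hA
  set B : 𝒳 → ℝ≥0∞ := fun x => ∫⁻ y, F (x, y) ∂(Q x) with hB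
  have hAm : Measurable A :=
    Measurable.lintegral_kernel_prod_right' (f := fun z => eexp (2 * Φ z)) (by fun_prop)
  have hBm : Measurable B := Measurable.lintegral_kernel_prod_right' hF
  -- Source of the order `4/(1-β)`: conditional Jensen for the power `2/(1-β)` of a moment of order
  -- `2`.
  have hA' : ∫⁻ x, A x ^ (2 / (1 - β)) ∂Q₀ ≤ eexp K := by
    refine le_trans ?_ hΦ
    rw [Measure.lintegral_compProd (by fun_prop)]
    refine lintegral_mono fun x => ?_
    refine (lintegral_rpow_le (by fun_prop) (by rw [le_div_iff₀ hδ]; linarith)).trans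
      (lintegral_mono fun y => ?_)
    rw [eexp_rpow]
    refine eexp_le_eexp (le_of_eq ?_)
    field_simp
    ring
  have hB' : ∫⁻ x, B x ∂Q₀ ≤ eexp K := by
    rwa [Measure.lintegral_compProd hF] at hFK
  -- The inflated scale leaves the power `1/(2-β)` of `A² B`. Hölder with weights `(1-β)/(2-β)` and
  -- `1/(2-β)`, which sum to one, reproduces the level `exp K` exactly.
  calc ∫⁻ x, eexp ((|G x| / ((2 - β) * c)) ^ s) ∂Q₀
      ≤ ∫⁻ x, (A x ^ (2 / (1 - β))) ^ ((1 - β) / (2 - β)) * B x ^ (1 / (2 - β)) ∂Q₀ := by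
        refine lintegral_mono_ae ?_
        filter_upwards [hG] with x hx
        calc _ ≤ eexp ((|G x| / c) ^ s) ^ (1 / (2 - β)) := by
              rw [eexp_rpow]
              refine eexp_le_eexp ?_
              have h0 : 0 ≤ |G x| / c := by positivity
              have h1 : |G x| / ((2 - β) * c) = (|G x| / c) / (2 - β) := by field_simp
              rw [h1, Real.div_rpow h0 hk.le, mul_one_div]
              gcongr
              nth_rewrite 1 [← Real.rpow_one (2 - β)]
              exact Real.rpow_le_rpow_of_exponent_le hk1 hs
          _ ≤ (A x ^ 2 * B x) ^ (1 / (2 - β)) := by gcongr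
          _ = _ := by
              rw [ENNReal.mul_rpow_of_nonneg _ _ (by positivity), ← ENNReal.rpow_mul,
                ← ENNReal.rpow_natCast, ← ENNReal.rpow_mul]
              congr 2
              field_simp
              norm_num
    _ ≤ (∫⁻ x, A x ^ (2 / (1 - β)) ∂Q₀) ^ ((1 - β) / (2 - β)) * (∫⁻ x, B x ∂Q₀) ^ (1 / (2 - β)) :=
        ENNReal.lintegral_mul_norm_pow_le (hAm.pow_const _).aemeasurable hBm.aemeasurable
          (by positivity) (by positivity) (by field_simp; ring)
    _ ≤ eexp K ^ ((1 - β) / (2 - β)) * eexp K ^ (1 / (2 - β)) := by gcongr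
    _ = eexp K := by
        rw [eexp_rpow, eexp_rpow, ← eexp_add]
        congr 1
        field_simp
        ring

end Contraction

/-! ### Limits of bounds, and linear exponential moments from moments of order `r`. -/

section Auxiliary

variable {Ω : Type*} [MeasurableSpace Ω] {μ : Measure Ω}

lemma lintegral_le_of_ae_tendsto {F : ℕ → Ω → ℝ≥0∞} {G : Ω → ℝ≥0∞} {R : ℝ≥0∞}
    (hF : ∀ n, Measurable (F n)) (hlim : ∀ᵐ ω ∂μ, Tendsto (fun n => F n ω) atTop (𝓝 (G ω)))
    (hR : ∀ n, ∫⁻ ω, F n ω ∂μ ≤ R) : ∫⁻ ω, G ω ∂μ ≤ R := by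
  calc ∫⁻ ω, G ω ∂μ = ∫⁻ ω, liminf (fun n => F n ω) atTop ∂μ := by
        refine lintegral_congr_ae ?_
        filter_upwards [hlim] with ω hω
        exact hω.liminf_eq.symm
    _ ≤ liminf (fun n => ∫⁻ ω, F n ω ∂μ) atTop := lintegral_liminf_le hF
    _ ≤ liminf (fun _ : ℕ => R) atTop := liminf_le_liminf (Eventually.of_forall hR)
    _ = R := liminf_const R

/-- The first absolute moment is at most `c n * exp K`, which tends to zero. -/
lemma ae_eq_zero_of_expBound {K : ℝ} {f : Ω → ℝ} {c : ℕ → ℝ} (hf : Measurable f)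
    (hc : ∀ n, 0 < c n) (hlim : Tendsto c atTop (𝓝 0)) (h : ∀ n, ExpBound K 1 (c n) f μ) :
    f =ᵐ[μ] 0 := by
  have h0 : ∫⁻ ω, ENNReal.ofReal |f ω| ∂μ ≤ 0 := by
    have t : Tendsto (fun n => ENNReal.ofReal (c n) * eexp K) atTop (𝓝 (ENNReal.ofReal 0 * eexp K)) :=
      ENNReal.Tendsto.mul_const (ENNReal.tendsto_ofReal hlim) (Or.inr (eexp_ne_top K))
    rw [ENNReal.ofReal_zero, zero_mul] at t
    exact ge_of_tendsto' t fun n => (h n).lintegral_abs_le (hc n)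
  rw [nonpos_iff_eq_zero, lintegral_eq_zero_iff (by fun_prop)] at h0
  filter_upwards [h0] with ω hω
  simpa using hω

lemma eexp_add_three_le {a x y z : ℝ} (ha : 0 ≤ a) (_hx : 0 ≤ x) (_hy : 0 ≤ y)
    (_hz : 0 ≤ z) : eexp (a * (x + y + z)) ≤ eexp (3 * a * x) + eexp (3 * a * y) + eexp (3 * a * z) := by
  rcases le_total x y with h1 | h1 <;> rcases le_total y z with h2 | h2 <;>
    rcases le_total x z with h3 | h3
  all_goals
    first
    | refine le_trans (eexp_le_eexp (y := 3 * a * x) (by nlinarith)) ?_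
      exact le_self_add.trans le_self_add
    | refine le_trans (eexp_le_eexp (y := 3 * a * y) (by nlinarith)) ?_
      exact le_add_self.trans le_self_add
    | refine le_trans (eexp_le_eexp (y := 3 * a * z) (by nlinarith)) ?_
      exact le_add_self

/-- The constant relating linear exponential moments to exponential moments of order `r`. -/
noncomputable def expConst (a l r : ℝ) : ℝ≥0∞ := eexp (a * (a / l) ^ (1 / (r - 1)))

/-- Superlinearity of `x^r` for `r > 1`: a single moment of order `r` controls linear exponential
moments with any coefficient. -/
lemma lintegral_eexp_mul_abs_le {f : Ω → ℝ} {a b l r : ℝ} (ha : 0 ≤ a) (hb : 0 < b) (hl : 0 < l)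
    (hr : 1 < r) :
    ∫⁻ ω, eexp (a * |f ω|) ∂μ
      ≤ expConst (a * b) l r * ∫⁻ ω, eexp (l * (|f ω| / b) ^ r) ∂μ := by
  rw [expConst, ← lintegral_const_mul' _ _ (eexp_ne_top _)]
  refine lintegral_mono fun ω => ?_
  rw [← eexp_add]
  refine eexp_le_eexp ?_
  have := mul_le_mul_rpow_add (a := a * b) (by positivity) hl hr
    (show 0 ≤ |f ω| / b by positivity)
  rw [mul_assoc, mul_div_cancel₀ _ hb.ne'] at this
  linarith

lemma exists_le_eexp {x : ℝ≥0∞} (hx : x < ∞) : ∃ K : ℝ, 0 < K ∧ x ≤ eexp K := by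
  refine ⟨x.toReal + 1, by positivity, ?_⟩
  rw [← ENNReal.ofReal_toReal hx.ne]
  refine ENNReal.ofReal_le_ofReal ?_
  rw [ENNReal.toReal_ofReal (by positivity)]
  linarith [Real.add_one_le_exp (x.toReal + 1)]

end Auxiliary

/-! ### The operator: contraction in the gauge and moments along value iteration. -/

/-- The value recursion operator with the utility increment `w`. -/
noncomputable def riskOp {𝒳 : Type*} [MeasurableSpace 𝒳] (β : ℝ) (w : 𝒳 × 𝒳 → ℝ)
    (Q : Kernel 𝒳 𝒳) (f : 𝒳 → ℝ) (x : 𝒳) : ℝ :=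
  β * Real.log (∫ y, Real.exp (f y + w (x, y)) ∂(Q x))

/-- Value iteration from `0`. -/
noncomputable def valueIter {𝒳 : Type*} [MeasurableSpace 𝒳] (β : ℝ) (w : 𝒳 × 𝒳 → ℝ) (Q : Kernel 𝒳 𝒳) (n : ℕ) : 𝒳 → ℝ :=
  (riskOp β w Q)^[n] 0

lemma valueIter_succ {𝒳 : Type*} [MeasurableSpace 𝒳] {Q : Kernel 𝒳 𝒳} {β : ℝ} {w : 𝒳 × 𝒳 → ℝ}
    (n : ℕ) :
    valueIter β w Q (n + 1) = riskOp β w Q (valueIter β w Q n) :=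
  Function.iterate_succ_apply' _ _ _

section RiskOp

variable {𝒳 : Type*} [MeasurableSpace 𝒳] {Q : Kernel 𝒳 𝒳} [IsMarkovKernel Q] {Q₀ : Measure 𝒳}
  [IsProbabilityMeasure Q₀] {β r : ℝ} {w : 𝒳 × 𝒳 → ℝ}

lemma measurable_riskOp (hw : Measurable w) {f : 𝒳 → ℝ} (hf : Measurable f) :
    Measurable (riskOp β w Q f) := by
  have : StronglyMeasurable fun x => ∫ y, Real.exp (f y + w (x, y)) ∂(Q x) := by
    refine StronglyMeasurable.integral_kernel_prod_right
      (f := fun x y => Real.exp (f y + w (x, y))) ?_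
    refine Measurable.stronglyMeasurable ?_
    simp only [Function.uncurry_def]
    fun_prop
  exact (Real.measurable_log.comp this.measurable).const_mul β

/-- Stationarity: the next state again has law `Q₀`, so bounds on `f(X_{t+1})` and on `f(X_t)` are
interchangeable. -/
lemma lintegral_compProd_snd (hQ : Q.Invariant Q₀) {F : 𝒳 → ℝ≥0∞} (hF : Measurable F) :
    ∫⁻ z, F z.2 ∂(Q₀ ⊗ₘ Q) = ∫⁻ x, F x ∂Q₀ := by
  rw [Measure.lintegral_compProd (f := fun z => F z.2) (by fun_prop)]
  conv_rhs => rw [← hQ.def]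
  rw [Measure.lintegral_bind (Kernel.aemeasurable Q) hF.aemeasurable]

lemma lintegral_compProd_fst {F : 𝒳 → ℝ≥0∞} (hF : Measurable F) :
    ∫⁻ z, F z.1 ∂(Q₀ ⊗ₘ Q) = ∫⁻ x, F x ∂Q₀ := by
  rw [Measure.lintegral_compProd (f := fun z => F z.1) (by fun_prop)]
  simp

lemma ae_lintegral_lt_top {F : 𝒳 × 𝒳 → ℝ≥0∞} (hF : Measurable F)
    (h : ∫⁻ z, F z ∂(Q₀ ⊗ₘ Q) < ∞) : ∀ᵐ x ∂Q₀, ∫⁻ y, F (x, y) ∂(Q x) < ∞ := by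
  rw [Measure.lintegral_compProd hF] at h
  exact ae_lt_top (Measurable.lintegral_kernel_prod_right' hF) h.ne

/-- The operator contracts on sets with bounded exponential moments. -/
lemma ExpBound.riskOp_sub {K s c : ℝ} {f g : 𝒳 → ℝ} (hQ : Q.Invariant Q₀) (hβ₀ : 0 < β)
    (hβ₁ : β < 1) (hs : 1 ≤ s) (hc : 0 < c) (hw : Measurable w) (hf : Measurable f)
    (hg : Measurable g)
    (hΦ : ∫⁻ z, eexp (4 / (1 - β) * (|f z.2| + |g z.2| + |w z|)) ∂(Q₀ ⊗ₘ Q) ≤ eexp K)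
    (h : ExpBound K s c (fun x => f x - g x) Q₀) :
    ExpBound K s (β * (2 - β) * c) (fun x => riskOp β w Q f x - riskOp β w Q g x) Q₀ := by
  have hδ : 0 < 1 - β := by linarith
  have h2 : ∀ᵐ x ∂Q₀, ∫⁻ y, eexp (2 * (|f y| + |g y| + |w (x, y)|)) ∂(Q x) < ∞ := by
    refine ae_lintegral_lt_top (F := fun z => eexp (2 * (|f z.2| + |g z.2| + |w z|)))
      (by fun_prop) (lt_of_le_of_lt ?_ (hΦ.trans_lt (eexp_ne_top K).lt_top))
    refine lintegral_mono fun z => eexp_le_eexp ?_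
    refine mul_le_mul_of_nonneg_right ?_ (by positivity)
    rw [le_div_iff₀ hδ]
    linarith
  have key := expBound_of_kernel_le (Q := Q) (Q₀ := Q₀) (K := K) (c := c) (s := s)
    (G := fun x => Real.log (∫ y, Real.exp (f y + w (x, y)) ∂(Q x))
      - Real.log (∫ y, Real.exp (g y + w (x, y)) ∂(Q x)))
    (Φ := fun z => |f z.2| + |g z.2| + |w z|)
    (F := fun z => eexp ((|f z.2 - g z.2| / c) ^ s)) hβ₀ hβ₁ hs hc (by fun_prop) (by fun_prop)
    (by
      filter_upwards [h2] with x hx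
      exact eexp_log_integral_sub_le hs hc hf hg (by fun_prop) hx)
    (by
      rw [lintegral_compProd_snd hQ (F := fun y => eexp ((|f y - g y| / c) ^ s)) (by fun_prop)]
      exact h)
    hΦ
  have := key.const_mul hβ₀
  rw [← mul_assoc] at this
  refine le_of_eq_of_le (lintegral_congr fun x => ?_) this
  simp only [riskOp, mul_sub]

/-- Uniform bound on the `r`-exponential moments along the value iteration. -/
noncomputable def momentBound (β l r : ℝ) (W : ℝ≥0∞) : ℝ≥0∞ :=
  jensenConst l r / ENNReal.ofReal (1 - β) + W

lemma momentBound_lt_top {l : ℝ} {W : ℝ≥0∞} (hβ₁ : β < 1) (hW : W < ∞) :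
    momentBound β l r W < ∞ := by
  refine ENNReal.add_lt_top.2 ⟨ENNReal.div_lt_top (eexp_ne_top _) ?_, hW⟩
  simpa using hβ₁

/-- Integrating the one-step bound gives the map `m ↦ J + β m + (1-β) W`, and `momentBound` is its
fixed point `J/(1-β) + W`. -/
lemma lintegral_eexp_riskOp_le {l : ℝ} {f : 𝒳 → ℝ} {W : ℝ≥0∞} (hQ : Q.Invariant Q₀)
    (hβ₀ : 0 < β) (hβ₁ : β < 1) (hr : 1 < r) (hl : 0 < l) (hw : Measurable w) (hf : Measurable f)
    (hW : ∫⁻ z, eexp (l * (|w z| / (1 - β)) ^ r) ∂(Q₀ ⊗ₘ Q) ≤ W)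
    (h : ∫⁻ x, eexp (l * (|f x| / β) ^ r) ∂Q₀ ≤ momentBound β l r W) :
    ∫⁻ x, eexp (l * (|riskOp β w Q f x| / β) ^ r) ∂Q₀ ≤ momentBound β l r W := by
  have hδ : 0 < 1 - β := by linarith
  have hδ' : ENNReal.ofReal (1 - β) ≠ 0 := by simpa using hβ₁
  calc ∫⁻ x, eexp (l * (|riskOp β w Q f x| / β) ^ r) ∂Q₀
      ≤ ∫⁻ x, jensenConst l r + (ENNReal.ofReal β * ∫⁻ y, eexp (l * (|f y| / β) ^ r) ∂(Q x)
        + ENNReal.ofReal (1 - β) * ∫⁻ y, eexp (l * (|w (x, y)| / (1 - β)) ^ r) ∂(Q x)) ∂Q₀ := by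
        refine lintegral_mono fun x => ?_
        rw [riskOp, abs_mul, abs_of_pos hβ₀, mul_div_cancel_left₀ _ hβ₀.ne']
        exact eexp_abs_log_integral_le hr hl hβ₀ hβ₁ hf (by fun_prop)
    _ = jensenConst l r + (ENNReal.ofReal β * ∫⁻ x, eexp (l * (|f x| / β) ^ r) ∂Q₀
        + ENNReal.ofReal (1 - β) * ∫⁻ z, eexp (l * (|w z| / (1 - β)) ^ r) ∂(Q₀ ⊗ₘ Q)) := by
        have m1 : Measurable fun x => ∫⁻ y, eexp (l * (|f y| / β) ^ r) ∂(Q x) :=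
          Measurable.lintegral_kernel_prod_right'
            (f := fun z : 𝒳 × 𝒳 => eexp (l * (|f z.2| / β) ^ r)) (by fun_prop)
        rw [lintegral_add_left measurable_const, lintegral_add_left (m1.const_mul _),
          lintegral_const_mul' _ _ ENNReal.ofReal_ne_top,
          lintegral_const_mul' _ _ ENNReal.ofReal_ne_top,
          ← lintegral_compProd_snd hQ (F := fun x => eexp (l * (|f x| / β) ^ r)) (by fun_prop),
          Measure.lintegral_compProd (by fun_prop), Measure.lintegral_compProd (by fun_prop)]
        simp
    _ ≤ jensenConst l r + (ENNReal.ofReal β * momentBound β l r W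
        + ENNReal.ofReal (1 - β) * W) := by gcongr
    _ = momentBound β l r W := by
        have e1 : ENNReal.ofReal (1 - β) * (jensenConst l r / ENNReal.ofReal (1 - β))
            = jensenConst l r := ENNReal.mul_div_cancel hδ' ENNReal.ofReal_ne_top
        have e2 : ENNReal.ofReal β + ENNReal.ofReal (1 - β) = 1 := by
          rw [← ENNReal.ofReal_add hβ₀.le hδ.le]
          simp
        unfold momentBound
        set J := jensenConst l r / ENNReal.ofReal (1 - β)
        rw [← e1]
        calc _ = (ENNReal.ofReal β + ENNReal.ofReal (1 - β)) * J
              + (ENNReal.ofReal β + ENNReal.ofReal (1 - β)) * W := by ring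
          _ = _ := by rw [e2, one_mul, one_mul]

lemma measurable_valueIter (hw : Measurable w) (n : ℕ) : Measurable (valueIter β w Q n) := by
  induction n with
  | zero => exact measurable_const
  | succ n ih =>
    rw [valueIter_succ]
    exact measurable_riskOp hw ih

lemma lintegral_eexp_valueIter_le {l : ℝ} {W : ℝ≥0∞} (hQ : Q.Invariant Q₀)
    (hβ₀ : 0 < β) (hβ₁ : β < 1) (hr : 1 < r) (hl : 0 < l) (hw : Measurable w)
    (hW : ∫⁻ z, eexp (l * (|w z| / (1 - β)) ^ r) ∂(Q₀ ⊗ₘ Q) ≤ W) (n : ℕ) :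
    ∫⁻ x, eexp (l * (|valueIter β w Q n x| / β) ^ r) ∂Q₀ ≤ momentBound β l r W := by
  induction n with
  | zero =>
    have : ∫⁻ x, eexp (l * (|valueIter β w Q 0 x| / β) ^ r) ∂Q₀ = 1 := by
      simp [valueIter, Real.zero_rpow (by linarith : r ≠ 0), eexp_zero]
    rw [this]
    refine le_trans ?_ le_self_add
    rw [ENNReal.le_div_iff_mul_le (Or.inl (by simpa using hβ₁)) (Or.inl ENNReal.ofReal_ne_top),
      one_mul]
    refine le_trans ?_ (one_le_jensenConst hr hl)
    rw [← ENNReal.ofReal_one]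
    exact ENNReal.ofReal_le_ofReal (by linarith)
  | succ n ih =>
    rw [valueIter_succ]
    exact lintegral_eexp_riskOp_le hQ hβ₀ hβ₁ hr hl hw (measurable_valueIter hw n) hW ih

/-- Functions with bounded `r`-exponential moments have jointly bounded exponential moments. -/
lemma lintegral_eexp_three_le {a l : ℝ} {f g : 𝒳 → ℝ} {R W : ℝ≥0∞} (hQ : Q.Invariant Q₀)
    (hβ₀ : 0 < β) (hβ₁ : β < 1) (hr : 1 < r) (ha : 0 ≤ a) (hl : 0 < l)
    (hf : Measurable f) (hg : Measurable g)
    (hfR : ∫⁻ x, eexp (l * (|f x| / β) ^ r) ∂Q₀ ≤ R)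
    (hgR : ∫⁻ x, eexp (l * (|g x| / β) ^ r) ∂Q₀ ≤ R)
    (hW : ∫⁻ z, eexp (l * (|w z| / (1 - β)) ^ r) ∂(Q₀ ⊗ₘ Q) ≤ W) :
    ∫⁻ z, eexp (a * (|f z.2| + |g z.2| + |w z|)) ∂(Q₀ ⊗ₘ Q)
      ≤ expConst (3 * a * β) l r * R + expConst (3 * a * β) l r * R
        + expConst (3 * a * (1 - β)) l r * W := by
  have hδ : 0 < 1 - β := by linarith
  calc _ ≤ ∫⁻ z, eexp (3 * a * |f z.2|) + eexp (3 * a * |g z.2|) + eexp (3 * a * |w z|)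
        ∂(Q₀ ⊗ₘ Q) := lintegral_mono fun z =>
          eexp_add_three_le ha (abs_nonneg _) (abs_nonneg _) (abs_nonneg _)
    _ = ∫⁻ x, eexp (3 * a * |f x|) ∂Q₀ + ∫⁻ x, eexp (3 * a * |g x|) ∂Q₀
        + ∫⁻ z, eexp (3 * a * |w z|) ∂(Q₀ ⊗ₘ Q) := by
        rw [lintegral_add_left (by fun_prop), lintegral_add_left (by fun_prop),
          lintegral_compProd_snd hQ (F := fun x => eexp (3 * a * |f x|)) (by fun_prop),
          lintegral_compProd_snd hQ (F := fun x => eexp (3 * a * |g x|)) (by fun_prop)]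
    _ ≤ _ := by
        refine add_le_add (add_le_add ?_ ?_) ?_
        · exact (lintegral_eexp_mul_abs_le (by positivity) hβ₀ hl hr).trans (by gcongr)
        · exact (lintegral_eexp_mul_abs_le (by positivity) hβ₀ hl hr).trans (by gcongr)
        · exact (lintegral_eexp_mul_abs_le (by positivity) hδ hl hr).trans (by gcongr)

end RiskOp

/-! ### Existence and uniqueness of fixed points. -/

section FixedPoint

variable {𝒳 : Type*} [MeasurableSpace 𝒳] {Q : Kernel 𝒳 𝒳} [IsMarkovKernel Q] {Q₀ : Measure 𝒳}
  [IsProbabilityMeasure Q₀] {β r : ℝ} {w : 𝒳 × 𝒳 → ℝ}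

lemma contractionRate_pos (hβ₀ : 0 < β) (hβ₁ : β < 1) : 0 < β * (2 - β) :=
  mul_pos hβ₀ (by linarith)

/-- `β(2-β) = 1 - (1-β)²`. -/
lemma contractionRate_lt_one (hβ₁ : β < 1) : β * (2 - β) < 1 := by
  nlinarith [mul_pos (sub_pos.2 hβ₁) (sub_pos.2 hβ₁)]

/-- Two fixed points with finite exponential moments of every order agree. -/
theorem riskOp_fixedPoint_unique {v v' : 𝒳 → ℝ} (hQ : Q.Invariant Q₀) (hβ₀ : 0 < β) (hβ₁ : β < 1)
    (hw : Measurable w) (hv : Measurable v) (hv' : Measurable v')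
    (hΦ : ∫⁻ z, eexp (4 / (1 - β) * (|v z.2| + |v' z.2| + |w z|)) ∂(Q₀ ⊗ₘ Q) < ∞)
    (fv : riskOp β w Q v =ᵐ[Q₀] v) (fv' : riskOp β w Q v' =ᵐ[Q₀] v') : v =ᵐ[Q₀] v' := by
  obtain ⟨K, hK, hΦK⟩ := exists_le_eexp hΦ
  have hδ : 0 < 1 - β := by linarith
  have hm : Measurable fun x => v x - v' x := hv.sub hv'
  obtain ⟨c, hc, h0⟩ : ∃ c, 0 < c ∧ ExpBound K 1 c (fun x => v x - v' x) Q₀ := by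
    refine exists_expBound le_rfl hK hm.aemeasurable (lt_of_le_of_lt ?_ hΦ)
    rw [← lintegral_compProd_snd hQ (F := fun x => eexp (|v x - v' x| ^ (1 : ℝ))) (by fun_prop)]
    refine lintegral_mono fun z => eexp_le_eexp ?_
    rw [Real.rpow_one]
    have h4 : 1 ≤ 4 / (1 - β) := by
      rw [le_div_iff₀ hδ]
      linarith
    have := abs_sub (v z.2) (v' z.2)
    have := abs_nonneg (w z)
    nlinarith [abs_nonneg (v z.2), abs_nonneg (v' z.2)]
  have hρ0 := contractionRate_pos hβ₀ hβ₁
  have hρ1 := contractionRate_lt_one hβ₁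
  -- The operator reproduces `v - v'` almost everywhere, so each application shrinks the scale of
  -- one and the same function.
  have step : ∀ n : ℕ, ExpBound K 1 ((β * (2 - β)) ^ n * c) (fun x => v x - v' x) Q₀ := by
    intro n
    induction n with
    | zero => simpa using h0
    | succ n ih =>
      have := ih.riskOp_sub hQ hβ₀ hβ₁ le_rfl (by positivity) hw hv hv' hΦK
      rw [← mul_assoc, ← pow_succ'] at this
      refine this.mono_fun le_rfl (by positivity) ?_
      filter_upwards [fv, fv'] with x h1 h2
      rw [h1, h2]
  have lim : Tendsto (fun n => (β * (2 - β)) ^ n * c) atTop (𝓝 0) := by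
    simpa using (tendsto_pow_atTop_nhds_zero_of_lt_one hρ0.le hρ1).mul_const c
  filter_upwards [ae_eq_zero_of_expBound hm (fun n => by positivity) lim step] with x hx
  simpa [sub_eq_zero] using hx

lemma expBound_valueIter_sub {K c : ℝ} (hQ : Q.Invariant Q₀) (hβ₀ : 0 < β) (hβ₁ : β < 1)
    (hw : Measurable w) (hc : 0 < c)
    (hΦ : ∀ m n, ∫⁻ z, eexp (4 / (1 - β) * (|valueIter β w Q m z.2| + |valueIter β w Q n z.2| + |w z|))
      ∂(Q₀ ⊗ₘ Q) ≤ eexp K)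
    (h0 : ExpBound K 1 c (fun x => valueIter β w Q 1 x - valueIter β w Q 0 x) Q₀) (n : ℕ) :
    ExpBound K 1 ((β * (2 - β)) ^ n * c)
      (fun x => valueIter β w Q (n + 1) x - valueIter β w Q n x) Q₀ := by
  have hρ0 := contractionRate_pos hβ₀ hβ₁
  induction n with
  | zero => simpa using h0
  | succ n ih =>
    have := ih.riskOp_sub hQ hβ₀ hβ₁ le_rfl (by positivity) hw (measurable_valueIter hw (n + 1))
      (measurable_valueIter hw n) (hΦ _ _)
    rw [← mul_assoc, ← pow_succ'] at this
    simpa only [valueIter_succ] using this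

/-- Geometric series for the scales. With `ρ = β(2-β)`, the first increment is split off, and
`ρ^{n+1} c/(1-ρ) + ρ^n c = ρ^n c/(1-ρ)` closes the induction on `j`, with `n` left free. -/
lemma expBound_valueIter_sub_add {K c : ℝ} (hQ : Q.Invariant Q₀) (hβ₀ : 0 < β) (hβ₁ : β < 1)
    (hw : Measurable w) (hK : 0 ≤ K) (hc : 0 < c)
    (hΦ : ∀ m n, ∫⁻ z, eexp (4 / (1 - β) * (|valueIter β w Q m z.2| + |valueIter β w Q n z.2| + |w z|))
      ∂(Q₀ ⊗ₘ Q) ≤ eexp K)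
    (h0 : ExpBound K 1 c (fun x => valueIter β w Q 1 x - valueIter β w Q 0 x) Q₀) (j : ℕ) :
    ∀ n, ExpBound K 1 ((β * (2 - β)) ^ n * (c / (1 - β * (2 - β))))
      (fun x => valueIter β w Q (n + j) x - valueIter β w Q n x) Q₀ := by
  have hρ0 := contractionRate_pos hβ₀ hβ₁
  have hρ1 : 0 < 1 - β * (2 - β) := sub_pos.2 (contractionRate_lt_one hβ₁)
  induction j with
  | zero =>
    intro n
    simp only [ExpBound, add_zero, sub_self, abs_zero, zero_div, Real.rpow_one, eexp_zero,
      lintegral_const, measure_univ, mul_one]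
    exact one_le_eexp hK
  | succ j ih =>
    intro n
    have m1 := measurable_valueIter (β := β) (Q := Q) hw
    have h1 := (ih (n + 1)).add le_rfl (by positivity) (by positivity)
      ((m1 _).sub (m1 _)) (expBound_valueIter_sub hQ hβ₀ hβ₁ hw hc hΦ h0 n)
    have e : (β * (2 - β)) ^ (n + 1) * (c / (1 - β * (2 - β))) + (β * (2 - β)) ^ n * c
        = (β * (2 - β)) ^ n * (c / (1 - β * (2 - β))) := by
      rw [pow_succ]
      field_simp
      ring
    rw [e] at h1
    simpa [add_assoc, add_comm 1] using h1

/-- Existence of a fixed point with controlled `r`-exponential moments. -/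
theorem exists_riskOp_fixedPoint (hQ : Q.Invariant Q₀) (hβ₀ : 0 < β) (hβ₁ : β < 1) (hr : 1 < r)
    (hw : Measurable w)
    (hW : ∀ l : ℝ, 0 < l → ∫⁻ z, eexp (l * (|w z| / (1 - β)) ^ r) ∂(Q₀ ⊗ₘ Q) < ∞) :
    ∃ v : 𝒳 → ℝ, Measurable v ∧ riskOp β w Q v =ᵐ[Q₀] v ∧
      ∀ l : ℝ, 0 < l → ∫⁻ x, eexp (l * (|v x| / β) ^ r) ∂Q₀
        ≤ momentBound β l r (∫⁻ z, eexp (l * (|w z| / (1 - β)) ^ r) ∂(Q₀ ⊗ₘ Q)) := by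
  have hδ : 0 < 1 - β := by linarith
  have hρ0 := contractionRate_pos hβ₀ hβ₁
  have hρ1 := contractionRate_lt_one hβ₁
  have hρ2 : 0 < 1 - β * (2 - β) := sub_pos.2 hρ1
  set V := valueIter β w Q with hV
  have mV : ∀ n, Measurable (V n) := measurable_valueIter hw
  have momV : ∀ l : ℝ, 0 < l → ∀ n, ∫⁻ x, eexp (l * (|V n x| / β) ^ r) ∂Q₀
      ≤ momentBound β l r (∫⁻ z, eexp (l * (|w z| / (1 - β)) ^ r) ∂(Q₀ ⊗ₘ Q)) :=
    fun l hl n => lintegral_eexp_valueIter_le hQ hβ₀ hβ₁ hr hl hw le_rfl n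
  set R := momentBound β 1 r (∫⁻ z, eexp (1 * (|w z| / (1 - β)) ^ r) ∂(Q₀ ⊗ₘ Q)) with hR
  have hRtop : R < ∞ := momentBound_lt_top hβ₁ (hW 1 one_pos)
  -- One level for every pair of functions whose moments are at most `R`; it covers the iterates
  -- and, after Fatou, their limit.
  obtain ⟨K, hK, hΦK⟩ : ∃ K : ℝ, 0 < K ∧ ∀ f g : 𝒳 → ℝ, Measurable f → Measurable g →
      ∫⁻ x, eexp (1 * (|f x| / β) ^ r) ∂Q₀ ≤ R → ∫⁻ x, eexp (1 * (|g x| / β) ^ r) ∂Q₀ ≤ R →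
      ∫⁻ z, eexp (4 / (1 - β) * (|f z.2| + |g z.2| + |w z|)) ∂(Q₀ ⊗ₘ Q) ≤ eexp K := by
    have fin : expConst (3 * (4 / (1 - β)) * β) 1 r * R + expConst (3 * (4 / (1 - β)) * β) 1 r * R
        + expConst (3 * (4 / (1 - β)) * (1 - β)) 1 r
          * (∫⁻ z, eexp (1 * (|w z| / (1 - β)) ^ r) ∂(Q₀ ⊗ₘ Q)) < ∞ :=
      ENNReal.add_lt_top.2 ⟨ENNReal.add_lt_top.2
        ⟨ENNReal.mul_lt_top (eexp_ne_top _).lt_top hRtop,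
          ENNReal.mul_lt_top (eexp_ne_top _).lt_top hRtop⟩,
        ENNReal.mul_lt_top (eexp_ne_top _).lt_top (hW 1 one_pos)⟩
    obtain ⟨K, hK, h⟩ := exists_le_eexp fin
    refine ⟨K, hK, fun f g hf hg hfR hgR => le_trans ?_ h⟩
    exact lintegral_eexp_three_le hQ hβ₀ hβ₁ hr (by positivity) one_pos hf hg hfR hgR le_rfl
  have hΦV : ∀ m n, ∫⁻ z, eexp (4 / (1 - β) * (|V m z.2| + |V n z.2| + |w z|)) ∂(Q₀ ⊗ₘ Q)
      ≤ eexp K := fun m n => hΦK _ _ (mV m) (mV n) (momV 1 one_pos m) (momV 1 one_pos n)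
  obtain ⟨c, hc, h0⟩ : ∃ c, 0 < c ∧ ExpBound K 1 c (fun x => V 1 x - V 0 x) Q₀ := by
    refine exists_expBound le_rfl hK ((mV 1).sub (mV 0)).aemeasurable
      (lt_of_le_of_lt ?_ ((hΦV 1 0).trans_lt (eexp_ne_top K).lt_top))
    rw [← lintegral_compProd_snd hQ (F := fun x => eexp (|V 1 x - V 0 x| ^ (1 : ℝ)))
      (by have := mV 0; have := mV 1; fun_prop)]
    refine lintegral_mono fun z => eexp_le_eexp ?_
    rw [Real.rpow_one]
    have h4 : 1 ≤ 4 / (1 - β) := by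
      rw [le_div_iff₀ hδ]
      linarith
    have := abs_sub (V 1 z.2) (V 0 z.2)
    have := abs_nonneg (w z)
    nlinarith [abs_nonneg (V 1 z.2), abs_nonneg (V 0 z.2)]
  have hstep := expBound_valueIter_sub hQ hβ₀ hβ₁ hw hc hΦV h0
  have htail := expBound_valueIter_sub_add hQ hβ₀ hβ₁ hw hK.le hc hΦV h0
  rw [← hV] at hstep htail
  -- The increments are summable in `L¹` by the geometric bound, hence summable almost everywhere.
  have hconv : ∀ᵐ x ∂Q₀, ∃ y, Tendsto (fun n => V n x) atTop (𝓝 y) := by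
    have hsum : ∫⁻ x, ∑' n, ENNReal.ofReal |V (n + 1) x - V n x| ∂Q₀ ≠ ∞ := by
      rw [lintegral_tsum fun n => by have := mV n; have := mV (n + 1); fun_prop]
      refine ne_of_lt (lt_of_le_of_lt
        (ENNReal.tsum_le_tsum fun n => (hstep n).lintegral_abs_le (by positivity)) ?_)
      rw [ENNReal.tsum_mul_right, ← ENNReal.ofReal_tsum_of_nonneg (fun n => by positivity)
        ((summable_geometric_of_lt_one hρ0.le hρ1).mul_right c)]
      exact ENNReal.mul_lt_top ENNReal.ofReal_lt_top (eexp_ne_top K).lt_top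
    have hm : Measurable fun x => ∑' n, ENNReal.ofReal |V (n + 1) x - V n x| :=
      Measurable.tsum fun n => by have := mV n; have := mV (n + 1); fun_prop
    filter_upwards [ae_lt_top hm hsum] with x hx
    refine cauchySeq_tendsto_of_complete (cauchySeq_of_summable_dist ?_)
    have := ENNReal.summable_toReal hx.ne
    refine this.congr fun n => ?_
    rw [ENNReal.toReal_ofReal (abs_nonneg _), dist_comm, Real.dist_eq]
  obtain ⟨v, mv, hv⟩ := measurable_limit_of_tendsto_metrizable_ae (fun n => (mV n).aemeasurable) hconv
  have momv : ∀ l : ℝ, 0 < l → ∫⁻ x, eexp (l * (|v x| / β) ^ r) ∂Q₀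
      ≤ momentBound β l r (∫⁻ z, eexp (l * (|w z| / (1 - β)) ^ r) ∂(Q₀ ⊗ₘ Q)) := by
    intro l hl
    refine lintegral_le_of_ae_tendsto (F := fun n x => eexp (l * (|V n x| / β) ^ r))
      (fun n => by have := mV n; fun_prop) ?_ (momV l hl)
    filter_upwards [hv] with x hx
    refine (continuous_eexp.tendsto _).comp (Tendsto.const_mul l ?_)
    exact ((hx.abs.div_const β).rpow_const (Or.inr (by linarith)))
  have hlimv : ∀ n, ExpBound K 1 ((β * (2 - β)) ^ n * (c / (1 - β * (2 - β))))
      (fun x => v x - V n x) Q₀ := by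
    intro n
    refine lintegral_le_of_ae_tendsto
      (F := fun j x => eexp ((|V (n + j) x - V n x|
        / ((β * (2 - β)) ^ n * (c / (1 - β * (2 - β))))) ^ (1 : ℝ)))
      (fun j => by have := mV n; have := mV (n + j); fun_prop) ?_ (fun j => htail j n)
    filter_upwards [hv] with x hx
    refine (continuous_eexp.tendsto _).comp ?_
    have hx' : Tendsto (fun j => V (n + j) x) atTop (𝓝 (v x)) := by
      simpa only [add_comm n] using (tendsto_add_atTop_iff_nat n).2 hx
    exact (((hx'.sub_const _).abs.div_const _).rpow_const (Or.inr (by norm_num)))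
  refine ⟨v, mv, ?_, momv⟩
  have mT : Measurable (riskOp β w Q v) := measurable_riskOp hw mv
  -- `Tv - v = (Tv - TVₙ) + (Vₙ₊₁ - v)`, where both terms have the scale of step `n + 1`.
  have hfix : ∀ n : ℕ, ExpBound K 1 (2 * ((β * (2 - β)) ^ (n + 1) * (c / (1 - β * (2 - β)))))
      (fun x => riskOp β w Q v x - v x) Q₀ := by
    intro n
    have h1 := (hlimv n).riskOp_sub hQ hβ₀ hβ₁ le_rfl (by positivity) hw mv (mV n)
      (hΦK _ _ mv (mV n) (momv 1 one_pos) (momV 1 one_pos n))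
    rw [← mul_assoc, ← pow_succ'] at h1
    have h2 : ExpBound K 1 ((β * (2 - β)) ^ (n + 1) * (c / (1 - β * (2 - β))))
        (fun x => V (n + 1) x - v x) Q₀ :=
      (hlimv (n + 1)).mono_fun le_rfl (by positivity) (ae_of_all _ fun x => (abs_sub_comm _ _).le)
    have h3 := h1.add le_rfl (by positivity) (by positivity)
      (mT.sub (measurable_riskOp hw (mV n))) h2
    rw [← two_mul] at h3
    refine h3.mono_fun le_rfl (by positivity) (ae_of_all _ fun x => le_of_eq ?_)
    rw [hV, valueIter_succ]
    simp
  have lim : Tendsto (fun n => 2 * ((β * (2 - β)) ^ (n + 1) * (c / (1 - β * (2 - β))))) atTop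
      (𝓝 0) := by
    have := ((tendsto_pow_atTop_nhds_zero_of_lt_one hρ0.le hρ1).comp (tendsto_add_atTop_nat 1))
    simpa using (this.mul_const (c / (1 - β * (2 - β)))).const_mul 2
  filter_upwards [ae_eq_zero_of_expBound (mT.sub mv) (fun n => by positivity) lim hfix] with x hx
  simpa [sub_eq_zero] using hx

end FixedPoint

/-! ### Change of measure with density `exp l`. -/

section Density

variable {Ω : Type*} [MeasurableSpace Ω] {μ ν : Measure Ω} {l ψ : Ω → ℝ}

lemma integral_withDensity_eexp (hl : Measurable l) (F : Ω → ℝ) :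
    ∫ ω, F ω ∂(μ.withDensity fun ω => eexp (l ω)) = ∫ ω, Real.exp (l ω) * F ω ∂μ := by
  rw [integral_withDensity_eq_integral_toReal_smul (by fun_prop)
    (ae_of_all _ fun ω => (eexp_ne_top _).lt_top)]
  simp [toReal_eexp]

lemma integrable_withDensity_eexp (hl : Measurable l) {F : Ω → ℝ} :
    Integrable F (μ.withDensity fun ω => eexp (l ω))
      ↔ Integrable (fun ω => Real.exp (l ω) * F ω) μ := by
  rw [integrable_withDensity_iff_integrable_smul' (by fun_prop)
    (ae_of_all _ fun ω => (eexp_ne_top _).lt_top)]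
  simp [toReal_eexp]

lemma eq_withDensity_neg (hl : Measurable l) (h : ν = μ.withDensity fun ω => eexp (l ω)) :
    μ = ν.withDensity fun ω => eexp (-l ω) := by
  rw [h, ← withDensity_mul _ (by fun_prop) (by fun_prop)]
  have : (fun ω => eexp (l ω)) * (fun ω => eexp (-l ω)) = 1 := by
    ext ω
    simp [← eexp_add, eexp_zero]
  rw [this, withDensity_one]

/-- The `ν`-moment of `e^ψ` is the `μ`-moment of `e^{l+ψ}`, so Gibbs' inequality applies to two
exponents that differ by `l`. -/
lemma log_integral_exp_sub_le_of_withDensity [IsProbabilityMeasure μ]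
    (hl : Measurable l)
    (h : ν = μ.withDensity fun ω => eexp (l ω))
    (hμ : Integrable (fun ω => Real.exp (ψ ω)) μ) (hν : Integrable (fun ω => Real.exp (ψ ω)) ν)
    (hi : Integrable l (μ.tilted ψ)) :
    Real.log (∫ ω, Real.exp (ψ ω) ∂μ) - Real.log (∫ ω, Real.exp (ψ ω) ∂ν)
      ≤ ∫ ω, |l ω| ∂(μ.tilted ψ) := by
  have e1 : ∫ ω, Real.exp (ψ ω) ∂ν = ∫ ω, Real.exp (l ω + ψ ω) ∂μ := by
    rw [h, integral_withDensity_eexp hl]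
    simp_rw [Real.exp_add]
  have i1 : Integrable (fun ω => Real.exp (l ω + ψ ω)) μ := by
    rw [h, integrable_withDensity_eexp hl] at hν
    simpa only [Real.exp_add] using hν
  have hd : ∀ ω, ψ ω - (l ω + ψ ω) = -l ω := fun ω => by ring
  rw [e1]
  refine (log_integral_exp_sub_le hμ i1 (by simp only [hd]; exact hi.neg)).trans ?_
  simp only [hd]
  exact integral_mono hi.neg hi.abs fun ω => neg_le_abs _

variable [IsProbabilityMeasure ν]

lemma integrable_exp_of_withDensity (hl : Measurable l)
    (h : ν = μ.withDensity fun ω => eexp (l ω)) :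
    Integrable (fun ω => Real.exp (l ω)) μ ∧ ∫ ω, Real.exp (l ω) ∂μ = 1 := by
  constructor
  · have := (integrable_withDensity_eexp (μ := μ) hl (F := fun _ => (1 : ℝ))).1
      (by rw [← h]; exact integrable_const _)
    simpa using this
  · have := integral_withDensity_eexp (μ := μ) hl fun _ => (1 : ℝ)
    rw [← h] at this
    simpa using this.symm

lemma eq_tilted_of_withDensity (hl : Measurable l) (h : ν = μ.withDensity fun ω => eexp (l ω)) :
    ν = μ.tilted l := by
  rw [Measure.tilted, (integrable_exp_of_withDensity hl h).2, h]
  simp [eexp]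

variable [IsProbabilityMeasure μ]

/-- The change in a log exponential moment caused by a change of measure. -/
lemma abs_log_integral_exp_sub_le (hl : Measurable l)
    (h : ν = μ.withDensity fun ω => eexp (l ω))
    (hμ : Integrable (fun ω => Real.exp (ψ ω)) μ) (hν : Integrable (fun ω => Real.exp (ψ ω)) ν)
    (hiμ : Integrable l (μ.tilted ψ)) (hiν : Integrable l (ν.tilted ψ)) :
    |Real.log (∫ ω, Real.exp (ψ ω) ∂ν) - Real.log (∫ ω, Real.exp (ψ ω) ∂μ)|
      ≤ ∫ ω, |l ω| ∂(μ.tilted ψ) + ∫ ω, |l ω| ∂(ν.tilted ψ) := by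
  have a := log_integral_exp_sub_le_of_withDensity hl h hμ hν hiμ
  have b := log_integral_exp_sub_le_of_withDensity (l := fun ω => -l ω) hl.neg
    (eq_withDensity_neg hl h) hν hμ hiν.neg
  simp only [abs_neg] at b
  have p1 : 0 ≤ ∫ ω, |l ω| ∂(μ.tilted ψ) := integral_nonneg fun ω => abs_nonneg _
  have p2 : 0 ≤ ∫ ω, |l ω| ∂(ν.tilted ψ) := integral_nonneg fun ω => abs_nonneg _
  rw [abs_le]
  constructor <;> linarith

/-- The relative entropy `-E^μ[l]` is at most the mean under `ν` of the absolute score. -/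
lemma abs_integral_le_of_withDensity (hl : Measurable l)
    (h : ν = μ.withDensity fun ω => eexp (l ω)) (hiμ : Integrable l μ) (hiν : Integrable l ν) :
    |∫ ω, l ω ∂μ| ≤ ∫ ω, |l ω - ∫ ω', l ω' ∂μ| ∂ν := by
  obtain ⟨i1, e1⟩ := integrable_exp_of_withDensity hl h
  obtain ⟨i2, e2⟩ := integrable_exp_of_withDensity (l := fun ω => -l ω) hl.neg
    (eq_withDensity_neg hl h)
  -- Since `e^l` and `e^{-l}` are densities, Jensen gives `E^μ l ≤ 0 ≤ E^ν l`, hence `-E^μ l ≤ E^ν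
  -- (l - E^μ l)`.
  have a := exp_integral_le hiμ i1
  have b := exp_integral_le hiν.neg i2
  rw [e1, Real.exp_le_one_iff] at a
  simp only [Pi.neg_apply] at b
  rw [e2, Real.exp_le_one_iff, integral_neg] at b
  have c : ∫ ω, (l ω - ∫ ω', l ω' ∂μ) ∂ν ≤ ∫ ω, |l ω - ∫ ω', l ω' ∂μ| ∂ν :=
    integral_mono (hiν.sub (integrable_const _)) (hiν.sub (integrable_const _)).abs
      fun ω => le_abs_self _
  rw [integral_sub hiν (integrable_const _)] at c
  simp only [integral_const, probReal_univ, one_smul] at c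
  rw [abs_of_nonpos a]
  linarith

end Density

/-! ### Tilted conditional expectations in the gauge. -/

section Tilt

variable {𝒳 : Type*} [MeasurableSpace 𝒳] {Q : Kernel 𝒳 𝒳} [IsMarkovKernel Q] {Q₀ : Measure 𝒳}
  [IsProbabilityMeasure Q₀] {β K s c : ℝ} {ψ h : 𝒳 × 𝒳 → ℝ}

lemma measurable_integral_tilted (hψ : Measurable ψ) (hh : Measurable h) :
    Measurable fun x => ∫ y, |h (x, y)| ∂((Q x).tilted fun y => ψ (x, y)) := by
  simp_rw [integral_tilted, smul_eq_mul]
  have hZ : Measurable fun x => ∫ y, Real.exp (ψ (x, y)) ∂(Q x) := by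
    refine (StronglyMeasurable.integral_kernel_prod_right
      (f := fun x y => Real.exp (ψ (x, y))) ?_).measurable
    refine Measurable.stronglyMeasurable ?_
    simp only [Function.uncurry_def]
    fun_prop
  refine (StronglyMeasurable.integral_kernel_prod_right
    (f := fun x y => Real.exp (ψ (x, y)) / (∫ y, Real.exp (ψ (x, y)) ∂(Q x)) * |h (x, y)|)
    ?_).measurable
  refine Measurable.stronglyMeasurable ?_
  simp only [Function.uncurry_def]
  exact ((Real.measurable_exp.comp hψ).div (hZ.comp measurable_fst)).mul (by fun_prop)

lemma ae_lintegral_two_mul_lt_top (hβ₀ : 0 < β) (hβ₁ : β < 1) (hψ : Measurable ψ)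
    (hΦ : ∫⁻ z, eexp (4 / (1 - β) * |ψ z|) ∂(Q₀ ⊗ₘ Q) < ∞) :
    ∀ᵐ x ∂Q₀, ∫⁻ y, eexp (2 * |ψ (x, y)|) ∂(Q x) < ∞ := by
  refine ae_lintegral_lt_top (F := fun z => eexp (2 * |ψ z|))
      (by fun_prop) (lt_of_le_of_lt ?_ hΦ)
  refine lintegral_mono fun z => eexp_le_eexp ?_
  refine mul_le_mul_of_nonneg_right ?_ (by positivity)
  rw [le_div_iff₀ (by linarith)]
  linarith

/-- Tilted conditional expectations are bounded between Orlicz spaces. -/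
lemma ExpBound.tilted (hβ₀ : 0 < β) (hβ₁ : β < 1) (hs : 1 ≤ s) (hc : 0 < c) (hψ : Measurable ψ)
    (hh : Measurable h) (hΦ : ∫⁻ z, eexp (4 / (1 - β) * |ψ z|) ∂(Q₀ ⊗ₘ Q) ≤ eexp K)
    (hb : ExpBound K s c h (Q₀ ⊗ₘ Q)) :
    (∀ᵐ x ∂Q₀, Integrable (fun y => h (x, y)) ((Q x).tilted fun y => ψ (x, y))) ∧
    ExpBound K s ((2 - β) * c)
      (fun x => ∫ y, |h (x, y)| ∂((Q x).tilted fun y => ψ (x, y))) Q₀ := by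
  have h2 := ae_lintegral_two_mul_lt_top (Q := Q) hβ₀ hβ₁ hψ (hΦ.trans_lt (eexp_ne_top K).lt_top)
  have h3 : ∀ᵐ x ∂Q₀, ∫⁻ y, eexp ((|h (x, y)| / c) ^ s) ∂(Q x) < ∞ :=
    ae_lintegral_lt_top (F := fun z => eexp ((|h z| / c) ^ s)) (by fun_prop)
      (lt_of_le_of_lt hb (eexp_ne_top K).lt_top)
  have key : ∀ᵐ x ∂Q₀, Integrable (fun y => |h (x, y)| / c) ((Q x).tilted fun y => ψ (x, y)) ∧
      eexp ((∫ y, |h (x, y)| / c ∂((Q x).tilted fun y => ψ (x, y))) ^ s)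
        ≤ (∫⁻ y, eexp (2 * |ψ (x, y)|) ∂(Q x)) ^ 2 * ∫⁻ y, eexp ((|h (x, y)| / c) ^ s) ∂(Q x) := by
    filter_upwards [h2, h3] with x hx2 hx3
    exact integrable_tilted_and_eexp_le hs (by fun_prop) hx2 (by fun_prop)
      (fun y => by positivity) hx3
  constructor
  · filter_upwards [key] with x hx
    have hi : Integrable (fun y => |h (x, y)|) ((Q x).tilted fun y => ψ (x, y)) := by
      simpa [div_mul_cancel₀ _ hc.ne'] using hx.1.mul_const c
    exact (integrable_norm_iff (hh.comp measurable_prodMk_left).aestronglyMeasurable).1 hi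
  · refine expBound_of_kernel_le (Q := Q) (Φ := fun z => |ψ z|)
      (F := fun z => eexp ((|h z| / c) ^ s)) hβ₀ hβ₁ hs hc (by fun_prop) (by fun_prop) ?_ hb hΦ
    filter_upwards [key] with x hx
    rw [abs_of_nonneg (integral_nonneg fun y => abs_nonneg _), ← integral_div]
    exact hx.2

end Tilt

/-! ### Distance between fixed points against the defect `Tv - v`. -/

section Perturbation

variable {𝒳 : Type*} [MeasurableSpace 𝒳] {P : Kernel 𝒳 𝒳} [IsMarkovKernel P] {P₀ : Measure 𝒳}
  [IsProbabilityMeasure P₀] {β K s c : ℝ} {w : 𝒳 × 𝒳 → ℝ} {v vhat : 𝒳 → ℝ}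

/-- Write `v̂ - v = (Tv̂ - Tv) + (Tv - v)` and iterate: a scale `a` improves to `ρ a + c`, with
limit `c/(1-ρ)`. Some finite scale is needed to start, and the factor `2` absorbs the remainder
after finitely many steps. -/
lemma expBound_fixedPoint_sub_le (hP : P.Invariant P₀) (hβ₀ : 0 < β) (hβ₁ : β < 1) (hs : 1 ≤ s)
    (hw : Measurable w) (hv : Measurable v) (hvhat : Measurable vhat)
    (hΦ : ∫⁻ z, eexp (4 / (1 - β) * (|vhat z.2| + |v z.2| + |w z|)) ∂(P₀ ⊗ₘ P) ≤ eexp K)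
    (fvhat : riskOp β w P vhat =ᵐ[P₀] vhat)
    (hd : ∃ d, 0 < d ∧ ExpBound K s d (fun x => vhat x - v x) P₀)
    (hc : 0 < c) (h : ExpBound K s c (fun x => riskOp β w P v x - v x) P₀) :
    ExpBound K s (2 / (1 - β * (2 - β)) * c) (fun x => vhat x - v x) P₀ := by
  obtain ⟨d, hd0, hd⟩ := hd
  have hρ0 := contractionRate_pos hβ₀ hβ₁
  have hρ1 := contractionRate_lt_one hβ₁
  have hρ2 : 0 < 1 - β * (2 - β) := sub_pos.2 hρ1
  have mT : Measurable (riskOp β w P v) := measurable_riskOp hw hv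
  have mT' : Measurable (riskOp β w P vhat) := measurable_riskOp hw hvhat
  have step : ∀ n : ℕ, ExpBound K s ((β * (2 - β)) ^ n * d + c / (1 - β * (2 - β)))
      (fun x => vhat x - v x) P₀ := by
    intro n
    induction n with
    | zero => exact hd.mono_scale hs hd0 (by simp only [pow_zero, one_mul]; linarith [div_pos hc hρ2])
    | succ n ih =>
      have h1 := (ih.riskOp_sub hP hβ₀ hβ₁ hs (by positivity) hw hvhat hv hΦ).add hs
        (by positivity) hc (mT'.sub mT) h
      have e : β * (2 - β) * ((β * (2 - β)) ^ n * d + c / (1 - β * (2 - β))) + c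
          = (β * (2 - β)) ^ (n + 1) * d + c / (1 - β * (2 - β)) := by
        rw [pow_succ]
        field_simp
        ring
      rw [e] at h1
      refine h1.mono_fun hs (by positivity) ?_
      filter_upwards [fvhat] with x hx
      simp [hx]
  have lim : Tendsto (fun n => (β * (2 - β)) ^ n * d) atTop (𝓝 0) := by
    simpa using (tendsto_pow_atTop_nhds_zero_of_lt_one hρ0.le hρ1).mul_const d
  obtain ⟨n, hn⟩ := (lim.eventually (eventually_le_nhds (div_pos hc hρ2))).exists
  refine (step n).mono_scale hs (by positivity) ?_
  have : 2 / (1 - β * (2 - β)) * c = c / (1 - β * (2 - β)) + c / (1 - β * (2 - β)) := by ring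
  rw [this]
  linarith

lemma expBound_riskOp_sub_self_le (hP : P.Invariant P₀) (hβ₀ : 0 < β) (hβ₁ : β < 1) (hs : 1 ≤ s)
    (hw : Measurable w) (hv : Measurable v) (hvhat : Measurable vhat)
    (hΦ : ∫⁻ z, eexp (4 / (1 - β) * (|vhat z.2| + |v z.2| + |w z|)) ∂(P₀ ⊗ₘ P) ≤ eexp K)
    (fvhat : riskOp β w P vhat =ᵐ[P₀] vhat)
    (hc : 0 < c) (h : ExpBound K s c (fun x => vhat x - v x) P₀) :
    ExpBound K s (2 * c) (fun x => riskOp β w P v x - v x) P₀ := by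
  have hρ0 := contractionRate_pos hβ₀ hβ₁
  have hρ1 := contractionRate_lt_one hβ₁
  have mT : Measurable (riskOp β w P v) := measurable_riskOp hw hv
  have mT' : Measurable (riskOp β w P vhat) := measurable_riskOp hw hvhat
  have h1 := (h.riskOp_sub hP hβ₀ hβ₁ hs hc hw hvhat hv hΦ).mono_fun
    (g := fun x => riskOp β w P v x - vhat x) hs (by positivity) (by
      filter_upwards [fvhat] with x hx
      rw [hx, abs_sub_comm])
  have h2 := h1.add hs (by positivity) hc (mT.sub hvhat) h
  refine (h2.mono_scale (d := 2 * c) hs (by positivity) (by nlinarith)).mono_fun hs (by positivity)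
    (ae_of_all _ fun x => ?_)
  simp

end Perturbation

/-! ### Score, log-likelihood ratio and operators, relative to a reference model. -/

section Comparison

variable {𝒳 : Type*} [MeasurableSpace 𝒳] {Q P Qhat : Kernel 𝒳 𝒳} [IsMarkovKernel Q]
  [IsMarkovKernel P] [IsMarkovKernel Qhat] {Q₀ P₀ : Measure 𝒳} [IsProbabilityMeasure Q₀]
  [IsProbabilityMeasure P₀] {β K s A c : ℝ} {l ψ w : 𝒳 × 𝒳 → ℝ} {v vhat : 𝒳 → ℝ}

/-- A log-density is just an extra utility increment, so the theory for the stationary reference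
model applies to the operator of `Qhat`. -/
lemma riskOp_eq_of_withDensity {P Qhat : Kernel 𝒳 𝒳} (hψ : Measurable ψ)
    (hPψ : ∀ x, Qhat x = (P x).withDensity fun y => eexp (ψ (x, y))) (f : 𝒳 → ℝ) :
    riskOp β w Qhat f = riskOp β (fun z => w z + ψ z) P f := by
  ext x
  rw [riskOp, riskOp, hPψ x, integral_withDensity_eexp (l := fun y => ψ (x, y))
    (hψ.comp measurable_prodMk_left)]
  simp_rw [← Real.exp_add]
  congr 3
  ext y
  congr 1
  ring

/-- The score controls the log-likelihood ratio. -/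
lemma expBound_of_score (hβ₀ : 0 < β) (hβ₁ : β < 1) (hs : 1 ≤ s) (hK : 0 ≤ K) (hA : 1 ≤ A)
    (hlm : Measurable l) (hψ : Measurable ψ)
    (hQl : ∀ x, Qhat x = (Q x).withDensity fun y => eexp (l (x, y)))
    (hPψ : ∀ x, Qhat x = (P x).withDensity fun y => eexp (ψ (x, y)))
    (hPQ : P₀ ≪ Q₀)
    (t₁ : ∀ (f : 𝒳 → ℝ) (c : ℝ), Measurable f → 0 < c →
      ExpBound K s c f P₀ → ExpBound K s (A * c) f Q₀)
    (t₂ : ∀ (h : 𝒳 × 𝒳 → ℝ) (c : ℝ), Measurable h → 0 < c →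
      ExpBound K s c h (Q₀ ⊗ₘ Q) → ExpBound K s (A * c) h (P₀ ⊗ₘ P))
    (hΦ : ∫⁻ z, eexp (4 / (1 - β) * |ψ z|) ∂(P₀ ⊗ₘ P) ≤ eexp K)
    (hl : ∃ d, 0 < d ∧ ExpBound K s d l (Q₀ ⊗ₘ Q))
    (hc : 0 < c) (hη : ExpBound K s c (fun z => l z - ∫ y, l (z.1, y) ∂(Q z.1)) (Q₀ ⊗ₘ Q)) :
    ExpBound K s ((1 + 2 * A ^ 2) * c) l (Q₀ ⊗ₘ Q) := by
  obtain ⟨d, hd, hl⟩ := hl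
  have hA0 : 0 < A := by linarith
  have hκm : Measurable fun x => ∫ y, l (x, y) ∂(Q x) :=
    (StronglyMeasurable.integral_kernel_prod_right (f := fun x y => l (x, y))
      hlm.stronglyMeasurable).measurable
  have hηm : Measurable fun z : 𝒳 × 𝒳 => l z - ∫ y, l (z.1, y) ∂(Q z.1) :=
    hlm.sub (hκm.comp measurable_fst)
  -- Bounds on tilted expectations thereby become bounds on conditional expectations under `Qhat`.
  have hν : ∀ x, (P x).tilted (fun y => ψ (x, y)) = Qhat x := fun x =>
    (eq_tilted_of_withDensity (hψ.comp measurable_prodMk_left) (hPψ x)).symm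
  -- The trivial tilt `ψ = 0` gives integrability under `Q x` itself.
  have i1 : ∀ᵐ x ∂P₀, Integrable (fun y => l (x, y)) (Q x) := by
    have := (ExpBound.tilted (ψ := fun _ => 0) hβ₀ hβ₁ hs hd measurable_const hlm
      (by simpa [eexp_zero] using one_le_eexp hK) hl).1
    filter_upwards [hPQ.ae_le this] with x hx
    simpa [tilted_const] using hx
  have i2 : ∀ᵐ x ∂P₀, Integrable (fun y => l (x, y)) (Qhat x) := by
    have := (ExpBound.tilted hβ₀ hβ₁ hs (by positivity) hψ hlm hΦ (t₂ l d hlm hd hl)).1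
    filter_upwards [this] with x hx
    rwa [hν] at hx
  have b1 := (ExpBound.tilted hβ₀ hβ₁ hs (by positivity) hψ hηm hΦ (t₂ _ c hηm hc hη)).2
  simp only [hν] at b1
  -- The conditional mean of `l` is a relative entropy up to sign, dominated by the `Qhat`-mean of
  -- the absolute score; `2 - β` is rounded up to `2`.
  have b2 : ExpBound K s (2 * A * c) (fun x => ∫ y, l (x, y) ∂(Q x)) P₀ := by
    have b1' := b1.mono_scale (d := 2 * A * c) hs
      (mul_pos (by linarith) (by positivity)) (by nlinarith [mul_pos hA0 hc])
    refine b1'.mono_fun hs (by positivity) ?_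
    filter_upwards [i1, i2] with x h1 h2
    refine (abs_integral_le_of_withDensity (hlm.comp measurable_prodMk_left) (hQl x) h1 h2).trans
      (le_abs_self _)
  have b3 := t₁ _ _ hκm (by positivity) b2
  have b4 : ExpBound K s (A * (2 * A * c)) (fun z : 𝒳 × 𝒳 => ∫ y, l (z.1, y) ∂(Q z.1))
      (Q₀ ⊗ₘ Q) := by
    unfold ExpBound
    rw [lintegral_compProd_fst
      (F := fun x => eexp ((|∫ y, l (x, y) ∂(Q x)| / (A * (2 * A * c))) ^ s)) (by fun_prop)]
    exact b3
  have b5 := hη.add hs hc (by positivity) hηm b4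
  have e : c + A * (2 * A * c) = (1 + 2 * A ^ 2) * c := by ring
  simpa [e] using b5

/-- The log-likelihood ratio controls the difference of the two operators. -/
lemma expBound_riskOp_sub_of_logLik (hβ₀ : 0 < β) (hβ₁ : β < 1) (hs : 1 ≤ s) (hA : 1 ≤ A)
    (hlm : Measurable l) (hψ : Measurable ψ) (hw : Measurable w) (hv : Measurable v)
    (hQl : ∀ x, Qhat x = (Q x).withDensity fun y => eexp (l (x, y)))
    (hPψ : ∀ x, Qhat x = (P x).withDensity fun y => eexp (ψ (x, y)))
    (hPQ : P₀ ≪ Q₀)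
    (t₁ : ∀ (f : 𝒳 → ℝ) (c : ℝ), Measurable f → 0 < c →
      ExpBound K s c f Q₀ → ExpBound K s (A * c) f P₀)
    (t₂ : ∀ (h : 𝒳 × 𝒳 → ℝ) (c : ℝ), Measurable h → 0 < c →
      ExpBound K s c h (Q₀ ⊗ₘ Q) → ExpBound K s (A * c) h (P₀ ⊗ₘ P))
    (hΦP : ∫⁻ z, eexp (4 / (1 - β) * (|ψ z| + (|v z.2| + |w z|))) ∂(P₀ ⊗ₘ P) ≤ eexp K)
    (hΦQ : ∫⁻ z, eexp (4 / (1 - β) * (|v z.2| + |w z|)) ∂(Q₀ ⊗ₘ Q) ≤ eexp K)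
    (fv : riskOp β w Q v =ᵐ[Q₀] v)
    (hc : 0 < c) (hl : ExpBound K s c l (Q₀ ⊗ₘ Q)) :
    ExpBound K s (2 * A * c) (fun x => riskOp β w Qhat v x - v x) P₀ := by
  have hA0 : 0 < A := by linarith
  have hδ : 0 < 1 - β := by linarith
  have hk : 0 < 2 - β := by linarith
  have hρ0 := contractionRate_pos hβ₀ hβ₁
  have hρ1 := contractionRate_lt_one hβ₁
  have h4 : 0 ≤ 4 / (1 - β) := by positivity
  have hχ : Measurable fun z : 𝒳 × 𝒳 => v z.2 + w z := by fun_prop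
  have hψχ : Measurable fun z : 𝒳 × 𝒳 => ψ z + (v z.2 + w z) := by fun_prop
  have hQ1 : ∫⁻ z, eexp (4 / (1 - β) * |v z.2 + w z|) ∂(Q₀ ⊗ₘ Q) ≤ eexp K :=
    (lintegral_mono fun z => eexp_le_eexp
      (mul_le_mul_of_nonneg_left (abs_add_le _ _) h4)).trans hΦQ
  have hP1 : ∫⁻ z, eexp (4 / (1 - β) * |ψ z + (v z.2 + w z)|) ∂(P₀ ⊗ₘ P) ≤ eexp K :=
    (lintegral_mono fun z => eexp_le_eexp (mul_le_mul_of_nonneg_left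
      ((abs_add_le _ _).trans (add_le_add_right (abs_add_le _ _) _)) h4)).trans hΦP
  have hQ2 := ae_lintegral_two_mul_lt_top hβ₀ hβ₁ hχ (hQ1.trans_lt (eexp_ne_top K).lt_top)
  have hP2 := ae_lintegral_two_mul_lt_top hβ₀ hβ₁ hψχ (hP1.trans_lt (eexp_ne_top K).lt_top)
  obtain ⟨i1, b1⟩ := ExpBound.tilted hβ₀ hβ₁ hs hc hχ hlm hQ1 hl
  obtain ⟨i2, b2⟩ := ExpBound.tilted hβ₀ hβ₁ hs (by positivity) hψχ hlm hP1 (t₂ l c hlm hc hl)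
  have b1' := t₁ _ _ (measurable_integral_tilted hχ hlm) (by positivity) b1
  have b3 := (b1'.add hs (by positivity) (by positivity) (measurable_integral_tilted hχ hlm)
    b2).const_mul hβ₀
  refine (b3.mono_scale (d := 2 * A * c) hs (by positivity) ?_).mono_fun hs (by positivity) ?_
  · have : β * (A * ((2 - β) * c) + (2 - β) * (A * c)) = 2 * A * c * (β * (2 - β)) := by ring
    rw [this]
    exact mul_le_of_le_one_right (by positivity) hρ1.le
  filter_upwards [hPQ.ae_le hQ2, hP2, hPQ.ae_le i1, i2, hPQ.ae_le fv] with x hQ2 hP2 i1 i2 fv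
  have hlx : Measurable fun y => l (x, y) := hlm.comp measurable_prodMk_left
  have hψx : Measurable fun y => ψ (x, y) := hψ.comp measurable_prodMk_left
  have hχx : Measurable fun y => v y + w (x, y) := by fun_prop
  have eQ := integrable_exp_of_abs hχx.aemeasurable (lintegral_eexp_abs_lt_top_of_two_mul hQ2)
  have eP := integrable_exp_of_abs (f := fun y => ψ (x, y) + (v y + w (x, y)))
    (hψx.add hχx).aemeasurable (lintegral_eexp_abs_lt_top_of_two_mul hP2)
  have eQhat : Integrable (fun y => Real.exp (v y + w (x, y))) (Qhat x) := by
    rw [hPψ x, integrable_withDensity_eexp hψx]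
    simpa only [Real.exp_add] using eP
  -- Tilts compose, so a tilt of `Qhat x` is a tilt of the reference kernel, for which exponential
  -- moments are available.
  have et : (Qhat x).tilted (fun y => v y + w (x, y))
      = (P x).tilted fun y => ψ (x, y) + (v y + w (x, y)) := by
    rw [eq_tilted_of_withDensity hψx (hPψ x),
      tilted_tilted (integrable_exp_of_withDensity hψx (hPψ x)).1]
    rfl
  rw [← et] at i2
  have key := abs_log_integral_exp_sub_le hlx (hQl x) eQ eQhat i1 i2
  rw [et] at key
  conv_lhs => rw [← fv]
  rw [riskOp, riskOp, ← mul_sub, abs_mul, abs_mul]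
  exact mul_le_mul_of_nonneg_left (key.trans (le_abs_self _)) (abs_nonneg β)

/-- The constant in the perturbation bounds at a common exponential level. -/
noncomputable def perturbConst (β A : ℝ) : ℝ :=
  4 * A ^ 2 * (1 + 2 * A ^ 2) / (1 - β * (2 - β))

lemma perturbConst_pos (hβ₁ : β < 1) (hA : 1 ≤ A) : 0 < perturbConst β A := by
  have hρ2 : 0 < 1 - β * (2 - β) := sub_pos.2 (contractionRate_lt_one hβ₁)
  unfold perturbConst
  positivity

/-- Perturbation bounds relative to a reference model `(P, P₀)`. -/
theorem expBound_perturbation (hP : P.Invariant P₀)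
    (hβ₀ : 0 < β) (hβ₁ : β < 1) (hs : 1 ≤ s) (hK : 0 ≤ K) (hA : 1 ≤ A)
    (hlm : Measurable l) (hψ : Measurable ψ) (hw : Measurable w) (hv : Measurable v)
    (hvhat : Measurable vhat)
    (hQl : ∀ x, Qhat x = (Q x).withDensity fun y => eexp (l (x, y)))
    (hPψ : ∀ x, Qhat x = (P x).withDensity fun y => eexp (ψ (x, y)))
    (hPQ : P₀ ≪ Q₀)
    (t₀ : ∀ (f : 𝒳 → ℝ) (c : ℝ), Measurable f → 0 < c →
      ExpBound K s c f P₀ → ExpBound K s (A * c) f Q₀)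
    (t₁ : ∀ (f : 𝒳 → ℝ) (c : ℝ), Measurable f → 0 < c →
      ExpBound K s c f Q₀ → ExpBound K s (A * c) f P₀)
    (t₂ : ∀ (h : 𝒳 × 𝒳 → ℝ) (c : ℝ), Measurable h → 0 < c →
      ExpBound K s c h (Q₀ ⊗ₘ Q) → ExpBound K s (A * c) h (P₀ ⊗ₘ P))
    (hΦP : ∫⁻ z, eexp (4 / (1 - β) * (|vhat z.2| + |v z.2| + (|w z| + |ψ z|))) ∂(P₀ ⊗ₘ P)
      ≤ eexp K)
    (hΦQ : ∫⁻ z, eexp (4 / (1 - β) * (|v z.2| + |w z|)) ∂(Q₀ ⊗ₘ Q) ≤ eexp K)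
    (hl : ∃ d, 0 < d ∧ ExpBound K s d l (Q₀ ⊗ₘ Q))
    (fv : riskOp β w Q v =ᵐ[Q₀] v) (fvhat : riskOp β w Qhat vhat =ᵐ[Q₀] vhat)
    (hd : ∃ d, 0 < d ∧ ExpBound K s d (fun x => vhat x - v x) P₀) :
    (∀ c, 0 < c → ExpBound K s c (fun z => l z - ∫ y, l (z.1, y) ∂(Q z.1)) (Q₀ ⊗ₘ Q) →
      ExpBound K s (perturbConst β A * c) (fun x => vhat x - v x) Q₀) ∧
    (∀ c, 0 < c → ExpBound K s c (fun x => vhat x - v x) Q₀ →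
      ExpBound K s (perturbConst β A * c) (fun x => riskOp β w Qhat v x - v x) Q₀) ∧
    (∀ c, 0 < c → ExpBound K s c (fun x => riskOp β w Qhat v x - v x) Q₀ →
      ExpBound K s (perturbConst β A * c) (fun x => vhat x - v x) Q₀) := by
  have hδ : 0 < 1 - β := by linarith
  have hA0 : 0 < A := by linarith
  have hρ0 := contractionRate_pos hβ₀ hβ₁
  have hρ2 : 0 < 1 - β * (2 - β) := sub_pos.2 (contractionRate_lt_one hβ₁)
  have h4 : 0 ≤ 4 / (1 - β) := by positivity
  have hwψ : Measurable fun z => w z + ψ z := hw.add hψ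
  have hTm : Measurable (riskOp β w Qhat v) := measurable_riskOp hw hv
  have hdm : Measurable fun x => vhat x - v x := hvhat.sub hv
  have hΦ1 : ∫⁻ z, eexp (4 / (1 - β) * (|vhat z.2| + |v z.2| + |w z + ψ z|)) ∂(P₀ ⊗ₘ P)
      ≤ eexp K := (lintegral_mono fun z => eexp_le_eexp (mul_le_mul_of_nonneg_left
        (add_le_add_right (abs_add_le _ _) _) h4)).trans hΦP
  have hΦ2 : ∫⁻ z, eexp (4 / (1 - β) * |ψ z|) ∂(P₀ ⊗ₘ P) ≤ eexp K :=
    (lintegral_mono fun z => eexp_le_eexp (mul_le_mul_of_nonneg_left (by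
      linarith [abs_nonneg (vhat z.2), abs_nonneg (v z.2), abs_nonneg (w z)]) h4)).trans hΦP
  have hΦ3 : ∫⁻ z, eexp (4 / (1 - β) * (|ψ z| + (|v z.2| + |w z|))) ∂(P₀ ⊗ₘ P) ≤ eexp K :=
    (lintegral_mono fun z => eexp_le_eexp (mul_le_mul_of_nonneg_left (by
      linarith [abs_nonneg (vhat z.2)]) h4)).trans hΦP
  have fvhat' : riskOp β (fun z => w z + ψ z) P vhat =ᵐ[P₀] vhat := by
    rw [← riskOp_eq_of_withDensity hψ hPψ]
    exact hPQ.ae_le fvhat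
  have main : ∀ c, 0 < c → ExpBound K s c (fun x => riskOp β w Qhat v x - v x) P₀ →
      ExpBound K s (A * (2 / (1 - β * (2 - β)) * c)) (fun x => vhat x - v x) Q₀ := by
    intro c hc h
    rw [riskOp_eq_of_withDensity hψ hPψ] at h
    exact t₀ _ _ hdm (by positivity) (expBound_fixedPoint_sub_le hP hβ₀ hβ₁ hs hwψ hv hvhat hΦ1
      fvhat' hd hc h)
  have hA2 : 1 ≤ A ^ 2 := one_le_pow₀ hA
  refine ⟨fun c hc h => ?_, fun c hc h => ?_, fun c hc h => ?_⟩
  -- The constant is a product: `1 + 2A²` from score to `l`, `2A` from `l` to the defect, `2/(1 -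
  -- β(2-β))` from the defect to `v̂ - v`, and `A` for the return to `Q₀`.
  · have h1 := expBound_of_score hβ₀ hβ₁ hs hK hA hlm hψ hQl hPψ hPQ t₀ t₂ hΦ2 hl hc h
    have h2 := expBound_riskOp_sub_of_logLik hβ₀ hβ₁ hs hA hlm hψ hw hv hQl hPψ hPQ t₁ t₂ hΦ3 hΦQ
      fv (by positivity) h1
    have h3 := main _ (by positivity) h2
    convert h3 using 1
    unfold perturbConst
    field_simp
    ring
  · have h1 := expBound_riskOp_sub_self_le hP hβ₀ hβ₁ hs hwψ hv hvhat hΦ1 fvhat' (by positivity)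
      (t₁ _ _ hdm hc h)
    rw [← riskOp_eq_of_withDensity hψ hPψ] at h1
    refine (t₀ _ _ (hTm.sub hv) (by positivity) h1).mono_scale hs (by positivity) ?_
    have : 2 * A ^ 2 ≤ perturbConst β A := by
      rw [perturbConst, le_div_iff₀ hρ2]
      nlinarith
    calc A * (2 * (A * c)) = 2 * A ^ 2 * c := by ring
      _ ≤ _ := by gcongr
  · refine (main _ (by positivity) (t₁ _ _ (hTm.sub hv) hc h)).mono_scale hs (by positivity) ?_
    have : A * (2 / (1 - β * (2 - β))) * A ≤ perturbConst β A := by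
      have e : A * (2 / (1 - β * (2 - β))) * A = 2 * A ^ 2 / (1 - β * (2 - β)) := by ring
      rw [perturbConst, e]
      gcongr
      · linarith
      · linarith
    calc A * (2 / (1 - β * (2 - β)) * (A * c)) = A * (2 / (1 - β * (2 - β))) * A * c := by ring
      _ ≤ _ := by gcongr

end Comparison

/-! ### Luxemburg norms and Orlicz hearts in terms of the gauge. -/

section Orlicz

variable {Ω : Type*} [MeasurableSpace Ω] {μ : Measure Ω} {f g : Ω → ℝ} {r s c : ℝ}

lemma orliczNorm_congr (h : f =ᵐ[μ] g) : orliczNorm s f μ = orliczNorm s g μ := by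
  have : ∀ c, orliczModular s f μ c = orliczModular s g μ c := fun c => by
    refine lintegral_congr_ae ?_
    filter_upwards [h] with ω hω
    rw [hω]
  simp only [orliczNorm, this]

lemma orliczNorm_le (hc : 0 < c) (h : orliczModular s f μ c ≤ 1) :
    orliczNorm s f μ ≤ ENNReal.ofReal c :=
  iInf₂_le c ⟨hc, h⟩

variable [IsProbabilityMeasure μ]

lemma orliczModular_add_one (hc : 0 < c) :
    orliczModular s f μ c + 1 = ∫⁻ ω, eexp ((|f ω| / c) ^ s) ∂μ := by
  have : (1 : ℝ≥0∞) = ∫⁻ _, 1 ∂μ := by simp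
  rw [orliczModular, this, ← lintegral_add_right _ measurable_const]
  refine lintegral_congr fun ω => ?_
  have h : 0 ≤ (|f ω| / c) ^ s := by positivity
  rw [eexp, ← ENNReal.ofReal_one, ← ENNReal.ofReal_add (by linarith [Real.one_le_exp h]) one_pos.le,
    sub_add_cancel]

/-- Adding the total mass `1` turns the Luxemburg condition into the gauge at level `log 2`. -/
lemma orliczModular_le_one_iff (hc : 0 < c) :
    orliczModular s f μ c ≤ 1 ↔ ExpBound (Real.log 2) s c f μ := by
  have e : eexp (Real.log 2) = 1 + 1 := by
    rw [eexp, Real.exp_log two_pos, one_add_one_eq_two]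
    simp
  rw [ExpBound, ← orliczModular_add_one hc, e]
  exact (ENNReal.add_le_add_iff_right ENNReal.one_ne_top).symm

/-- Comparison of Luxemburg norms from comparison at one exponential level. -/
lemma orliczNorm_le_of_expBound {Ω' : Type*} [MeasurableSpace Ω'] {ν : Measure Ω'}
    [IsProbabilityMeasure ν] {h : Ω' → ℝ} {A K : ℝ} (hs : 1 ≤ s) (hA : 0 < A)
    (hK : Real.log 2 ≤ K) (hf : AEMeasurable f μ)
    (hb : ∀ c, 0 < c → ExpBound K s c h ν → ExpBound K s (A * c) f μ) :
    orliczNorm s f μ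
      ≤ ENNReal.ofReal (A * max 1 (K / Real.log 2)) * orliczNorm s h ν := by
  have hlog : 0 < Real.log 2 := Real.log_pos one_lt_two
  set B := max 1 (K / Real.log 2)
  have hB : 1 ≤ B := le_max_left _ _
  have hAB : 0 < A * B := by positivity
  have h0 : ENNReal.ofReal (A * B) ≠ 0 := (ENNReal.ofReal_pos.2 hAB).ne'
  rw [← ENNReal.div_le_iff' h0 ENNReal.ofReal_ne_top]
  refine le_iInf₂ fun c hc => ?_
  rw [ENNReal.div_le_iff' h0 ENNReal.ofReal_ne_top,
    ← ENNReal.ofReal_mul hAB.le]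
  have hc0 := hc.1
  -- Raising the level from `log 2` to `K` is free; lowering it again costs the factor `B`.
  have h1 := hb c hc0 (((orliczModular_le_one_iff hc0).1 hc.2).mono_level hK)
  have h2 := h1.scale (K := Real.log 2) hs (by positivity) hB (by
    have : K / Real.log 2 ≤ B := le_max_right _ _
    rwa [div_le_iff₀' hlog] at this) hf
  have e : B * (A * c) = A * B * c := by ring
  rw [e] at h2
  exact orliczNorm_le (by positivity) ((orliczModular_le_one_iff (by positivity)).2 h2)

lemma MemOrlicz.exists_expBound (h : MemOrlicz s f μ) :
    ∃ d, 0 < d ∧ ExpBound (Real.log 2) s d f μ := by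
  have := h.2
  simp only [orliczNorm, iInf_lt_iff] at this
  obtain ⟨c, hc, -⟩ := this
  exact ⟨c, hc.1, (orliczModular_le_one_iff hc.1).1 hc.2⟩

lemma MemOrliczHeart.lintegral_lt_top (hs : 1 ≤ s) (h : MemOrliczHeart s f μ) (l : ℝ) :
    ∫⁻ ω, eexp (l * |f ω| ^ s) ∂μ < ∞ := by
  have hs0 : 0 < s := by linarith
  -- The maximum makes the root in the scale `m^(-1/s)` positive, for any real `l`.
  set m := max l 1
  have hm : 0 < m := lt_of_lt_of_le one_pos (le_max_right _ _)
  set c := (m ^ (1 / s))⁻¹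
  have hc : 0 < c := by positivity
  have := ENNReal.add_lt_top.2 ⟨h.2 c hc, ENNReal.one_lt_top⟩
  rw [orliczModular_add_one hc] at this
  refine (lintegral_mono fun ω => eexp_le_eexp ?_).trans_lt this
  have e : (|f ω| / c) ^ s = m * |f ω| ^ s := by
    rw [div_inv_eq_mul, Real.mul_rpow (abs_nonneg _) (by positivity), ← Real.rpow_mul hm.le,
      one_div_mul_cancel hs0.ne', Real.rpow_one, mul_comm]
  rw [e]
  gcongr
  exact le_max_left _ _

lemma memOrliczHeart_of_lintegral (hs : 1 ≤ s) (hf : AEMeasurable f μ)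
    (h : ∀ l : ℝ, 0 < l → ∫⁻ ω, eexp (l * |f ω| ^ s) ∂μ < ∞) : MemOrliczHeart s f μ := by
  have hmod : ∀ c : ℝ, 0 < c → orliczModular s f μ c < ∞ := fun c hc => by
    have : orliczModular s f μ c + 1 < ∞ := by
      rw [orliczModular_add_one hc]
      refine lt_of_eq_of_lt (lintegral_congr fun ω => ?_) (h ((1 / c) ^ s) (by positivity))
      rw [← Real.mul_rpow (by positivity) (abs_nonneg _)]
      congr 2
      ring
    exact (ENNReal.add_lt_top.1 this).1
  refine ⟨⟨hf, ?_⟩, hmod⟩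
  obtain ⟨d, hd, hb⟩ := RobustValue.exists_expBound (K := Real.log 2) hs (Real.log_pos one_lt_two) hf
    (by simpa using h 1 one_pos)
  exact (orliczNorm_le hd ((orliczModular_le_one_iff hd).2 hb)).trans_lt ENNReal.ofReal_lt_top

end Orlicz

/-! ### Stability of exponential moments under sums, scaling and lower orders. -/

section Moments

variable {Ω : Type*} [MeasurableSpace Ω] {μ : Measure Ω} {f g : Ω → ℝ} {r s l : ℝ}

lemma eexp_abs_add_rpow_le {x y : ℝ} (hr : 0 ≤ r) (hl : 0 ≤ l) :
    eexp (l * |x + y| ^ r) ≤ eexp (l * 2 ^ r * |x| ^ r) + eexp (l * 2 ^ r * |y| ^ r) := by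
  have key : ∀ a b : ℝ, |a| ≤ |b| → l * |a + b| ^ r ≤ l * 2 ^ r * |b| ^ r := fun a b h => by
    rw [mul_assoc, ← Real.mul_rpow two_pos.le (abs_nonneg _)]
    gcongr
    linarith [abs_add_le a b]
  rcases le_total |x| |y| with h | h
  · exact (eexp_le_eexp (key x y h)).trans le_add_self
  · rw [add_comm x]
    exact (eexp_le_eexp (key y x h)).trans le_self_add

lemma lintegral_eexp_abs_add_lt_top (hr : 0 ≤ r) (hl : 0 < l) (hf : Measurable f)
    (h1 : ∀ l : ℝ, 0 < l → ∫⁻ ω, eexp (l * |f ω| ^ r) ∂μ < ∞)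
    (h2 : ∀ l : ℝ, 0 < l → ∫⁻ ω, eexp (l * |g ω| ^ r) ∂μ < ∞) :
    ∫⁻ ω, eexp (l * |f ω + g ω| ^ r) ∂μ < ∞ := by
  refine (lintegral_mono fun ω => eexp_abs_add_rpow_le hr hl.le).trans_lt ?_
  rw [lintegral_add_left (by fun_prop)]
  exact ENNReal.add_lt_top.2 ⟨h1 _ (by positivity), h2 _ (by positivity)⟩

lemma lintegral_eexp_rpow_lt_top_of_le (hs : 0 ≤ s) (hsr : s ≤ r)
    (h : ∫⁻ ω, eexp (|f ω| ^ r) ∂μ < ∞) : ∫⁻ ω, eexp (|f ω| ^ s) ∂μ < ∞ := by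
  calc ∫⁻ ω, eexp (|f ω| ^ s) ∂μ ≤ ∫⁻ ω, eexp 1 * eexp (|f ω| ^ r) ∂μ := by
        refine lintegral_mono fun ω => ?_
        rw [← eexp_add]
        refine eexp_le_eexp ?_
        have hr0 := Real.rpow_nonneg (abs_nonneg (f ω)) r
        rcases le_total |f ω| 1 with h | h
        · linarith [Real.rpow_le_one (abs_nonneg (f ω)) h hs]
        · linarith [Real.rpow_le_rpow_of_exponent_le h hsr]
    _ = eexp 1 * ∫⁻ ω, eexp (|f ω| ^ r) ∂μ := lintegral_const_mul' _ _ (eexp_ne_top _)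
    _ < ∞ := ENNReal.mul_lt_top (eexp_ne_top _).lt_top h

lemma lintegral_eexp_div_lt_top {a l : ℝ} (hl : 0 < l) (ha : 0 < a)
    (h : ∀ l : ℝ, 0 < l → ∫⁻ ω, eexp (l * |f ω| ^ r) ∂μ < ∞) :
    ∫⁻ ω, eexp (l * (|f ω| / a) ^ r) ∂μ < ∞ := by
  refine lt_of_eq_of_lt (lintegral_congr fun ω => ?_) (h (l * (1 / a) ^ r) (by positivity))
  rw [mul_assoc, ← Real.mul_rpow (by positivity) (abs_nonneg _)]
  congr 3
  ring

lemma lintegral_eexp_lt_top_of_div {a l : ℝ} (hl : 0 < l) (ha : 0 < a)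
    (h : ∀ l : ℝ, 0 < l → ∫⁻ ω, eexp (l * (|f ω| / a) ^ r) ∂μ < ∞) :
    ∫⁻ ω, eexp (l * |f ω| ^ r) ∂μ < ∞ := by
  refine lt_of_eq_of_lt (lintegral_congr fun ω => ?_) (h (l * a ^ r) (by positivity))
  rw [mul_assoc, ← Real.mul_rpow (by positivity) (by positivity)]
  congr 3
  field_simp

lemma lintegral_eexp_mul_abs_lt_top {a : ℝ} (ha : 0 ≤ a) (hs : 1 < s)
    (h : ∫⁻ ω, eexp (|f ω| ^ s) ∂μ < ∞) : ∫⁻ ω, eexp (a * |f ω|) ∂μ < ∞ := by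
  refine (lintegral_eexp_mul_abs_le ha one_pos one_pos hs).trans_lt
    (ENNReal.mul_lt_top (eexp_ne_top _).lt_top ?_)
  simpa using h

end Moments

/-! ### Null-set independence, and value functions from a reference model. -/

section ValueFunction

variable {𝒳 : Type*} [MeasurableSpace 𝒳]

lemma valueOp_eq_riskOp (α β : ℝ) (u : 𝒳 × 𝒳 → ℝ) (Q : Kernel 𝒳 𝒳) :
    valueOp α β u Q = riskOp β (fun z => α * u z) Q := rfl

/-- By stationarity a `Q₀`-null set is `Q x`-null for almost every `x`, and absolute continuity
carries this to `Qhat x`. This allows measurable representatives of `u` and of the fixed points. -/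
lemma valueOp_congr {α β : ℝ} {u u' : 𝒳 × 𝒳 → ℝ} {f f' : 𝒳 → ℝ} {Q Qhat : Kernel 𝒳 𝒳}
    [IsMarkovKernel Q] {Q₀ : Measure 𝒳} [IsProbabilityMeasure Q₀] (hQ : Q.Invariant Q₀)
    (hac : ∀ x, Qhat x ≪ Q x) (hu : u =ᵐ[Q₀ ⊗ₘ Q] u') (hf : f =ᵐ[Q₀] f') :
    valueOp α β u Qhat f =ᵐ[Q₀] valueOp α β u' Qhat f' := by
  have h1 := Measure.ae_ae_of_ae_compProd hu
  have h2 : ∀ᵐ x ∂Q₀, ∀ᵐ y ∂(Q x), f y = f' y := by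
    have : ∀ᵐ y ∂(Q ∘ₘ Q₀), f y = f' y := by
      rw [hQ.def]
      exact hf
    exact Measure.ae_ae_of_ae_comp this
  filter_upwards [h1, h2] with x hx1 hx2
  unfold valueOp
  congr 2
  refine integral_congr_ae ?_
  filter_upwards [(hac x).ae_le hx1, (hac x).ae_le hx2] with y hy1 hy2
  rw [hy1, hy2]

/-- A fixed point in a reference model is the value function. -/
lemma isValueFunction_of_reference {α β r : ℝ} {u u' ψ : 𝒳 × 𝒳 → ℝ} {Q P Qhat : Kernel 𝒳 𝒳}
    [IsMarkovKernel Q] [IsMarkovKernel P] {Q₀ P₀ : Measure 𝒳}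
    [IsProbabilityMeasure Q₀] [IsProbabilityMeasure P₀] {v : 𝒳 → ℝ}
    (hβ₀ : 0 < β) (hβ₁ : β < 1) (hr : 1 < r) (hQ : Q.Invariant Q₀) (hP : P.Invariant P₀)
    (hac : ∀ x, Qhat x ≪ Q x) (hQP : Q₀ ≪ P₀) (hPQ : P₀ ≪ Q₀)
    (hu' : Measurable u') (hψ : Measurable ψ) (huu : u =ᵐ[Q₀ ⊗ₘ Q] u')
    (hPψ : ∀ x, Qhat x = (P x).withDensity fun y => eexp (ψ (x, y)))
    (hW : ∀ l : ℝ, 0 < l →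
      ∫⁻ z, eexp (l * (|α * u' z + ψ z| / (1 - β)) ^ r) ∂(P₀ ⊗ₘ P) < ∞)
    (t : ∀ (g : 𝒳 → ℝ) (s : ℝ), Measurable g →
      (∀ l : ℝ, 0 < l → ∫⁻ x, eexp (l * |g x| ^ s) ∂Q₀ < ∞) → ∫⁻ x, eexp (|g x| ^ s) ∂P₀ < ∞)
    (hv : Measurable v) (fv : riskOp β (fun z => α * u' z + ψ z) P v =ᵐ[P₀] v)
    (mP : ∫⁻ x, eexp (|v x| ^ r) ∂P₀ < ∞)
    (mQ : ∀ l : ℝ, 0 < l → ∫⁻ x, eexp (l * |v x| ^ r) ∂Q₀ < ∞) :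
    IsValueFunction α β r u Qhat Q₀ v := by
  have hδ : 0 < 1 - β := by linarith
  have eT : ∀ f : 𝒳 → ℝ, valueOp α β u' Qhat f = riskOp β (fun z => α * u' z + ψ z) P f :=
    fun f => by rw [valueOp_eq_riskOp, riskOp_eq_of_withDensity hψ hPψ]
  have hw : Measurable fun z => α * u' z + ψ z := by fun_prop
  refine ⟨memOrliczHeart_of_lintegral hr.le hv.aemeasurable mQ, ?_, ?_⟩
  · refine (valueOp_congr hQ hac huu (ae_eq_refl v)).trans ?_
    rw [eT]
    exact hQP.ae_le fv
  intro s hs _ g hg fg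
  obtain ⟨g', hg', hgg⟩ := hg.1.1
  have mg : ∀ l : ℝ, 0 < l → ∫⁻ x, eexp (l * |g' x| ^ s) ∂Q₀ < ∞ := fun l _ => by
    refine lt_of_eq_of_lt (lintegral_congr_ae ?_) (hg.lintegral_lt_top hs.le l)
    filter_upwards [hgg] with x hx
    rw [hx]
  have fg' : riskOp β (fun z => α * u' z + ψ z) P g' =ᵐ[P₀] g' := by
    rw [← eT]
    exact hPQ.ae_le (((valueOp_congr hQ hac huu hgg).symm.trans fg).trans hgg)
  have h4 : 0 ≤ 4 / (1 - β) := by positivity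
  have hΦ : ∫⁻ z, eexp (4 / (1 - β) * (|g' z.2| + |v z.2| + |α * u' z + ψ z|)) ∂(P₀ ⊗ₘ P)
      < ∞ := by
    refine (lintegral_mono fun z => eexp_add_three_le h4 (abs_nonneg _) (abs_nonneg _)
      (abs_nonneg _)).trans_lt ?_
    rw [lintegral_add_left (by fun_prop), lintegral_add_left (by fun_prop),
      lintegral_compProd_snd hP (F := fun x => eexp (3 * (4 / (1 - β)) * |g' x|)) (by fun_prop),
      lintegral_compProd_snd hP (F := fun x => eexp (3 * (4 / (1 - β)) * |v x|)) (by fun_prop)]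
    refine ENNReal.add_lt_top.2 ⟨ENNReal.add_lt_top.2 ⟨?_, ?_⟩, ?_⟩
    · exact lintegral_eexp_mul_abs_lt_top (by positivity) hs (t g' s hg' mg)
    · exact lintegral_eexp_mul_abs_lt_top (by positivity) hr mP
    · exact (lintegral_eexp_mul_abs_le (by positivity) hδ one_pos hr).trans_lt
        (ENNReal.mul_lt_top (eexp_ne_top _).lt_top (hW 1 one_pos))
  exact hgg.trans (hQP.ae_le (riskOp_fixedPoint_unique hP hβ₀ hβ₁ hw hg' hv hΦ fg' fv))

end ValueFunction

/-! ### The log-likelihood ratio as an everywhere finite log-density. -/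

section LogLik

variable {𝒳 : Type*} [MeasurableSpace 𝒳] [MeasurableSpace.CountablyGenerated 𝒳]
  {Q Qhat : Kernel 𝒳 𝒳}

lemma measurable_logLik : Measurable (logLik Q Qhat) :=
  Real.measurable_log.comp (Kernel.measurable_rnDeriv Qhat Q).ennreal_toReal

/-- Mutual absolute continuity makes the derivative positive and finite `Q x`-almost everywhere, so
the default values of `Real.log` and `toReal` are harmless. -/
lemma eq_withDensity_logLik [IsMarkovKernel Q] [IsMarkovKernel Qhat]
    (h : EverywhereMutuallyAC Q Qhat) (x : 𝒳) :
    Qhat x = (Q x).withDensity fun y => eexp (logLik Q Qhat (x, y)) := by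
  have h1 : Qhat x = (Q x).withDensity (Kernel.rnDeriv Qhat Q x) := by
    rw [← Kernel.withDensity_apply _ (Kernel.measurable_rnDeriv Qhat Q)]
    exact (Kernel.withDensity_rnDeriv_eq (h x).2).symm
  have h2 : Kernel.rnDeriv Qhat Q x =ᵐ[Q x] (Qhat x).rnDeriv (Q x) :=
    Kernel.rnDeriv_eq_rnDeriv_measure
  nth_rewrite 1 [h1]
  refine withDensity_congr_ae ?_
  filter_upwards [h2, (h x).1.ae_le (Measure.rnDeriv_pos (h x).2),
    Measure.rnDeriv_lt_top (Qhat x) (Q x)] with y e pos fin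
  rw [← e] at pos fin
  rw [logLik, eexp, Real.exp_log (ENNReal.toReal_pos pos.ne' fin.ne), ENNReal.ofReal_toReal fin.ne]

end LogLik

/-! ### Existence of value functions and passage to the Luxemburg inequalities. -/

section Final

variable {𝒳 : Type*} [MeasurableSpace 𝒳]

lemma withDensity_eexp_zero (μ : Measure 𝒳) : (μ.withDensity fun _ => eexp 0) = μ := by
  simp only [eexp_zero]
  exact withDensity_one

/-- Existence of the value function of a model whose kernel has a density relative to `Q`. -/
lemma exists_isValueFunction {α β r : ℝ} {u u' ψ : 𝒳 × 𝒳 → ℝ} {Q Qhat : Kernel 𝒳 𝒳}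
    [IsMarkovKernel Q] {Q₀ : Measure 𝒳} [IsProbabilityMeasure Q₀]
    (hβ₀ : 0 < β) (hβ₁ : β < 1) (hr : 1 < r) (hQ : Q.Invariant Q₀)
    (hac : ∀ x, Qhat x ≪ Q x) (hu' : Measurable u') (hψ : Measurable ψ) (huu : u =ᵐ[Q₀ ⊗ₘ Q] u')
    (hQψ : ∀ x, Qhat x = (Q x).withDensity fun y => eexp (ψ (x, y)))
    (hW : ∀ l : ℝ, 0 < l →
      ∫⁻ z, eexp (l * (|α * u' z + ψ z| / (1 - β)) ^ r) ∂(Q₀ ⊗ₘ Q) < ∞) :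
    ∃ v : 𝒳 → ℝ, Measurable v ∧ IsValueFunction α β r u Qhat Q₀ v ∧
      valueOp α β u' Qhat v =ᵐ[Q₀] v ∧
      (∀ l : ℝ, 0 < l → ∫⁻ x, eexp (l * |v x| ^ r) ∂Q₀ < ∞) ∧
      ∀ l : ℝ, 0 < l → ∫⁻ x, eexp (l * (|v x| / β) ^ r) ∂Q₀
        ≤ momentBound β l r
          (∫⁻ z, eexp (l * (|α * u' z + ψ z| / (1 - β)) ^ r) ∂(Q₀ ⊗ₘ Q)) := by
  have hw : Measurable fun z => α * u' z + ψ z := by fun_prop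
  obtain ⟨v, hv, fv, mv⟩ := exists_riskOp_fixedPoint hQ hβ₀ hβ₁ hr hw hW
  have mv' : ∀ l : ℝ, 0 < l → ∫⁻ x, eexp (l * |v x| ^ r) ∂Q₀ < ∞ := fun l hl =>
    lintegral_eexp_lt_top_of_div hl hβ₀ fun l hl =>
      (mv l hl).trans_lt (momentBound_lt_top hβ₁ (hW l hl))
  refine ⟨v, hv, ?_, ?_, mv', mv⟩
  · exact isValueFunction_of_reference hβ₀ hβ₁ hr hQ hQ hac .rfl .rfl hu' hψ huu hQψ hW
      (fun g s _ h => by simpa using h 1 one_pos) hv fv (by simpa using mv' 1 one_pos) mv'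
  · rw [valueOp_eq_riskOp, riskOp_eq_of_withDensity hψ hQψ]
    exact fv

lemma lintegral_eexp_four_le {a : ℝ} {f g : 𝒳 → ℝ} {w₁ w₂ : 𝒳 × 𝒳 → ℝ} {P : Kernel 𝒳 𝒳}
    [IsMarkovKernel P] {P₀ : Measure 𝒳} [IsProbabilityMeasure P₀] (hP : P.Invariant P₀)
    (hf : Measurable f) (hg : Measurable g) (hw₁ : Measurable w₁) :
    ∫⁻ z, eexp (a * (|f z.2| + |g z.2| + (|w₁ z| + |w₂ z|))) ∂(P₀ ⊗ₘ P)
      ≤ (∫⁻ x, eexp (4 * a * |f x|) ∂P₀ + ∫⁻ x, eexp (4 * a * |g x|) ∂P₀)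
        + (∫⁻ z, eexp (4 * a * |w₁ z|) ∂(P₀ ⊗ₘ P) + ∫⁻ z, eexp (4 * a * |w₂ z|) ∂(P₀ ⊗ₘ P)) := by
  have key : ∀ x y : ℝ, eexp (2 * (a * (x + y))) ≤ eexp (4 * a * x) + eexp (4 * a * y) :=
    fun x y => by
      have := eexp_add_le (2 * (a * x)) (2 * (a * y))
      convert this using 2 <;> ring_nf
  calc _ ≤ ∫⁻ z, (eexp (4 * a * |f z.2|) + eexp (4 * a * |g z.2|))
        + (eexp (4 * a * |w₁ z|) + eexp (4 * a * |w₂ z|)) ∂(P₀ ⊗ₘ P) := by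
        refine lintegral_mono fun z => ?_
        rw [mul_add a (|f z.2| + |g z.2|)]
        exact (eexp_add_le _ _).trans (add_le_add (key _ _) (key _ _))
    _ = _ := by
        rw [lintegral_add_left (by fun_prop), lintegral_add_left (by fun_prop),
          lintegral_add_left (by fun_prop),
          lintegral_compProd_snd hP (F := fun x => eexp (4 * a * |f x|)) (by fun_prop),
          lintegral_compProd_snd hP (F := fun x => eexp (4 * a * |g x|)) (by fun_prop)]

lemma exists_expBound_sub {μ : Measure 𝒳} [IsProbabilityMeasure μ] {K s r : ℝ} {f g : 𝒳 → ℝ}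
    (hK : 0 < K) (hs : 1 ≤ s) (hsr : s ≤ r) (hf : Measurable f) (hg : Measurable g)
    (h1 : ∀ l : ℝ, 0 < l → ∫⁻ ω, eexp (l * |f ω| ^ r) ∂μ < ∞)
    (h2 : ∀ l : ℝ, 0 < l → ∫⁻ ω, eexp (l * |g ω| ^ r) ∂μ < ∞) :
    ∃ d, 0 < d ∧ ExpBound K s d (fun x => f x - g x) μ := by
  refine exists_expBound hs hK (hf.sub hg).aemeasurable
    (lintegral_eexp_rpow_lt_top_of_le (r := r) (by linarith) hsr ?_)
  have := lintegral_eexp_abs_add_lt_top (g := fun x => -g x) (r := r) (by linarith) one_pos hf h1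
    (by simpa using h2)
  simpa [sub_eq_add_neg] using this

lemma lintegral_eexp_const_mul_lt_top {Ω : Type*} [MeasurableSpace Ω] {μ : Measure Ω} {f : Ω → ℝ}
    {r : ℝ} (a : ℝ) (h : ∀ l : ℝ, ∫⁻ ω, eexp (l * |f ω| ^ r) ∂μ < ∞) (l : ℝ) :
    ∫⁻ ω, eexp (l * |a * f ω| ^ r) ∂μ < ∞ := by
  refine lt_of_eq_of_lt (lintegral_congr fun ω => ?_) (h (l * |a| ^ r))
  rw [abs_mul, Real.mul_rpow (abs_nonneg _) (abs_nonneg _), mul_assoc]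

lemma perturbationBounds_of_expBound [MeasurableSpace.CountablyGenerated 𝒳] {α β s B K : ℝ}
    {u u' : 𝒳 × 𝒳 → ℝ} {Q Qhat : Kernel 𝒳 𝒳} [IsMarkovKernel Q] [IsMarkovKernel Qhat]
    {Q₀ : Measure 𝒳} [IsProbabilityMeasure Q₀] {v vhat : 𝒳 → ℝ} (hs : 1 ≤ s) (hB : 0 < B)
    (hK : Real.log 2 ≤ K) (hQ : Q.Invariant Q₀) (hac : ∀ x, Qhat x ≪ Q x) (hu' : Measurable u')
    (huu : u =ᵐ[Q₀ ⊗ₘ Q] u') (hv : Measurable v) (hvhat : Measurable vhat)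
    (h : (∀ c, 0 < c → ExpBound K s c (score Q Qhat) (Q₀ ⊗ₘ Q) →
        ExpBound K s (B * c) (fun x => vhat x - v x) Q₀) ∧
      (∀ c, 0 < c → ExpBound K s c (fun x => vhat x - v x) Q₀ →
        ExpBound K s (B * c) (fun x => valueOp α β u' Qhat v x - v x) Q₀) ∧
      (∀ c, 0 < c → ExpBound K s c (fun x => valueOp α β u' Qhat v x - v x) Q₀ →
        ExpBound K s (B * c) (fun x => vhat x - v x) Q₀)) :
    PerturbationBounds α β s (B * max 1 (K / Real.log 2)) u Q Qhat Q₀ v vhat := by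
  obtain ⟨h1, h2, h3⟩ := h
  have hd : AEMeasurable (fun x => vhat x - v x) Q₀ := (hvhat.sub hv).aemeasurable
  have hT : Measurable (valueOp α β u' Qhat v) := by
    rw [valueOp_eq_riskOp]
    exact measurable_riskOp (by fun_prop) hv
  have e : orliczNorm s (fun x => valueOp α β u Qhat v x - v x) Q₀
      = orliczNorm s (fun x => valueOp α β u' Qhat v x - v x) Q₀ := by
    refine orliczNorm_congr ?_
    filter_upwards [valueOp_congr (α := α) (β := β) hQ hac huu (ae_eq_refl v)] with x hx
    rw [hx]
  have hC : 0 < B * max 1 (K / Real.log 2) := by positivity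
  refine ⟨orliczNorm_le_of_expBound hs hB hK hd h1, ?_, ?_⟩
  · rw [e, mul_comm, ← div_eq_mul_inv,
      ENNReal.div_le_iff' (ENNReal.ofReal_pos.2 hC).ne' ENNReal.ofReal_ne_top]
    exact orliczNorm_le_of_expBound hs hB hK (hT.sub hv).aemeasurable h2
  · rw [e]
    exact orliczNorm_le_of_expBound hs hB hK hd h3

lemma expMoment_one_eq {Ω : Type*} [MeasurableSpace Ω] {μ : Measure Ω} {f g : Ω → ℝ} {r b : ℝ}
    (hb : 0 < b) (h : ∀ᵐ ω ∂μ, f ω = g ω / b) :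
    expMoment 1 r f μ = ∫⁻ ω, eexp (1 * (|g ω| / b) ^ r) ∂μ := by
  refine lintegral_congr_ae ?_
  filter_upwards [h] with ω hω
  rw [hω, abs_div, abs_of_pos hb]
  rfl

lemma momentBound_mono {β l r : ℝ} {W W' : ℝ≥0∞} (h : W ≤ W') :
    momentBound β l r W ≤ momentBound β l r W' :=
  add_le_add_right h _

end Final

/-- Joint exponential moments in the thin-tailed case. -/
lemma lintegral_eexp_thinTailed_le {𝒳 : Type*} [MeasurableSpace 𝒳] {β r a : ℝ} {R W : ℝ≥0∞}
    {Q : Kernel 𝒳 𝒳} [IsMarkovKernel Q] {Q₀ : Measure 𝒳} [IsProbabilityMeasure Q₀]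
    {f g : 𝒳 → ℝ} {w ℓ : 𝒳 × 𝒳 → ℝ} (hβ₀ : 0 < β) (hβ₁ : β < 1) (hr : 1 < r) (ha : 0 ≤ a)
    (hQ : Q.Invariant Q₀) (hf : Measurable f) (hg : Measurable g) (hw : Measurable w)
    (hfR : ∫⁻ x, eexp (1 * (|f x| / β) ^ r) ∂Q₀ ≤ R)
    (hgR : ∫⁻ x, eexp (1 * (|g x| / β) ^ r) ∂Q₀ ≤ R)
    (hwW : ∫⁻ z, eexp (1 * (|w z| / (1 - β)) ^ r) ∂(Q₀ ⊗ₘ Q) ≤ W)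
    (hlW : ∫⁻ z, eexp (1 * (|w z + ℓ z| / (1 - β)) ^ r) ∂(Q₀ ⊗ₘ Q) ≤ W) :
    ∫⁻ z, eexp (a * (|f z.2| + |g z.2| + (|w z| + |ℓ z|))) ∂(Q₀ ⊗ₘ Q)
      ≤ (expConst (4 * a * β) 1 r * R + expConst (4 * a * β) 1 r * R)
        + (expConst (4 * a * 2 * (1 - β)) 1 r * W + expConst (4 * a * (1 - β)) 1 r * W) := by
  have hδ : 0 < 1 - β := by linarith
  -- `|ℓ| ≤ |w + ℓ| + |w|`: only the moments of `w` and `w + ℓ` are bounded by `W`, which explains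
  -- the doubled `w`.
  calc _ ≤ ∫⁻ z, eexp (a * (|f z.2| + |g z.2| + (|2 * w z| + |w z + ℓ z|))) ∂(Q₀ ⊗ₘ Q) := by
        refine lintegral_mono fun z => eexp_le_eexp (mul_le_mul_of_nonneg_left ?_ ha)
        have h1 : |ℓ z| ≤ |w z + ℓ z| + |w z| := by
          have := abs_sub (w z + ℓ z) (w z)
          rwa [add_sub_cancel_left] at this
        rw [abs_mul 2, abs_two]
        linarith
    _ ≤ _ := lintegral_eexp_four_le hQ hf hg (hw.const_mul 2)
    _ ≤ _ := by
        refine add_le_add (add_le_add ?_ ?_) (add_le_add ?_ ?_)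
        · exact (lintegral_eexp_mul_abs_le (by positivity) hβ₀ one_pos hr).trans (by gcongr)
        · exact (lintegral_eexp_mul_abs_le (by positivity) hβ₀ one_pos hr).trans (by gcongr)
        · have e : ∀ z, 4 * a * |2 * w z| = 4 * a * 2 * |w z| := fun z => by
            rw [abs_mul 2, abs_two]
            ring
          simp only [e]
          exact (lintegral_eexp_mul_abs_le (by positivity) hδ one_pos hr).trans (by gcongr)
        · exact (lintegral_eexp_mul_abs_le (by positivity) hδ one_pos hr).trans (by gcongr)

/-- The perturbation theorem for a thin-tailed log-likelihood ratio. -/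
theorem exists_perturbationBounds_of_thinTailed (α β r M : ℝ) (hβ₀ : 0 < β) (hβ₁ : β < 1)
    (hr : 1 < r) :
    ∃ C : ℝ, 0 < C ∧
      ∀ (𝒳 : Type*) [MeasurableSpace 𝒳] [MeasurableSpace.CountablyGenerated 𝒳]
        (Q Qhat : Kernel 𝒳 𝒳) [IsMarkovKernel Q] [IsMarkovKernel Qhat]
        (Q₀ : Measure 𝒳) [IsProbabilityMeasure Q₀] (u : 𝒳 × 𝒳 → ℝ),
        Q.Invariant Q₀ →
        MemOrliczHeart r u (Q₀ ⊗ₘ Q) →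
        expMoment 1 r (fun z => α / (1 - β) * u z) (Q₀ ⊗ₘ Q) ≤ ENNReal.ofReal M →
        ThinTailed α β r M u Q Qhat Q₀ →
        ∃ v vhat : 𝒳 → ℝ,
          IsValueFunction α β r u Q Q₀ v ∧ IsValueFunction α β r u Qhat Q₀ vhat ∧
          ∀ s : ℝ, 1 ≤ s → s ≤ r → PerturbationBounds α β s C u Q Qhat Q₀ v vhat := by
  have hδ : 0 < 1 - β := by linarith
  have h4 : 0 ≤ 4 / (1 - β) := by positivity
  obtain ⟨R, hRdef⟩ : ∃ R, R = momentBound β 1 r (ENNReal.ofReal M) := ⟨_, rfl⟩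
  have hR : R < ∞ := hRdef ▸ momentBound_lt_top hβ₁ ENNReal.ofReal_lt_top
  have h1 : ∀ a, expConst a 1 r * R < ∞ := fun a => ENNReal.mul_lt_top (eexp_ne_top _).lt_top hR
  have h2 : ∀ a, expConst a 1 r * ENNReal.ofReal M < ∞ := fun a =>
    ENNReal.mul_lt_top (eexp_ne_top _).lt_top ENNReal.ofReal_lt_top
  -- The level is fixed from `β`, `r` and `M` before any model is introduced.
  obtain ⟨K₁, hK₁, hK⟩ := exists_le_eexp (ENNReal.add_lt_top.2
    ⟨ENNReal.add_lt_top.2 ⟨h1 (4 * (4 / (1 - β)) * β), h1 (4 * (4 / (1 - β)) * β)⟩,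
      ENNReal.add_lt_top.2 ⟨h2 (4 * (4 / (1 - β)) * 2 * (1 - β)), h2 (4 * (4 / (1 - β)) * (1 - β))⟩⟩)
  obtain ⟨K, hK₁K, hlogK⟩ : ∃ K, K₁ ≤ K ∧ Real.log 2 ≤ K := ⟨_, le_max_left _ _, le_max_right _ _⟩
  have hK0 : 0 < K := hK₁.trans_le hK₁K
  have hB := perturbConst_pos (A := 1) hβ₁ le_rfl
  refine ⟨perturbConst β 1 * max 1 (K / Real.log 2), by positivity, ?_⟩
  intro 𝒳 _ _ Q Qhat _ _ Q₀ _ u hQ hu huM hthin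
  obtain ⟨hac, hl, -, hlM⟩ := hthin
  obtain ⟨u', hu', huu⟩ := hu.1.1
  have hlm : Measurable (logLik Q Qhat) := measurable_logLik
  have hw : Measurable fun z => α * u' z := by fun_prop
  have hwl : Measurable fun z => α * u' z + logLik Q Qhat z := by fun_prop
  have hQl := eq_withDensity_logLik hac
  have huM' : ∫⁻ z, eexp (1 * (|α * u' z| / (1 - β)) ^ r) ∂(Q₀ ⊗ₘ Q) ≤ ENNReal.ofReal M := by
    rw [← expMoment_one_eq (f := fun z => α / (1 - β) * u z) hδ]
    · exact huM
    · filter_upwards [huu] with z hz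
      rw [hz]
      ring
  have hlM' : ∫⁻ z, eexp (1 * (|α * u' z + logLik Q Qhat z| / (1 - β)) ^ r) ∂(Q₀ ⊗ₘ Q)
      ≤ ENNReal.ofReal M := by
    rw [← expMoment_one_eq (f := fun z => 1 / (1 - β) * (logLik Q Qhat z + α * u z)) hδ]
    · exact hlM
    · filter_upwards [huu] with z hz
      rw [hz]
      ring
  have mu : ∀ l : ℝ, ∫⁻ z, eexp (l * |u' z| ^ r) ∂(Q₀ ⊗ₘ Q) < ∞ := fun l => by
    refine lt_of_eq_of_lt (lintegral_congr_ae ?_) (hu.lintegral_lt_top hr.le l)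
    filter_upwards [huu] with z hz
    rw [hz]
  have mw := lintegral_eexp_const_mul_lt_top α mu
  have ml : ∀ l : ℝ, ∫⁻ z, eexp (l * |logLik Q Qhat z| ^ r) ∂(Q₀ ⊗ₘ Q) < ∞ :=
    fun l => hl.lintegral_lt_top hr.le l
  obtain ⟨v, hv, hvV, fv, mv, mvR⟩ := exists_isValueFunction (Qhat := Q) (ψ := fun _ => 0) hβ₀ hβ₁
    hr hQ (fun _ => .rfl) hu' measurable_const huu (fun x => (withDensity_eexp_zero (Q x)).symm)
    (fun l hl => by
      simp only [add_zero]
      exact lintegral_eexp_div_lt_top hl hδ fun l _ => mw l)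
  obtain ⟨vhat, hvhat, hvhatV, fvhat, mvhat, mvhatR⟩ := exists_isValueFunction (Qhat := Qhat)
    (ψ := logLik Q Qhat) hβ₀ hβ₁ hr hQ (fun x => (hac x).2) hu' hlm huu hQl
    (fun l hl => lintegral_eexp_div_lt_top hl hδ fun l hl =>
      lintegral_eexp_abs_add_lt_top (by linarith) hl hw (fun l _ => mw l) (fun l _ => ml l))
  refine ⟨v, vhat, hvV, hvhatV, fun s hs hsr => ?_⟩
  have mvR' : ∫⁻ x, eexp (1 * (|v x| / β) ^ r) ∂Q₀ ≤ R := by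
    rw [hRdef]
    refine (mvR 1 one_pos).trans (momentBound_mono ?_)
    simp only [add_zero]
    exact huM'
  have mvhatR' : ∫⁻ x, eexp (1 * (|vhat x| / β) ^ r) ∂Q₀ ≤ R := by
    rw [hRdef]
    exact (mvhatR 1 one_pos).trans (momentBound_mono hlM')
  have hΦP : ∫⁻ z, eexp (4 / (1 - β) * (|vhat z.2| + |v z.2| + (|α * u' z| + |logLik Q Qhat z|)))
      ∂(Q₀ ⊗ₘ Q) ≤ eexp K :=
    (lintegral_eexp_thinTailed_le hβ₀ hβ₁ hr h4 hQ hvhat hv hw mvhatR' mvR' huM' hlM').trans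
      (hK.trans (eexp_le_eexp hK₁K))
  have hΦQ : ∫⁻ z, eexp (4 / (1 - β) * (|v z.2| + |α * u' z|)) ∂(Q₀ ⊗ₘ Q) ≤ eexp K :=
    (lintegral_mono fun z => eexp_le_eexp (mul_le_mul_of_nonneg_left (by
      linarith [abs_nonneg (vhat z.2), abs_nonneg (logLik Q Qhat z)]) h4)).trans hΦP
  have hl' : ∃ d, 0 < d ∧ ExpBound K s d (logLik Q Qhat) (Q₀ ⊗ₘ Q) :=
    exists_expBound hs hK0 hlm.aemeasurable
      (lintegral_eexp_rpow_lt_top_of_le (by linarith) hsr (by simpa using ml 1))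
  -- The reference model is `Q` itself, so the transfers are trivial and `A = 1`.
  have bounds := expBound_perturbation (ψ := logLik Q Qhat) (A := 1) hQ hβ₀ hβ₁ hs hK0.le le_rfl hlm
    hlm hw hv hvhat hQl hQl .rfl (fun f c _ _ h => by simpa using h)
    (fun f c _ _ h => by simpa using h) (fun f c _ _ h => by simpa using h) hΦP hΦQ hl' fv fvhat
    (exists_expBound_sub hK0 hs hsr hvhat hv mvhat mv)
  exact perturbationBounds_of_expBound hs hB hlogK hQ (fun x => (hac x).2) hu' huu hv hvhat bounds

/-! ### Transfer of exponential moments between equivalent stationary laws. -/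

section ChangeOfMeasure

variable {Ω : Type*} [MeasurableSpace Ω] {μ ν : Measure Ω} [IsProbabilityMeasure μ]
  [IsProbabilityMeasure ν] {p q M : ℝ}

lemma lintegral_eexp_change_measure_le (hνμ : ν ≪ μ) (hpq : p.HolderConjugate q)
    (hM : ∫⁻ ω, (ν.rnDeriv μ ω) ^ p ∂μ ≤ ENNReal.ofReal M) {X : Ω → ℝ} (hX : Measurable X)
    {W : ℝ≥0∞} (hMW : ENNReal.ofReal M ≤ W) (h : ∫⁻ ω, eexp (1 * X ω) ∂μ ≤ W) :
    ∫⁻ ω, eexp (1 / q * X ω) ∂ν ≤ W := by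
  have hq := hpq.symm.pos
  have hp := hpq.pos
  refine (lintegral_le_of_rnDeriv_rpow hνμ hpq hM (by fun_prop)).trans ?_
  have e : ∀ ω, eexp (1 / q * X ω) ^ q = eexp (1 * X ω) := fun ω => by
    rw [eexp_rpow]
    congr 1
    field_simp
  simp_rw [e]
  calc _ ≤ W ^ (1 / p) * W ^ (1 / q) := by gcongr
    _ = W := by
        rw [← ENNReal.rpow_add_of_nonneg _ _ (by positivity) (by positivity), one_div, one_div,
          hpq.inv_add_inv_eq_one, ENNReal.rpow_one]

lemma lintegral_eexp_change_measure_lt_top (hνμ : ν ≪ μ) (hpq : p.HolderConjugate q)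
    (hM : ∫⁻ ω, (ν.rnDeriv μ ω) ^ p ∂μ ≤ ENNReal.ofReal M) {X : Ω → ℝ} (hX : Measurable X)
    (h : ∀ l : ℝ, 0 < l → ∫⁻ ω, eexp (l * X ω) ∂μ < ∞) {l : ℝ} (hl : 0 < l) :
    ∫⁻ ω, eexp (l * X ω) ∂ν < ∞ := by
  have hq := hpq.symm.pos
  have hp := hpq.pos
  refine (lintegral_le_of_rnDeriv_rpow hνμ hpq hM (by fun_prop)).trans_lt
    (ENNReal.mul_lt_top (ENNReal.rpow_lt_top_of_nonneg (by positivity) ENNReal.ofReal_ne_top)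
      (ENNReal.rpow_lt_top_of_nonneg (by positivity) (ne_of_lt ?_)))
  refine lt_of_eq_of_lt (lintegral_congr fun ω => ?_) (h (l * q) (by positivity))
  rw [eexp_rpow]
  congr 1
  ring

/-- Negative moments of a density are moments of the reciprocal density. -/
lemma lintegral_rnDeriv_symm_rpow_le (hνμ : ν ≪ μ) :
    ∫⁻ ω, (μ.rnDeriv ν ω) ^ p ∂ν ≤ ∫⁻ ω, (ν.rnDeriv μ ω) ^ (1 - p) ∂μ := by
  calc ∫⁻ ω, (μ.rnDeriv ν ω) ^ p ∂ν = ∫⁻ ω, ((ν.rnDeriv μ ω)⁻¹) ^ p ∂ν := by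
        refine lintegral_congr_ae ?_
        filter_upwards [Measure.inv_rnDeriv hνμ] with ω hω
        rw [← hω]
        rfl
    _ = ∫⁻ ω, ν.rnDeriv μ ω * ((ν.rnDeriv μ ω)⁻¹) ^ p ∂μ :=
        (lintegral_rnDeriv_mul hνμ
          ((Measure.measurable_rnDeriv ν μ).inv.pow_const p).aemeasurable).symm
    _ ≤ _ := by
        refine lintegral_mono_ae ?_
        filter_upwards [Measure.rnDeriv_lt_top ν μ] with ω hω
        by_cases h0 : ν.rnDeriv μ ω = 0
        · rw [h0, zero_mul]
          exact zero_le
        · rw [ENNReal.inv_rpow, ← ENNReal.rpow_neg, sub_eq_add_neg, ENNReal.rpow_add _ _ h0 hω.ne,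
            ENNReal.rpow_one]

end ChangeOfMeasure

/-- The perturbation theorem when both models are stationary. -/
theorem exists_perturbationBounds_of_stationary (α β r M p q : ℝ) (hβ₀ : 0 < β) (hβ₁ : β < 1)
    (hr : 1 < r) (hpq : p.HolderConjugate q) :
    ∃ C : ℝ, 0 < C ∧
      ∀ (𝒳 : Type*) [MeasurableSpace 𝒳] [MeasurableSpace.CountablyGenerated 𝒳]
        (Q Qhat : Kernel 𝒳 𝒳) [IsMarkovKernel Q] [IsMarkovKernel Qhat]
        (Q₀ : Measure 𝒳) [IsProbabilityMeasure Q₀] (u : 𝒳 × 𝒳 → ℝ),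
        Q.Invariant Q₀ →
        MemOrliczHeart r u (Q₀ ⊗ₘ Q) →
        expMoment 1 r (fun z => α / (1 - β) * u z) (Q₀ ⊗ₘ Q) ≤ ENNReal.ofReal M →
        StationaryAlternative p M Q Qhat Q₀ →
        ∃ v vhat : 𝒳 → ℝ,
          IsValueFunction α β r u Q Q₀ v ∧ IsValueFunction α β r u Qhat Q₀ vhat ∧
          PerturbationBounds α β 1 C u Q Qhat Q₀ v vhat := by
  have hδ : 0 < 1 - β := by linarith
  have h4 : 0 ≤ 4 / (1 - β) := by positivity
  have hq1 : 1 < q := hpq.symm.lt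
  have hq : 0 < q := by linarith
  obtain ⟨R, hRdef⟩ : ∃ R, R = momentBound β 1 r (ENNReal.ofReal M) := ⟨_, rfl⟩
  obtain ⟨S, hSdef⟩ : ∃ S, S = momentBound β (1 / q) r (ENNReal.ofReal M) := ⟨_, rfl⟩
  have hR : R < ∞ := by
    rw [hRdef]
    exact momentBound_lt_top hβ₁ ENNReal.ofReal_lt_top
  have hS : S < ∞ := by
    rw [hSdef]
    exact momentBound_lt_top hβ₁ ENNReal.ofReal_lt_top
  have hMR : ENNReal.ofReal M ≤ R := by
    rw [hRdef]
    exact le_add_self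
  have fin : ∀ a l X, X < ∞ → expConst a l r * X < ∞ := fun a l X hX =>
    ENNReal.mul_lt_top (eexp_ne_top _).lt_top hX
  obtain ⟨K₁, hK₁, hKP⟩ := exists_le_eexp (ENNReal.add_lt_top.2
    ⟨ENNReal.add_lt_top.2 ⟨fin (4 * (4 / (1 - β)) * β) (1 / q) S hS,
      fin (4 * (4 / (1 - β)) * β) (1 / q) R hR⟩,
      ENNReal.add_lt_top.2 ⟨fin (4 * (4 / (1 - β)) * (1 - β)) (1 / q) _
        (ENNReal.ofReal_lt_top (r := M)), ENNReal.one_lt_top⟩⟩)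
  obtain ⟨K₂, hK₂, hKQ⟩ := exists_le_eexp (ENNReal.add_lt_top.2
    ⟨ENNReal.add_lt_top.2 ⟨fin (3 * (4 / (1 - β)) * β) 1 R hR,
      fin (3 * (4 / (1 - β)) * β) 1 R hR⟩,
      fin (3 * (4 / (1 - β)) * (1 - β)) 1 _ (ENNReal.ofReal_lt_top (r := M))⟩)
  -- Besides the moments, `K` must dominate `log 2` for the Luxemburg norm and `M` for the change of
  -- measure.
  obtain ⟨K, hK₁K, hK₂K, hlogK, hMK⟩ : ∃ K, K₁ ≤ K ∧ K₂ ≤ K ∧ Real.log 2 ≤ K ∧ M ≤ K :=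
    ⟨max (max K₁ K₂) (max (Real.log 2) M), by simp, by simp, by simp, by simp⟩
  have hMK' : M ≤ Real.exp K := by linarith [Real.add_one_le_exp K]
  have hK0 : 0 < K := hK₁.trans_le hK₁K
  have hB := perturbConst_pos (A := q) hβ₁ hq1.le
  refine ⟨perturbConst β q * max 1 (K / Real.log 2), by positivity, ?_⟩
  intro 𝒳 _ _ Q Qhat _ _ Q₀ _ u hQ hu huM hstat
  obtain ⟨hac, hl, P₀, _, hP, hQP, hPQ, hM0, hM1, hM2⟩ := hstat
  obtain ⟨u', hu', huu⟩ := hu.1.1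
  have hlm : Measurable (logLik Q Qhat) := measurable_logLik
  have hw : Measurable fun z => α * u' z := by fun_prop
  have hQl := eq_withDensity_logLik hac
  have hPQ2 : P₀ ⊗ₘ Qhat ≪ Q₀ ⊗ₘ Q :=
    Measure.AbsolutelyContinuous.compProd hPQ (Filter.Eventually.of_forall fun x => (hac x).2)
  have hM1' : ∫⁻ x, (Q₀.rnDeriv P₀ x) ^ p ∂P₀ ≤ ENNReal.ofReal M :=
    (lintegral_rnDeriv_symm_rpow_le hPQ).trans hM1
  have huM' : ∫⁻ z, eexp (1 * (|α * u' z| / (1 - β)) ^ r) ∂(Q₀ ⊗ₘ Q) ≤ ENNReal.ofReal M := by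
    rw [← expMoment_one_eq (f := fun z => α / (1 - β) * u z) hδ]
    · exact huM
    · filter_upwards [huu] with z hz
      rw [hz]
      ring
  have huP : ∫⁻ z, eexp (1 / q * (|α * u' z| / (1 - β)) ^ r) ∂(P₀ ⊗ₘ Qhat) ≤ ENNReal.ofReal M :=
    lintegral_eexp_change_measure_le hPQ2 hpq hM2 (X := fun z => (|α * u' z| / (1 - β)) ^ r)
      (by fun_prop) le_rfl huM'
  have mu : ∀ l : ℝ, ∫⁻ z, eexp (l * |u' z| ^ r) ∂(Q₀ ⊗ₘ Q) < ∞ := fun l => by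
    refine lt_of_eq_of_lt (lintegral_congr_ae ?_) (hu.lintegral_lt_top hr.le l)
    filter_upwards [huu] with z hz
    rw [hz]
  have mw : ∀ l : ℝ, 0 < l → ∫⁻ z, eexp (l * (|α * u' z| / (1 - β)) ^ r) ∂(Q₀ ⊗ₘ Q) < ∞ :=
    fun l hl => lintegral_eexp_div_lt_top hl hδ fun l _ => lintegral_eexp_const_mul_lt_top α mu l
  have mwP : ∀ l : ℝ, 0 < l →
      ∫⁻ z, eexp (l * (|α * u' z + 0| / (1 - β)) ^ r) ∂(P₀ ⊗ₘ Qhat) < ∞ := fun l hl => by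
    simp only [add_zero]
    exact lintegral_eexp_change_measure_lt_top hPQ2 hpq hM2
      (X := fun z => (|α * u' z| / (1 - β)) ^ r) (by fun_prop) mw hl
  obtain ⟨v, hv, hvV, fv, mv, mvR⟩ := exists_isValueFunction (Qhat := Q) (ψ := fun _ => 0) hβ₀ hβ₁
    hr hQ (fun _ => .rfl) hu' measurable_const huu (fun x => (withDensity_eexp_zero (Q x)).symm)
    (fun l hl => by
      simp only [add_zero]
      exact mw l hl)
  -- The fixed point is built under the stationary law of `Qhat`; its moments reach `Q₀` through the
  -- reciprocal density.
  obtain ⟨vhat, hvhat, fvhat, mvhatS⟩ := exists_riskOp_fixedPoint hP hβ₀ hβ₁ hr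
    (w := fun z => α * u' z + 0) (by fun_prop) mwP
  have mvhatP : ∀ l : ℝ, 0 < l → ∫⁻ x, eexp (l * |vhat x| ^ r) ∂P₀ < ∞ := fun l hl =>
    lintegral_eexp_lt_top_of_div hl hβ₀ fun l hl =>
      (mvhatS l hl).trans_lt (momentBound_lt_top hβ₁ (mwP l hl))
  have mvhat : ∀ l : ℝ, 0 < l → ∫⁻ x, eexp (l * |vhat x| ^ r) ∂Q₀ < ∞ := fun l hl =>
    lintegral_eexp_change_measure_lt_top hQP hpq hM1' (X := fun x => |vhat x| ^ r) (by fun_prop)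
      mvhatP hl
  have mvP : ∀ l : ℝ, 0 < l → ∫⁻ x, eexp (l * |v x| ^ r) ∂P₀ < ∞ := fun l hl =>
    lintegral_eexp_change_measure_lt_top hPQ hpq hM0 (X := fun x => |v x| ^ r) (by fun_prop) mv hl
  have hvhatV : IsValueFunction α β r u Qhat Q₀ vhat :=
    isValueFunction_of_reference (ψ := fun _ => 0) hβ₀ hβ₁ hr hQ hP (fun x => (hac x).2) hQP hPQ hu'
      measurable_const huu (fun x => (withDensity_eexp_zero (Qhat x)).symm) mwP
      (fun g s hg h => by
        have := lintegral_eexp_change_measure_lt_top hPQ hpq hM0 (X := fun x => |g x| ^ s)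
          (by fun_prop) h one_pos
        simpa using this)
      hvhat fvhat (by simpa using mvhatP 1 one_pos) mvhat
  refine ⟨v, vhat, hvV, hvhatV, ?_⟩
  have mvR' : ∫⁻ x, eexp (1 * (|v x| / β) ^ r) ∂Q₀ ≤ R := by
    rw [hRdef]
    refine (mvR 1 one_pos).trans (momentBound_mono ?_)
    simp only [add_zero]
    exact huM'
  have mvRP : ∫⁻ x, eexp (1 / q * (|v x| / β) ^ r) ∂P₀ ≤ R :=
    lintegral_eexp_change_measure_le hPQ hpq hM0 (X := fun x => (|v x| / β) ^ r) (by fun_prop)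
      hMR mvR'
  have hq' : 0 < 1 / q := by positivity
  have mvhatS' : ∫⁻ x, eexp (1 / q * (|vhat x| / β) ^ r) ∂P₀ ≤ S := by
    rw [hSdef]
    refine (mvhatS (1 / q) hq').trans (momentBound_mono ?_)
    simp only [add_zero]
    exact huP
  have hΦP : ∫⁻ z, eexp (4 / (1 - β) * (|vhat z.2| + |v z.2| + (|α * u' z| + |(0 : ℝ)|)))
      ∂(P₀ ⊗ₘ Qhat) ≤ eexp K := by
    refine (lintegral_eexp_four_le (w₂ := fun _ => 0) hP hvhat hv hw).trans
      (le_trans (add_le_add (add_le_add ?_ ?_) (add_le_add ?_ ?_))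
        (hKP.trans (eexp_le_eexp hK₁K)))
    · exact (lintegral_eexp_mul_abs_le (by positivity) hβ₀ hq' hr).trans (by gcongr)
    · exact (lintegral_eexp_mul_abs_le (by positivity) hβ₀ hq' hr).trans (by gcongr)
    · exact (lintegral_eexp_mul_abs_le (by positivity) hδ hq' hr).trans (by gcongr)
    · simp [eexp_zero]
  have hΦQ : ∫⁻ z, eexp (4 / (1 - β) * (|v z.2| + |α * u' z|)) ∂(Q₀ ⊗ₘ Q) ≤ eexp K :=
    ((lintegral_mono fun z => eexp_le_eexp (mul_le_mul_of_nonneg_left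
      (by linarith [abs_nonneg (v z.2)]) h4)).trans
      (lintegral_eexp_three_le hQ hβ₀ hβ₁ hr h4 one_pos hv hv mvR' mvR' huM')).trans
      (hKQ.trans (eexp_le_eexp hK₂K))
  obtain ⟨d, hd, hld⟩ := hl.exists_expBound
  have fvhat' : riskOp β (fun z => α * u' z) Qhat vhat =ᵐ[Q₀] vhat := by
    have h := hQP.ae_le fvhat
    simp only [add_zero] at h
    exact h
  -- The reference model is `Qhat` with its stationary law, so `ψ = 0`; the three transfers are
  -- Hölder's inequality with `A = q`.
  have bounds := expBound_perturbation (ψ := fun _ => 0) (A := q) (s := 1) hP hβ₀ hβ₁ le_rfl hK0.le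
    hq1.le hlm measurable_const hw hv hvhat hQl (fun x => (withDensity_eexp_zero (Qhat x)).symm) hPQ
    (fun f c hf _ h => h.change_measure hQP hpq hM1' hMK' hf)
    (fun f c hf _ h => h.change_measure hPQ hpq hM0 hMK' hf)
    (fun f c hf _ h => h.change_measure hPQ2 hpq hM2 hMK' hf) hΦP hΦQ
    ⟨d, hd, hld.mono_level hlogK⟩ fv fvhat'
    (exists_expBound_sub hK0 le_rfl hr.le hvhat hv mvhatP mvP)
  exact perturbationBounds_of_expBound le_rfl hB hlogK hQ (fun x => (hac x).2) hu' huu hv hvhat bounds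

end RobustValue

open RobustValue in
/-- The constant `C` is chosen before the state space, the two models and `u`, so it depends only
on `α`, `β`, `r`, `M`, `K = ‖u‖_{φ_r}` (first part), and in addition on `p` and on
`L = E[exp(q² |α u / (1 - β)| ^ r)]` (second part). -/
theorem lemma5p2 (α β r M K : ℝ) (hβ₀ : 0 < β) (hβ₁ : β < 1) (hr : 1 < r) :
    (∃ C : ℝ, 0 < C ∧
      ∀ (𝒳 : Type*) [MeasurableSpace 𝒳] [MeasurableSpace.CountablyGenerated 𝒳]
        (Q Qhat : Kernel 𝒳 𝒳) [IsMarkovKernel Q] [IsMarkovKernel Qhat]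
        (Q₀ : Measure 𝒳) [IsProbabilityMeasure Q₀] (u : 𝒳 × 𝒳 → ℝ),
        Q.Invariant Q₀ →
        MemOrliczHeart r u (Q₀ ⊗ₘ Q) →
        orliczNorm r u (Q₀ ⊗ₘ Q) = ENNReal.ofReal K →
        expMoment 1 r (fun z => α / (1 - β) * u z) (Q₀ ⊗ₘ Q) ≤ ENNReal.ofReal M →
        ThinTailed α β r M u Q Qhat Q₀ →
        orliczNorm 1 (score Q Qhat) (Q₀ ⊗ₘ Q) ≤ 1 →
        ∃ v vhat : 𝒳 → ℝ,
          IsValueFunction α β r u Q Q₀ v ∧ IsValueFunction α β r u Qhat Q₀ vhat ∧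
          ∀ s : ℝ, 1 ≤ s → s ≤ r → PerturbationBounds α β s C u Q Qhat Q₀ v vhat) ∧
    (∀ p q L : ℝ, p.HolderConjugate q → ∃ C : ℝ, 0 < C ∧
      ∀ (𝒳 : Type*) [MeasurableSpace 𝒳] [MeasurableSpace.CountablyGenerated 𝒳]
        (Q Qhat : Kernel 𝒳 𝒳) [IsMarkovKernel Q] [IsMarkovKernel Qhat]
        (Q₀ : Measure 𝒳) [IsProbabilityMeasure Q₀] (u : 𝒳 × 𝒳 → ℝ),
        Q.Invariant Q₀ →
        MemOrliczHeart r u (Q₀ ⊗ₘ Q) →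
        orliczNorm r u (Q₀ ⊗ₘ Q) = ENNReal.ofReal K →
        expMoment 1 r (fun z => α / (1 - β) * u z) (Q₀ ⊗ₘ Q) ≤ ENNReal.ofReal M →
        expMoment (q ^ 2) r (fun z => α / (1 - β) * u z) (Q₀ ⊗ₘ Q) = ENNReal.ofReal L →
        StationaryAlternative p M Q Qhat Q₀ →
        orliczNorm 1 (score Q Qhat) (Q₀ ⊗ₘ Q) ≤ 1 →
        ∃ v vhat : 𝒳 → ℝ,
          IsValueFunction α β r u Q Q₀ v ∧ IsValueFunction α β r u Qhat Q₀ vhat ∧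
          PerturbationBounds α β 1 C u Q Qhat Q₀ v vhat) := by
  refine ⟨?_, fun p q L hpq => ?_⟩
  · obtain ⟨C, hC, h⟩ := exists_perturbationBounds_of_thinTailed α β r M hβ₀ hβ₁ hr
    exact ⟨C, hC, fun 𝒳 _ _ Q Qhat _ _ Q₀ _ u hQ hu _ huM hthin _ =>
      h 𝒳 Q Qhat Q₀ u hQ hu huM hthin⟩
  · obtain ⟨C, hC, h⟩ := exists_perturbationBounds_of_stationary α β r M p q hβ₀ hβ₁ hr hpq
    exact ⟨C, hC, fun 𝒳 _ _ Q Qhat _ _ Q₀ _ u hQ hu _ huM _ hstat _ =>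
      h 𝒳 Q Qhat Q₀ u hQ hu huM hstat⟩
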